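/- For an even integer $k\ge 4$ and an integer $m\ge 0$ let $$P_{k,m}(z)=\frac12\sum_{\substack{c,d\in\mathbb Z\\ \gcd(c,d)=1}}\frac{e^{2\pi i m\gamma z}}{(cz+d)^k},\qquad \operatorname{Im} z>0,$$ where $\gamma\in \mathrm{SL}(2,\mathbb Z)$ is any matrix with bottom row $(c,d)$. Let $$\mathcal F=\{\operatorname{Im}z>0,\ |z|>1,\ \operatorname{Re} z\in(-\tfrac12,\tfrac12]\}\cup\{|z|=1,\ \arg z\in[\tfrac\pi3,\tfrac\pi2]\},$$ $\mathcal A=\{e^{i\theta}:\theta\in[\frac\pi3,\frac\pi2]\}$, $\mathcal L_\rho=\{\frac12+it: t\ge\frac{\sqrt3}2\}$, $\mathcal L_i=\{it:t\ge1\}$. Zeros are counted with multiplicity, and a zero in $\mathcal F$ is called non-real if it does not lie on $\mathcal A\cup\mathcal L_\rho\cup\mathcal L_i$. Let $0<\alpha<\frac1{4\pi}$ and let $$\Gamma_\alpha=\Bigl\{z=x+iy\in\mathcal F:\ |z|>1,\ 2\pi\alpha y=\frac{\log|z|}{1-|z|^{-2}}\Bigr\}.$$ Put $F(t)=\frac1{4\pi}\,\frac{(\frac14+t^2)\log(\frac14+t^2)}{t\,(t^2-\frac34)}$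 for $t>\frac{\sqrt3}2$. Then there is exactly one $T=F^{-1}(\alpha)>\frac{\sqrt3}2$ with $F(T)=\alpha$, and there is a constant $C(\alpha)>0$, depending only on $\alpha$, such that the following holds whenever $k\to\infty$ through even integers and $m=m(k)\ge 0$ are integers with $m=\alpha k+o(k)$. For all large $k$ the form $P_{k,m}$ has only finitely many zeros in $\mathcal F$. For every $\varepsilon>0$, the number $N_{\Gamma_\alpha,\varepsilon}$ of non-real zeros of $P_{k,m}$ in $\mathcal F$ whose distance from $\Gamma_\alpha$ is at most $\varepsilon$ satisfies $$N_{\Gamma_\alpha,\varepsilon}>C(\alpha)k+o(k),$$ and all but at most $o(k)$ of the zeros of $P_{k,m}$ in $\mathcal F$ that lie neither on $\mathcal A$ nor on $\mathcal L_\rho$ are non-real zeros whose distance from $\Gamma_\alpha$ is at most $\varepsilon$. Moreover, the number of zeros of $P_{k,m}$ on $\mathcal L_\rho$ is equal to $$P_\rho(\alpha)\frac{k}{12}+o(k),\qquad P_\rho(\alpha)=12\left(\frac12-\frac{\alpha}{\frac14+T^2}-\frac1\pi\arctan(2T)\right).$$ The $o(k)$ terms may depend on $\alpha$, on $\varepsilon$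 and on the choice of $m$. -/

import Mathlib

open Filter Asymptotics

noncomputable section

namespace PoincareZeros

/-- The term `exp (2 π i m γ z) / (c z + d) ^ k` attached to a coprime pair `(c, d)`. The matrix
`γ` with bottom row `(c, d)` is the one with top row `(Int.gcdB c d, -Int.gcdA c d)`; it has
determinant one (`topRow_det`) and any other choice gives the same term (`term_eq`). -/
def term (k m : ℕ) (c d : ℤ) (z : ℂ) : ℂ :=
  Complex.exp (2 * Real.pi * Complex.I * m *
      (((Int.gcdB c d : ℂ) * z + ((-Int.gcdA c d : ℤ) : ℂ)) / ((c : ℂ) * z + d))) /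
    ((c : ℂ) * z + d) ^ k

/-- The Poincaré series `P_{k,m}` of the full modular group (only its values on the upper half
plane are meaningful). -/
def poincare (k m : ℕ) (z : ℂ) : ℂ :=
  (1 / 2) * ∑' p : {p : ℤ × ℤ // IsCoprime p.1 p.2}, term k m p.1.1 p.1.2 z

theorem topRow_det {c d : ℤ} (h : IsCoprime c d) :
    Int.gcdB c d * d - (-Int.gcdA c d) * c = 1 := by
  have h1 := Int.gcd_eq_gcd_ab c d
  rw [Int.isCoprime_iff_gcd_eq_one.mp h] at h1
  push_cast at h1
  linarith

theorem term_eq (k m : ℕ) {a b c d : ℤ} (h : a * d - b * c = 1) {z : ℂ} (hz : 0 < z.im) :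
    term k m c d z =
      Complex.exp (2 * Real.pi * Complex.I * m * (((a : ℂ) * z + b) / ((c : ℂ) * z + d))) /
        ((c : ℂ) * z + d) ^ k := by
  have hcop : IsCoprime c d := ⟨-b, a, by linarith⟩
  have hdet := topRow_det hcop
  set a' := Int.gcdB c d with ha'
  set b' := -Int.gcdA c d with hb'
  have hne : (c : ℂ) * z + d ≠ 0 := by
    intro h0
    have him : (c : ℝ) * z.im = 0 := by simpa using congrArg Complex.im h0
    have hc : c = 0 := by
      rcases mul_eq_zero.mp him with h1 | h1
      · exact_mod_cast h1
      · exact absurd h1 hz.ne'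
    subst hc
    have hd : d = 0 := by simpa using h0
    subst hd
    simp at h
  -- the two top rows differ by the multiple `n` of the bottom row
  set n : ℤ := a' * b - a * b' with hn
  have h1 : a' = a - n * c := by rw [hn]; linear_combination a * hdet - a' * h
  have h2 : b' = b - n * d := by rw [hn]; linear_combination b * hdet - b' * h
  have h3 : ((a' : ℂ) * z + (b' : ℤ)) / ((c : ℂ) * z + d) =
      ((a : ℂ) * z + b) / ((c : ℂ) * z + d) - n := by
    rw [h1, h2]
    push_cast
    field_simp
    ring
  unfold term
  rw [← ha', ← hb', h3]
  congr 1
  rw [Complex.exp_eq_exp_iff_exists_int]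
  exact ⟨-(m * n), by push_cast; ring⟩

/-- The fundamental domain of the full modular group. -/
def fundDomain : Set ℂ :=
  {z | 0 < z.im ∧ 1 < ‖z‖ ∧ z.re ∈ Set.Ioc (-(1 / 2) : ℝ) (1 / 2)} ∪
    {z | 0 < z.im ∧ ‖z‖ = 1 ∧ z.arg ∈ Set.Icc (Real.pi / 3) (Real.pi / 2)}

/-- The arc `𝒜`. -/
def arc : Set ℂ :=
  {z | ∃ θ ∈ Set.Icc (Real.pi / 3) (Real.pi / 2), z = Complex.exp (θ * Complex.I)}

/-- The half line `1/2 + i t`, `t ≥ √3/2`. -/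
def lineRho : Set ℂ :=
  {z | ∃ t : ℝ, √3 / 2 ≤ t ∧ z = 1 / 2 + t * Complex.I}

/-- The half line `i t`, `t ≥ 1`. -/
def lineI : Set ℂ :=
  {z | ∃ t : ℝ, 1 ≤ t ∧ z = t * Complex.I}

/-- The curve `Γ_α`. -/
def curve (α : ℝ) : Set ℂ :=
  {z | z ∈ fundDomain ∧ 1 < ‖z‖ ∧
    2 * Real.pi * α * z.im = Real.log ‖z‖ / (1 - ‖z‖ ^ (-2 : ℤ))}

/-- The points of the fundamental domain off the three segments (a zero there is called non-real)
whose Euclidean distance to `Γ_α` is at most `ε`. -/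
def nearCurve (α ε : ℝ) : Set ℂ :=
  {z | z ∈ fundDomain \ (arc ∪ lineRho ∪ lineI) ∧
    Metric.infEDist z (curve α) ≤ ENNReal.ofReal ε}

/-- The number of zeros of `f` in `S`, counted with multiplicity. It is meaningful when `f` is
analytic around `S` and has only finitely many zeros in `S`. -/
def zeroCount (f : ℂ → ℂ) (S : Set ℂ) : ℕ :=
  ∑ᶠ z ∈ S, analyticOrderNatAt f z

/-- `F(t) = (1/(4π)) · (1/4 + t²) log (1/4 + t²) / (t (t² - 3/4))`. -/
def heightFun (t : ℝ) : ℝ :=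
  1 / (4 * Real.pi) * ((1 / 4 + t ^ 2) * Real.log (1 / 4 + t ^ 2) / (t * (t ^ 2 - 3 / 4)))

/-- `P_ρ(α) = 12 (1/2 - α / (1/4 + T²) - arctan (2 T) / π)`, to be used with `T = F⁻¹(α)`. -/
def rhoProportion (α T : ℝ) : ℝ :=
  12 * (1 / 2 - α / (1 / 4 + T ^ 2) - 1 / Real.pi * Real.arctan (2 * T))

end PoincareZeros

end

/-! The proof balances lower bounds for three disjoint families of zeros against one upper bound for
all zeros. The upper bound is the valence inequality `IsCuspidal.sum_order_le`: the orders of the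
zeros in the fundamental domain, each divided by half the order of the stabiliser, add up to at most
k/12. The families have about (1/12 - α) k members on the open arc, C k near the curve and P_ρ k/12
on the line Re z = 1/2. Since C + P_ρ/12 = α, they use up k/12 to within o(k). Hence no family can
be larger than exhibited and only o(k) zeros are left for all other places
(`IsCuspidal.zeroCount_le`, `eventually_zeroCount_bounds`).

The lower bounds rest on the size exp(-2πmy/r²) r^(-k) of a term, where r = |cz+d| and y = Im z. The
condition α < 1/(4π) makes this decay exponentially in k once r exceeds |z| by a fixed factor. So,
up to sign, only the pairs (0,1) and (1,0) matter for |z| ≥ 1 away from Re z = ±1/2, joined by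
(1,-1) on Re z = 1/2 (`exists_approx_inner`, `exists_approx_edge`). On the arc the two main terms
become conjugate after multiplication by z^(k/2). Their sum is a multiple of a cosine whose phase
changes by π(k/12 - m) (`exists_zeros_arc`). On Re z = 1/2 the terms of (1,0) and (1,-1) are
conjugate. They dominate that of (0,1) above the height T where the curve meets the line, and again
give a cosine (`exists_zeros_lineRho`). The quotient of the terms of (0,1) and (1,0) is exp(k ·
phase), of modulus one on the curve in the limit m/k → α. Zeros appear where the phase is close to
an odd multiple of πi/k. On the right half of the curve the phase runs through an imaginary interval
of length πC, and reflection in the imaginary axis doubles the count (`exists_zeros_nearCurve`).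

The valence inequality comes from Jensen's formula for f as a function of q = exp(2πiz) on |q| =
exp(-2πy), as y → 0. The bound |f| ≤ B y^(-l), with k = 2l, makes the circle mean at most l log(1/y)
+ O(1). A zero z contributes through its whole orbit, with weights Im z/|cz+d|² - y. Counting
lattice points in ellipses evaluates the sum over all (c,d), and passing to coprime pairs costs ζ(2)
= π²/6. Comparing the coefficients of log(1/y) gives k/12. -/

namespace PoincareZeros

/-! ### The Poincaré series: convergence, modularity, reflection and growth. -/

/-- The coprime pairs indexing the Poincaré series. -/
abbrev CoprimePair : Type := {p : ℤ × ℤ // IsCoprime p.1 p.2}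

/-- The norm `max |c| |d|` of a coprime pair. -/
noncomputable def pairNorm (c d : ℤ) : ℝ := ‖![c, d]‖

theorem denom_ne_zero {c d : ℤ} (h : IsCoprime c d) {z : ℂ} (hz : 0 < z.im) :
    (c : ℂ) * z + d ≠ 0 := by
  intro h0
  have him : (c : ℝ) * z.im = 0 := by simpa using congrArg Complex.im h0
  have hc : c = 0 := by
    rcases mul_eq_zero.mp him with h1 | h1
    · exact_mod_cast h1
    · exact absurd h1 hz.ne'
  subst hc
  have hd : d = 0 := by simpa using h0
  subst hd
  exact not_isCoprime_zero_zero h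

theorem moebius_im {a b c d : ℤ} (h : a * d - b * c = 1) (z : ℂ) :
    (((a : ℂ) * z + b) / ((c : ℂ) * z + d)).im = z.im / ‖(c : ℂ) * z + d‖ ^ 2 := by
  have h' : (a : ℝ) * d - b * c = 1 := by exact_mod_cast h
  rw [Complex.div_im, ← Complex.normSq_eq_norm_sq]
  simp only [Complex.add_re, Complex.add_im, Complex.mul_re, Complex.mul_im, Complex.intCast_re,
    Complex.intCast_im]
  rw [div_sub_div_same]
  congr 1
  linear_combination z.im * h'

theorem norm_exp_moebius {a b c d : ℤ} (h : a * d - b * c = 1) (m : ℕ) (z : ℂ) :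
    ‖Complex.exp (2 * Real.pi * Complex.I * m * (((a : ℂ) * z + b) / ((c : ℂ) * z + d)))‖ =
      Real.exp (-(2 * Real.pi * m * (z.im / ‖(c : ℂ) * z + d‖ ^ 2))) := by
  rw [Complex.norm_exp, ← moebius_im h]
  congr 1
  set w := ((a : ℂ) * z + b) / ((c : ℂ) * z + d)
  simp [Complex.mul_re, Complex.mul_im]

theorem norm_term (k m : ℕ) {c d : ℤ} (h : IsCoprime c d) (z : ℂ) :
    ‖term k m c d z‖ =
      Real.exp (-(2 * Real.pi * m * (z.im / ‖(c : ℂ) * z + d‖ ^ 2))) /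
        ‖(c : ℂ) * z + d‖ ^ k := by
  unfold term
  rw [norm_div, norm_pow, norm_exp_moebius (topRow_det h)]

theorem norm_term_le (k m : ℕ) {c d : ℤ} (h : IsCoprime c d) {z : ℂ} (hz : 0 < z.im) :
    ‖term k m c d z‖ ≤ 1 / ‖(c : ℂ) * z + d‖ ^ k := by
  rw [norm_term k m h]
  gcongr
  rw [Real.exp_le_one_iff]
  have := Real.pi_pos
  have : 0 ≤ 2 * Real.pi * m * (z.im / ‖(c : ℂ) * z + d‖ ^ 2) := by positivity
  linarith

/-- One constant serves a whole half strip. This gives a common summable majorant for local uniform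
convergence, for the growth bound and for the tail estimates. -/
theorem exists_mul_pairNorm_le (A : ℝ) {B : ℝ} (hB : 0 < B) :
    ∃ r > 0, ∀ z : ℂ, |z.re| ≤ A → B ≤ z.im → ∀ c d : ℤ,
      r * pairNorm c d ≤ ‖(c : ℂ) * z + d‖ := by
  refine ⟨EisensteinSeries.r ⟨⟨A, B⟩, hB⟩, EisensteinSeries.r_pos _, fun z h1 h2 c d => ?_⟩
  by_cases hx : ![c, d] = 0
  · simp [pairNorm, hx]
  · have h3 := EisensteinSeries.r_mul_max_le ⟨z, hB.trans_le h2⟩ hx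
    refine le_trans ?_ (by simpa using h3)
    exact mul_le_mul_of_nonneg_right
      (EisensteinSeries.r_lower_bound_on_verticalStrip ⟨z, hB.trans_le h2⟩ hB ⟨h1, h2⟩)
      (norm_nonneg _)

theorem one_le_pairNorm {c d : ℤ} (h : IsCoprime c d) : 1 ≤ pairNorm c d := by
  rw [pairNorm, EisensteinSeries.norm_eq_max_natAbs]
  simp only [Matrix.cons_val_zero, Matrix.cons_val_one]
  norm_cast
  by_contra! h0
  have : c = 0 ∧ d = 0 := by omega
  rw [this.1, this.2] at h
  exact not_isCoprime_zero_zero h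

theorem summable_pairNorm : Summable fun p : CoprimePair => 1 / pairNorm p.1.1 p.1.2 ^ 3 := by
  have h := EisensteinSeries.summable_one_div_norm_rpow (k := 3) (by norm_num)
  rw [← (finTwoArrowEquiv ℤ).symm.summable_iff] at h
  refine (h.subtype {p : ℤ × ℤ | IsCoprime p.1 p.2}).congr fun p => ?_
  simp only [Function.comp, finTwoArrowEquiv_symm_apply, pairNorm]
  rw [Real.rpow_neg (norm_nonneg _), one_div]
  norm_cast

/-- A nonzero integer pair has norm at least one, so the convergent exponent 3 majorises every
larger weight. -/
theorem one_div_norm_pow_le {k : ℕ} (hk : 3 ≤ k) {r : ℝ} (hr : 0 < r) {c d : ℤ}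
    (h : IsCoprime c d) {w : ℝ} (hw : r * pairNorm c d ≤ w) :
    1 / w ^ k ≤ 1 / r ^ k * (1 / pairNorm c d ^ 3) := by
  have h1 := one_le_pairNorm h
  rw [one_div_mul_one_div]
  refine one_div_le_one_div_of_le (by positivity) ?_
  calc r ^ k * pairNorm c d ^ 3 ≤ r ^ k * pairNorm c d ^ k := by gcongr
    _ = (r * pairNorm c d) ^ k := (mul_pow _ _ _).symm
    _ ≤ w ^ k := by gcongr

theorem summable_term {k : ℕ} (hk : 3 ≤ k) (m : ℕ) {z : ℂ} (hz : 0 < z.im) :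
    Summable fun p : CoprimePair => term k m p.1.1 p.1.2 z := by
  obtain ⟨r, hr, hb⟩ := exists_mul_pairNorm_le |z.re| hz
  refine Summable.of_norm_bounded (summable_pairNorm.mul_left (1 / r ^ k)) fun p => ?_
  exact (norm_term_le k m p.2 hz).trans
    (one_div_norm_pow_le hk hr p.2 (hb z le_rfl le_rfl _ _))

theorem differentiableAt_term (k m : ℕ) {c d : ℤ} (h : IsCoprime c d) {z : ℂ} (hz : 0 < z.im) :
    DifferentiableAt ℂ (term k m c d) z := by
  have h0 := denom_ne_zero h hz
  have h1 : DifferentiableAt ℂ (fun z : ℂ => (c : ℂ) * z + d) z := by fun_prop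
  unfold term
  refine DifferentiableAt.div ?_ (h1.pow k) (pow_ne_zero _ h0)
  refine DifferentiableAt.cexp (DifferentiableAt.const_mul (DifferentiableAt.div ?_ h1 h0) _)
  fun_prop

theorem isOpen_upper : IsOpen {z : ℂ | 0 < z.im} :=
  isOpen_lt continuous_const Complex.continuous_im

theorem differentiableOn_poincare {k : ℕ} (hk : 3 ≤ k) (m : ℕ) :
    DifferentiableOn ℂ (poincare k m) {z : ℂ | 0 < z.im} := by
  intro z hz
  obtain ⟨r, hr, hb⟩ := exists_mul_pairNorm_le (|z.re| + 1) (half_pos hz)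
  set U : Set ℂ := {w : ℂ | |w.re| < |z.re| + 1 ∧ z.im / 2 < w.im}
  have hU : IsOpen U := by
    refine IsOpen.and ?_ ?_
    · exact isOpen_lt (Complex.continuous_re.abs) continuous_const
    · exact isOpen_lt continuous_const Complex.continuous_im
  have hzU : z ∈ U := ⟨by linarith, by simpa using hz⟩
  have hUpos : ∀ w ∈ U, 0 < w.im := fun w hw => (half_pos hz).trans hw.2
  have h := Complex.differentiableOn_tsum_of_summable_norm
    (summable_pairNorm.mul_left (1 / r ^ k))
    (F := fun (p : CoprimePair) w => term k m p.1.1 p.1.2 w)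
    (fun p w hw => (differentiableAt_term k m p.2 (hUpos w hw)).differentiableWithinAt) hU
    (fun p w hw => (norm_term_le k m p.2 (hUpos w hw)).trans
      (one_div_norm_pow_le hk hr p.2 (hb w hw.1.le hw.2.le _ _)))
  exact ((h.differentiableAt (hU.mem_nhds hzU)).const_mul (1 / 2)).differentiableWithinAt

/-- Right multiplication of a coprime pair by a matrix of determinant one. -/
def pairMul {a b c d : ℤ} (h : a * d - b * c = 1) : CoprimePair ≃ CoprimePair where
  toFun p := ⟨(p.1.1 * a + p.1.2 * c, p.1.1 * b + p.1.2 * d), by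
    obtain ⟨u, v, huv⟩ := p.2
    exact ⟨u * d - v * b, v * a - u * c, by linear_combination huv + (u * p.1.1 + v * p.1.2) * h⟩⟩
  invFun p := ⟨(p.1.1 * d - p.1.2 * c, p.1.2 * a - p.1.1 * b), by
    obtain ⟨u, v, huv⟩ := p.2
    exact ⟨u * a + v * b, u * c + v * d, by linear_combination huv + (u * p.1.1 + v * p.1.2) * h⟩⟩
  left_inv p := by
    ext
    · show (p.1.1 * a + p.1.2 * c) * d - (p.1.1 * b + p.1.2 * d) * c = p.1.1
      linear_combination p.1.1 * h
    · show (p.1.1 * b + p.1.2 * d) * a - (p.1.1 * a + p.1.2 * c) * b = p.1.2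
      linear_combination p.1.2 * h
  right_inv p := by
    ext
    · show (p.1.1 * d - p.1.2 * c) * a + (p.1.2 * a - p.1.1 * b) * c = p.1.1
      linear_combination p.1.1 * h
    · show (p.1.1 * d - p.1.2 * c) * b + (p.1.2 * a - p.1.1 * b) * d = p.1.2
      linear_combination p.1.2 * h

theorem moebius_im_pos {a b c d : ℤ} (h : a * d - b * c = 1) {z : ℂ} (hz : 0 < z.im) :
    0 < (((a : ℂ) * z + b) / ((c : ℂ) * z + d)).im := by
  have hcop : IsCoprime c d := ⟨-b, a, by linarith⟩
  rw [moebius_im h]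
  have := norm_pos_iff.mpr (denom_ne_zero hcop hz)
  positivity

/-- If γ' has bottom row p, then γ'γ has bottom row pγ, and the denominators multiply as a cocycle.
The top row of γ'γ need not be the one chosen in `term`; `term_eq` makes this harmless. -/
theorem term_moebius (k m : ℕ) {a b c d : ℤ} (h : a * d - b * c = 1) {z : ℂ} (hz : 0 < z.im)
    (p : CoprimePair) :
    term k m p.1.1 p.1.2 (((a : ℂ) * z + b) / ((c : ℂ) * z + d)) =
      ((c : ℂ) * z + d) ^ k * term k m (pairMul h p).1.1 (pairMul h p).1.2 z := by
  have hcop : IsCoprime c d := ⟨-b, a, by linarith⟩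
  have h0 := denom_ne_zero hcop hz
  obtain ⟨⟨e, f⟩, hp⟩ := p
  have hp2 := (pairMul h ⟨(e, f), hp⟩).2
  have h1 := denom_ne_zero hp2 hz
  have hdet := topRow_det hp
  set x := Int.gcdB e f
  set y := -Int.gcdA e f
  have hdet2 : (x * a + y * c) * (e * b + f * d) - (x * b + y * d) * (e * a + f * c) = 1 := by
    linear_combination hdet + (x * f - y * e) * h
  have hw := denom_ne_zero hp (moebius_im_pos h hz)
  have hq : (e : ℂ) * (((a : ℂ) * z + b) / ((c : ℂ) * z + d)) + f =
      (((e * a + f * c : ℤ) : ℂ) * z + (e * b + f * d : ℤ)) / ((c : ℂ) * z + d) := by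
    rw [eq_div_iff h0, add_mul, mul_assoc, div_mul_cancel₀ _ h0]
    push_cast
    ring
  have hq2 : (x : ℂ) * (((a : ℂ) * z + b) / ((c : ℂ) * z + d)) + y =
      (((x * a + y * c : ℤ) : ℂ) * z + (x * b + y * d : ℤ)) / ((c : ℂ) * z + d) := by
    rw [eq_div_iff h0, add_mul, mul_assoc, div_mul_cancel₀ _ h0]
    push_cast
    ring
  rw [term_eq k m hdet (moebius_im_pos h hz)]
  show _ = _ * term k m (e * a + f * c) (e * b + f * d) z
  rw [term_eq k m hdet2 hz, hq, hq2, div_div_div_cancel_right₀ h0, div_pow]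
  have h1' : ((e * a + f * c : ℤ) : ℂ) * z + (e * b + f * d : ℤ) ≠ 0 := h1
  field_simp

theorem poincare_moebius (k m : ℕ) {a b c d : ℤ} (h : a * d - b * c = 1) {z : ℂ}
    (hz : 0 < z.im) :
    poincare k m (((a : ℂ) * z + b) / ((c : ℂ) * z + d)) =
      ((c : ℂ) * z + d) ^ k * poincare k m z := by
  unfold poincare
  rw [tsum_congr (term_moebius k m h hz), tsum_mul_left,
    (pairMul h).tsum_eq (fun p : CoprimePair => term k m p.1.1 p.1.2 z)]
  ring

/-- The involution `(c, d) ↦ (-c, d)` of coprime pairs. -/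
def pairNegLeft : CoprimePair ≃ CoprimePair where
  toFun p := ⟨(-p.1.1, p.1.2), p.2.neg_left⟩
  invFun p := ⟨(-p.1.1, p.1.2), p.2.neg_left⟩
  left_inv p := by ext <;> simp
  right_inv p := by ext <;> simp

/-- The reflection z ↦ -z̄ conjugates a matrix (a, b; c, d) into (a, -b; -c, d). Summed up, this
makes the series real on the symmetric lines and lets zeros be reflected. -/
theorem term_neg_conj (k m : ℕ) {z : ℂ} (hz : 0 < z.im) (p : CoprimePair) :
    term k m p.1.1 p.1.2 (-starRingEnd ℂ z) =
      starRingEnd ℂ (term k m (pairNegLeft p).1.1 (pairNegLeft p).1.2 z) := by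
  obtain ⟨⟨c, d⟩, hp⟩ := p
  have hdet := topRow_det hp
  show term k m c d _ = starRingEnd ℂ (term k m (-c) d z)
  have hz' : 0 < (-starRingEnd ℂ z).im := by simpa using hz
  set a := Int.gcdB c d
  set b := -Int.gcdA c d
  rw [term_eq k m hdet hz', term_eq k m (a := a) (b := -b) (by linarith) hz]
  rw [map_div₀, map_pow, ← Complex.exp_conj]
  congr 2
  · simp only [map_mul, map_div₀, map_add, map_ofNat, Complex.conj_ofReal, Complex.conj_I,
      map_natCast, map_intCast, Int.cast_neg, map_neg]
    rw [show (a : ℂ) * -starRingEnd ℂ z + b = - (a * starRingEnd ℂ z + -b) by ring,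
      show (c : ℂ) * -starRingEnd ℂ z + d = -c * starRingEnd ℂ z + d by ring]
    ring
  · simp

theorem poincare_neg_conj (k m : ℕ) {z : ℂ} (hz : 0 < z.im) :
    poincare k m (-starRingEnd ℂ z) = starRingEnd ℂ (poincare k m z) := by
  unfold poincare
  rw [tsum_congr (term_neg_conj k m hz), map_mul, Complex.conj_tsum,
    pairNegLeft.tsum_eq (fun p : CoprimePair => starRingEnd ℂ (term k m p.1.1 p.1.2 z))]
  simp [map_ofNat]

theorem term_neg {k : ℕ} (hk : Even k) (m : ℕ) {c d : ℤ} (h : IsCoprime c d) {z : ℂ}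
    (hz : 0 < z.im) : term k m (-c) (-d) z = term k m c d z := by
  have hdet := topRow_det h
  set a := Int.gcdB c d
  set b := -Int.gcdA c d
  rw [term_eq k m hdet hz, term_eq k m (a := -a) (b := -b) (by linarith) hz]
  push_cast
  rw [show -(c : ℂ) * z + -d = -(c * z + d) by ring,
    show -(a : ℂ) * z + -b = -(a * z + b) by ring, neg_div_neg_eq, hk.neg_pow]

/-- For c = 0 the factor exp(-2πmy) with m ≥ 1 beats y^l, since y^l ≤ l! e^y. For c ≠ 0 one has
|cz+d| ≥ y, so 2l - 3 powers of the denominator absorb y^l and three remain for the summation. -/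
theorem norm_term_mul_pow_le {l m : ℕ} (hl : 3 ≤ l) (hm : 1 ≤ m) {r : ℝ} (hr : 0 < r) {z : ℂ}
    (hz : 1 / 2 ≤ z.im) {c d : ℤ} (h : IsCoprime c d)
    (hb : r * pairNorm c d ≤ ‖(c : ℂ) * z + d‖) :
    ‖term (2 * l) m c d z‖ * z.im ^ l ≤
      (l.factorial + 2 ^ (l - 3) / r ^ 3) * (1 / pairNorm c d ^ 3) := by
  have hz0 : 0 < z.im := by linarith
  have hN := one_le_pairNorm h
  have hw := norm_pos_iff.mpr (denom_ne_zero h hz0)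
  by_cases hc : c = 0
  · subst hc
    have hu := h
    rw [isCoprime_zero_left, Int.isUnit_iff] at hu
    have hd : |d| = 1 := by
      rcases hu with rfl | rfl <;> simp
    have hd' : ‖((0 : ℤ) : ℂ) * z + d‖ = 1 := by
      have : ((|d| : ℤ) : ℝ) = 1 := by rw [hd]; simp
      simpa [Complex.norm_intCast] using this
    have hN1 : pairNorm 0 d = 1 := by
      rw [pairNorm, EisensteinSeries.norm_eq_max_natAbs]
      simp only [Matrix.cons_val_zero, Matrix.cons_val_one]
      rcases hu with rfl | rfl <;> simp
    rw [norm_term _ _ h, hd', hN1]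
    have h1 := Real.pow_div_factorial_le_exp z.im hz0.le l
    rw [div_le_iff₀ (by positivity)] at h1
    have hm' : (1 : ℝ) ≤ m := by exact_mod_cast hm
    have h2 : z.im ≤ 2 * Real.pi * m * z.im := by
      have := Real.pi_gt_three
      have : 1 ≤ 2 * Real.pi * m := by nlinarith
      nlinarith
    have h3 : Real.exp (-(2 * Real.pi * m * z.im)) * Real.exp z.im ≤ 1 := by
      rw [← Real.exp_add, Real.exp_le_one_iff]; linarith
    have h4 : (0 : ℝ) ≤ 2 ^ (l - 3) / r ^ 3 := by positivity
    simp only [one_pow, div_one, mul_one]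
    calc Real.exp (-(2 * Real.pi * m * z.im)) * z.im ^ l
        ≤ Real.exp (-(2 * Real.pi * m * z.im)) * (Real.exp z.im * l.factorial) := by gcongr
      _ = (Real.exp (-(2 * Real.pi * m * z.im)) * Real.exp z.im) * l.factorial := by ring
      _ ≤ 1 * l.factorial := by gcongr
      _ ≤ _ := by linarith
  · have h1 := norm_term_le (2 * l) m h hz0
    set w := ‖(c : ℂ) * z + d‖ with hwdef
    have h2 : z.im ≤ w := by
      have h3 := Complex.abs_im_le_norm ((c : ℂ) * z + d)
      have h4 : ((c : ℂ) * z + d).im = c * z.im := by simp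
      rw [h4, abs_mul, abs_of_pos hz0] at h3
      have h5 : (1 : ℝ) ≤ |(c : ℝ)| := by exact_mod_cast Int.one_le_abs hc
      nlinarith
    have h3 : z.im ^ (2 * l - 3) * (r * pairNorm c d) ^ 3 ≤ w ^ (2 * l) := by
      calc z.im ^ (2 * l - 3) * (r * pairNorm c d) ^ 3 ≤ w ^ (2 * l - 3) * w ^ 3 := by gcongr
        _ = w ^ (2 * l) := by rw [← pow_add]; congr 1; omega
    -- The factor 2^(l-3) compensates for heights between 1/2 and 1, where a larger exponent gives a
    -- smaller power.
    have h4 : z.im ^ l ≤ 2 ^ (l - 3) * z.im ^ (2 * l - 3) := by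
      have : 1 ≤ (2 * z.im) ^ (l - 3) := one_le_pow₀ (by linarith)
      calc z.im ^ l ≤ (2 * z.im) ^ (l - 3) * z.im ^ l := le_mul_of_one_le_left (by positivity) this
        _ = 2 ^ (l - 3) * z.im ^ (2 * l - 3) := by
          rw [mul_pow, mul_assoc, ← pow_add]; congr 2; omega
    calc ‖term (2 * l) m c d z‖ * z.im ^ l
        ≤ 1 / w ^ (2 * l) * (2 ^ (l - 3) * z.im ^ (2 * l - 3)) := by gcongr
      _ ≤ 1 / (z.im ^ (2 * l - 3) * (r * pairNorm c d) ^ 3) *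
            (2 ^ (l - 3) * z.im ^ (2 * l - 3)) := by gcongr
      _ = 2 ^ (l - 3) / r ^ 3 * (1 / pairNorm c d ^ 3) := by field_simp
      _ ≤ _ := by gcongr; linarith [(Nat.cast_nonneg l.factorial : (0 : ℝ) ≤ _)]

/-- The function |f| y^l is invariant under the modular group, so a bound on the standard
fundamental domain is a bound everywhere. -/
theorem exists_norm_poincare_mul_pow_le {l m : ℕ} (hl : 3 ≤ l) (hm : 1 ≤ m) :
    ∃ B : ℝ, ∀ z : ℂ, 0 < z.im → ‖poincare (2 * l) m z‖ * z.im ^ l ≤ B := by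
  obtain ⟨r, hr, hb⟩ := exists_mul_pairNorm_le (1 / 2) (B := 1 / 2) (by norm_num)
  set K : ℝ := l.factorial + 2 ^ (l - 3) / r ^ 3
  set B : ℝ := 1 / 2 * ∑' p : CoprimePair, K * (1 / pairNorm p.1.1 p.1.2 ^ 3)
  have key : ∀ z : ℂ, |z.re| ≤ 1 / 2 → 1 / 2 ≤ z.im → ‖poincare (2 * l) m z‖ * z.im ^ l ≤ B := by
    intro z h1 h2
    have hz0 : 0 < z.im := by linarith
    have hs := (summable_term (k := 2 * l) (by omega) m hz0).norm
    unfold poincare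
    rw [norm_mul, mul_assoc]
    have : ‖(1 / 2 : ℂ)‖ = 1 / 2 := by norm_num
    rw [this]
    refine mul_le_mul_of_nonneg_left ?_ (by norm_num)
    calc _ ≤ (∑' p : CoprimePair, ‖term (2 * l) m p.1.1 p.1.2 z‖) * z.im ^ l := by
          gcongr; exact norm_tsum_le_tsum_norm hs
      _ = ∑' p : CoprimePair, ‖term (2 * l) m p.1.1 p.1.2 z‖ * z.im ^ l := tsum_mul_right.symm
      _ ≤ _ := (hs.mul_right _).tsum_le_tsum
          (fun p => norm_term_mul_pow_le hl hm hr h2 p.2 (hb z h1 h2 _ _))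
          (summable_pairNorm.mul_left K)
  refine ⟨B, fun z hz => ?_⟩
  obtain ⟨g, hg⟩ := ModularGroup.exists_smul_mem_fd ⟨z, hz⟩
  have hdet : g 0 0 * g 1 1 - g 0 1 * g 1 0 = 1 := by
    rw [← Matrix.det_fin_two]; exact g.det_coe
  have hcop : IsCoprime (g 1 0) (g 1 1) := ⟨-g 0 1, g 0 0, by linarith⟩
  have hw := norm_pos_iff.mpr (denom_ne_zero hcop hz)
  set w : ℂ := ((g 0 0 : ℂ) * z + g 0 1) / ((g 1 0 : ℂ) * z + g 1 1) with hwdef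
  have hcoe : ((g • (⟨z, hz⟩ : UpperHalfPlane) : UpperHalfPlane) : ℂ) = w := by
    rw [UpperHalfPlane.specialLinearGroup_apply]
    simp [hwdef]
  have hre : |w.re| ≤ 1 / 2 := by rw [← hcoe]; exact hg.2
  have him : 1 / 2 ≤ w.im := by
    have h1 := ModularGroup.three_le_four_mul_im_sq_of_mem_fd hg
    have h2 := (g • (⟨z, hz⟩ : UpperHalfPlane)).im_pos
    have h3 : (g • (⟨z, hz⟩ : UpperHalfPlane)).im = w.im := by rw [← hcoe]; rfl
    rw [h3] at h1 h2
    nlinarith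
  have h := key w hre him
  rw [hwdef, poincare_moebius _ _ hdet hz, moebius_im hdet, norm_mul, norm_pow] at h
  refine le_trans (le_of_eq ?_) h
  rw [div_pow, ← pow_mul]
  field_simp

/-! ### Lattice points in ellipses and the logarithmic growth of the orbit sum. -/

open MeasureTheory in
theorem volume_real_ellipse {z : ℂ} (hz : 0 < z.im) :
    volume.real {v : Fin 2 → ℝ | ‖(v 0 : ℂ) * z + v 1‖ < 1} = Real.pi / z.im := by
  set M : (Fin 2 → ℝ) →ₗ[ℝ] (Fin 2 → ℝ) := Matrix.toLin' !![z.re, 1; z.im, 0]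
  have hdet : LinearMap.det M = -z.im := by
    rw [LinearMap.det_toLin', Matrix.det_fin_two_of]; ring
  have hset : {v : Fin 2 → ℝ | ‖(v 0 : ℂ) * z + v 1‖ < 1} =
      M ⁻¹' (Complex.measurableEquivPi.symm ⁻¹' Metric.ball 0 1) := by
    ext v
    have : (v 0 : ℂ) * z + v 1 = Complex.measurableEquivPi.symm (M v) := by
      rw [Complex.measurableEquivPi_symm_apply]
      apply Complex.ext <;> simp [M, Matrix.mulVec, dotProduct, Fin.sum_univ_two] <;> ring
    simp [this]
  rw [hset, measureReal_def, Measure.addHaar_preimage_linearMap _ (by rw [hdet]; simpa using hz.ne'),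
    (Complex.volume_preserving_equiv_pi.symm).measure_preimage
      Metric.isOpen_ball.measurableSet.nullMeasurableSet, Complex.volume_ball, hdet]
  rw [ENNReal.toReal_mul, ENNReal.toReal_ofReal (abs_nonneg _)]
  simp [abs_of_pos hz, NNReal.coe_real_pi]
  ring

-- The points with |cz+d| < x are the integer points of the x-fold dilate of a convex ellipse of
-- area π / Im z.
open scoped Pointwise in
theorem tendsto_card_lattice {z : ℂ} (hz : 0 < z.im) :
    Tendsto (fun x : ℝ => (Nat.card {p : ℤ × ℤ | ‖(p.1 : ℂ) * z + p.2‖ < x} : ℝ) / x ^ 2) atTop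
      (nhds (Real.pi / z.im)) := by
  set s : Set (Fin 2 → ℝ) := {v : Fin 2 → ℝ | ‖(v 0 : ℂ) * z + v 1‖ < 1} with hs
  have hcont : Continuous fun v : Fin 2 → ℝ => (v 0 : ℂ) * z + v 1 := by fun_prop
  have hsopen : IsOpen s := isOpen_lt hcont.norm continuous_const
  have hbd : Bornology.IsBounded s := by
    refine (Metric.isBounded_iff_subset_closedBall 0).mpr
      ⟨1 / z.im + (1 + ‖z‖ / z.im), fun v hv => ?_⟩
    rw [mem_closedBall_zero_iff, pi_norm_le_iff_of_nonneg (by positivity)]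
    have hv' : ‖(v 0 : ℂ) * z + v 1‖ < 1 := hv
    have h1 : |v 0| ≤ 1 / z.im := by
      have h2 := (Complex.abs_im_le_norm ((v 0 : ℂ) * z + v 1)).trans hv'.le
      rw [show ((v 0 : ℂ) * z + v 1).im = v 0 * z.im by simp, abs_mul, abs_of_pos hz] at h2
      rwa [le_div_iff₀ hz]
    have h2 : |v 1| ≤ 1 + ‖z‖ / z.im := by
      have h3 : ((v 1 : ℝ) : ℂ) = ((v 0 : ℂ) * z + v 1) - v 0 * z := by ring
      have h4 : ‖((v 1 : ℝ) : ℂ)‖ ≤ ‖(v 0 : ℂ) * z + v 1‖ + ‖(v 0 : ℂ) * z‖ := by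
        conv_lhs => rw [h3]
        exact norm_sub_le _ _
      rw [norm_mul, Complex.norm_real, Complex.norm_real, Real.norm_eq_abs, Real.norm_eq_abs] at h4
      have h5 : |v 0| * ‖z‖ ≤ 1 / z.im * ‖z‖ := by gcongr
      have h6 : 1 / z.im * ‖z‖ = ‖z‖ / z.im := by ring
      linarith
    have h3 : 0 ≤ 1 / z.im := by positivity
    have h4 : 0 ≤ ‖z‖ / z.im := by positivity
    intro i
    fin_cases i
    · show |v 0| ≤ _
      linarith
    · show |v 1| ≤ _
      linarith
  have hconv : Convex ℝ s := by
    have : s = (fun v : Fin 2 → ℝ => (v 0 : ℂ) * z + v 1) ⁻¹' Metric.ball 0 1 := by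
      ext v; simp [hs]
    rw [this]
    refine (convex_ball (0 : ℂ) 1).is_linear_preimage ⟨fun v w => ?_, fun c v => ?_⟩
    · simp; ring
    · simp; ring
  have h := tendsto_card_div_pow_atTop_volume' s hbd hsopen.measurableSet
    (hconv.addHaar_frontier _) (by
      intro x y hx hxy v hv
      obtain ⟨w, hw, rfl⟩ := hv
      have hy : 0 < y := hx.trans_le hxy
      refine ⟨(x / y) • w, ?_, ?_⟩
      · show ‖((((x / y) • w) 0 : ℝ) : ℂ) * z + (((x / y) • w) 1 : ℝ)‖ < 1
        have : ((((x / y) • w) 0 : ℝ) : ℂ) * z + (((x / y) • w) 1 : ℝ) =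
            ((x / y : ℝ) : ℂ) * ((w 0 : ℂ) * z + w 1) := by simp; ring
        rw [this, norm_mul, Complex.norm_real, Real.norm_of_nonneg (by positivity)]
        have h1 : x / y ≤ 1 := (div_le_one hy).mpr hxy
        have h2 : ‖(w 0 : ℂ) * z + w 1‖ < 1 := hw
        have h3 : 0 < x / y := by positivity
        nlinarith [norm_nonneg ((w 0 : ℂ) * z + w 1)]
      · ext i
        simp
        field_simp)
  rw [volume_real_ellipse hz] at h
  refine h.congr' ?_
  filter_upwards [eventually_gt_atTop 0] with x hx
  rw [Fintype.card_fin]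
  congr 2
  -- Scaling by 1/x identifies integer points of the large ellipse with points of the shrunken
  -- lattice in the fixed one.
  refine (Nat.card_congr (Equiv.ofBijective (fun p : {p : ℤ × ℤ | ‖(p.1 : ℂ) * z + p.2‖ < x} =>
    (⟨x⁻¹ • ![(p.1.1 : ℝ), (p.1.2 : ℝ)], ?_, ?_⟩ :
      (s ∩ x⁻¹ • (Submodule.span ℤ (Set.range (Pi.basisFun ℝ (Fin 2))) : Set (Fin 2 → ℝ)) :
        Set (Fin 2 → ℝ)))) ⟨?_, ?_⟩)).symm
  · show ‖(((x⁻¹ • ![(p.1.1 : ℝ), (p.1.2 : ℝ)]) 0 : ℝ) : ℂ) * z +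
      ((x⁻¹ • ![(p.1.1 : ℝ), (p.1.2 : ℝ)]) 1 : ℝ)‖ < 1
    have : (((x⁻¹ • ![(p.1.1 : ℝ), (p.1.2 : ℝ)]) 0 : ℝ) : ℂ) * z +
        ((x⁻¹ • ![(p.1.1 : ℝ), (p.1.2 : ℝ)]) 1 : ℝ) =
        ((x⁻¹ : ℝ) : ℂ) * ((p.1.1 : ℂ) * z + p.1.2) := by simp; ring
    rw [this, norm_mul, Complex.norm_real, Real.norm_of_nonneg (by positivity),
      inv_mul_lt_iff₀ hx, mul_one]
    exact p.2
  · refine Set.smul_mem_smul_set ?_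
    rw [SetLike.mem_coe, Module.Basis.mem_span_iff_repr_mem]
    intro i
    fin_cases i <;> simp
  · rintro ⟨⟨a, b⟩, hp⟩ ⟨⟨a', b'⟩, hp'⟩ h
    have h1 := congrArg Subtype.val h
    have h2 := congrFun h1 0
    have h3 := congrFun h1 1
    simp [hx.ne'] at h2 h3
    simp [h2, h3]
  · rintro ⟨v, hv1, w, hw, rfl⟩
    rw [SetLike.mem_coe, Module.Basis.mem_span_iff_repr_mem] at hw
    obtain ⟨a, ha⟩ := hw 0
    obtain ⟨b, hb⟩ := hw 1
    simp at ha hb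
    refine ⟨⟨(a, b), ?_⟩, ?_⟩
    · have hv2 : ‖(((x⁻¹ • w) 0 : ℝ) : ℂ) * z + ((x⁻¹ • w) 1 : ℝ)‖ < 1 := hv1
      have : (((x⁻¹ • w) 0 : ℝ) : ℂ) * z + ((x⁻¹ • w) 1 : ℝ) =
        ((x⁻¹ : ℝ) : ℂ) * ((a : ℂ) * z + b) := by simp [← ha, ← hb]; ring
      rw [this, norm_mul, Complex.norm_real, Real.norm_of_nonneg (by positivity),
        inv_mul_lt_iff₀ hx, mul_one] at hv2
      exact hv2
    · apply Subtype.ext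
      ext i
      fin_cases i <;> simp [ha, hb]

theorem integral_indicator_Iio_le {a y s : ℝ} (hys : y ≤ s) :
    ∫ t in y..s, (Set.Iio a).indicator (fun _ => (1 : ℝ)) t ≤ max (a - y) 0 := by
  rw [intervalIntegral.integral_of_le hys,
    MeasureTheory.integral_indicator measurableSet_Iio, MeasureTheory.integral_const, smul_eq_mul,
    mul_one, MeasureTheory.measureReal_restrict_apply MeasurableSet.univ, Set.univ_inter,
    MeasureTheory.measureReal_restrict_apply measurableSet_Iio]
  have h1 : Set.Iio a ∩ Set.Ioc y s ⊆ Set.Ioc y a := fun t ht => ⟨ht.2.1, le_of_lt ht.1⟩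
  refine (MeasureTheory.measureReal_mono h1 (by simp)).trans ?_
  simp [MeasureTheory.measureReal_def, ENNReal.toReal_ofReal']

/-- Layer cake: max(h - y, 0) is at least the integral over s from y to s₀ of the indicator of s <
h. With h = Im z/|cz+d|², the number of pairs active at level s counts lattice points of radius √(Im
z/s) and is at least about (π - δ)/s. Its integral is (π - δ) log(1/y) up to a constant. -/
theorem exists_lattice_sum_ge {z : ℂ} (hz : 0 < z.im) {δ : ℝ} (hδ : 0 < δ) (hδ' : δ < Real.pi) :
    ∃ B s₀ : ℝ, 0 < s₀ ∧ ∀ y, 0 < y → y ≤ s₀ → ∃ E : Finset (ℤ × ℤ), (0 : ℤ × ℤ) ∉ E ∧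
      (Real.pi - δ) * Real.log (1 / y) - B ≤
        ∑ p ∈ E, max (z.im / ‖(p.1 : ℂ) * z + p.2‖ ^ 2 - y) 0 := by
  have h1 := (tendsto_card_lattice hz).eventually_const_le
    (show (Real.pi - δ) / z.im < Real.pi / z.im by gcongr; linarith)
  obtain ⟨X, hX⟩ := eventually_atTop.mp h1
  set X₀ := max X 1
  have hX₀ : 0 < X₀ := lt_of_lt_of_le one_pos (le_max_right _ _)
  have hN : ∀ x, X₀ ≤ x → (Real.pi - δ) / z.im * x ^ 2 ≤
      Nat.card {p : ℤ × ℤ | ‖(p.1 : ℂ) * z + p.2‖ < x} := by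
    intro x hx
    have hx0 : 0 < x := hX₀.trans_le hx
    have := hX x ((le_max_left _ _).trans hx)
    rwa [le_div_iff₀ (by positivity)] at this
  have hfin : ∀ x, X₀ ≤ x → {p : ℤ × ℤ | ‖(p.1 : ℂ) * z + p.2‖ < x}.Finite := by
    intro x hx
    have hx0 : 0 < x := hX₀.trans_le hx
    -- `Nat.card` of an infinite set is 0, so the positive lower bound already proves finiteness.
    have h2 : (0 : ℝ) < Nat.card {p : ℤ × ℤ | ‖(p.1 : ℂ) * z + p.2‖ < x} := by
      refine lt_of_lt_of_le ?_ (hN x hx)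
      have : 0 < Real.pi - δ := by linarith
      positivity
    exact Nat.finite_of_card_ne_zero (by exact_mod_cast h2.ne')
  set s₀ := z.im / X₀ ^ 2
  have hs₀ : 0 < s₀ := by positivity
  -- The first term comes from the upper limit of the integral of 1/s; the second pays for the
  -- omitted origin.
  refine ⟨(Real.pi - δ) * Real.log (1 / s₀) + s₀, s₀, hs₀, fun y hy hys => ?_⟩
  have hsqrt : ∀ s, 0 < s → s ≤ s₀ → X₀ ≤ √(z.im / s) := by
    intro s hs hss
    refine Real.le_sqrt_of_sq_le ?_
    rw [le_div_iff₀ hs]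
    calc X₀ ^ 2 * s ≤ X₀ ^ 2 * s₀ := by gcongr
      _ = z.im := by simp only [s₀]; field_simp
  set E := ((hfin _ (hsqrt y hy hys)).toFinset).erase 0
  -- The -1 accounts for the pair (0,0), which is counted as a lattice point but is not in `E`.
  have hcount : ∀ s ∈ Set.Icc y s₀, (Real.pi - δ) * s⁻¹ - 1 ≤
      ∑ p ∈ E, (Set.Iio (z.im / ‖(p.1 : ℂ) * z + p.2‖ ^ 2)).indicator (fun _ => (1 : ℝ)) s := by
    intro s hs
    have hs0 : 0 < s := hy.trans_le hs.1
    have hf := hfin _ (hsqrt s hs0 hs.2)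
    have h3 := hN _ (hsqrt s hs0 hs.2)
    rw [Real.sq_sqrt (by positivity), Nat.card_coe_set_eq, Set.ncard_eq_toFinset_card _ hf] at h3
    have h4 : (Real.pi - δ) / z.im * (z.im / s) = (Real.pi - δ) * s⁻¹ := by field_simp
    rw [h4] at h3
    have h5 : (hf.toFinset.card : ℝ) - 1 ≤ ((hf.toFinset.erase 0).card : ℝ) := by
      have := Finset.pred_card_le_card_erase (s := hf.toFinset) (a := (0 : ℤ × ℤ))
      have : hf.toFinset.card ≤ (hf.toFinset.erase 0).card + 1 := by omega
      have : (hf.toFinset.card : ℝ) ≤ ((hf.toFinset.erase 0).card : ℝ) + 1 := by exact_mod_cast this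
      linarith
    have h6 : hf.toFinset.erase 0 ⊆ E := by
      intro p hp
      simp only [E, Finset.mem_erase, Set.Finite.mem_toFinset, Set.mem_ofPred_eq] at hp ⊢
      refine ⟨hp.1, hp.2.trans_le (Real.sqrt_le_sqrt ?_)⟩
      gcongr
      exact hs.1
    have h7 : ((hf.toFinset.erase 0).card : ℝ) = ∑ p ∈ hf.toFinset.erase 0,
        (Set.Iio (z.im / ‖(p.1 : ℂ) * z + p.2‖ ^ 2)).indicator (fun _ => (1 : ℝ)) s := by
      rw [Finset.sum_congr rfl (g := fun _ => (1 : ℝ)), Finset.sum_const, nsmul_eq_mul, mul_one]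
      intro p hp
      simp only [Finset.mem_erase, Set.Finite.mem_toFinset, Set.mem_ofPred_eq] at hp
      refine Set.indicator_of_mem ?_ _
      rw [Set.mem_Iio]
      have hpos : 0 < ‖(p.1 : ℂ) * z + p.2‖ := by
        rw [norm_pos_iff]
        intro h0
        apply hp.1
        have him : (p.1 : ℝ) * z.im = 0 := by simpa using congrArg Complex.im h0
        have hc : p.1 = 0 := by
          rcases mul_eq_zero.mp him with h1 | h1
          · exact_mod_cast h1
          · exact absurd h1 hz.ne'
        rw [hc] at h0
        have hd : p.2 = 0 := by simpa using h0
        exact Prod.ext hc hd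
      have h8 := (Real.lt_sqrt hpos.le).mp hp.2
      rw [lt_div_iff₀ hs0] at h8
      rw [lt_div_iff₀ (by positivity)]
      linarith
    calc (Real.pi - δ) * s⁻¹ - 1 ≤ ((hf.toFinset.erase 0).card : ℝ) := by linarith
      _ ≤ _ := by
        rw [h7]
        exact Finset.sum_le_sum_of_subset_of_nonneg h6
          fun p _ _ => Set.indicator_nonneg (fun _ _ => zero_le_one) _
  refine ⟨E, by simp [E], ?_⟩
  have hint : ∀ p : ℤ × ℤ, IntervalIntegrable
      ((Set.Iio (z.im / ‖(p.1 : ℂ) * z + p.2‖ ^ 2)).indicator (fun _ => (1 : ℝ)))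
      MeasureTheory.volume y s₀ := by
    intro p
    rw [intervalIntegrable_iff_integrableOn_Ioc_of_le hys]
    exact (MeasureTheory.integrableOn_const (by simp)).indicator measurableSet_Iio
  have hint1 : IntervalIntegrable (fun s : ℝ => (Real.pi - δ) * s⁻¹) MeasureTheory.volume y s₀ := by
    refine (intervalIntegral.intervalIntegrable_inv (fun x hx => ?_) continuousOn_id).const_mul _
    rw [Set.uIcc_of_le hys] at hx
    exact (hy.trans_le hx.1).ne'
  have hmono := intervalIntegral.integral_mono_on hys (hint1.sub intervalIntegrable_const)
    (IntervalIntegrable.sum E (fun p _ => hint p)) (fun s hs => by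
      rw [Finset.sum_apply]; exact hcount s hs)
  rw [intervalIntegral.integral_sub hint1 intervalIntegrable_const,
    intervalIntegral.integral_const_mul, integral_inv_of_pos hy hs₀, intervalIntegral.integral_const,
    smul_eq_mul, mul_one] at hmono
  have hsum : ∫ s in y..s₀, (∑ p ∈ E,
      (Set.Iio (z.im / ‖(p.1 : ℂ) * z + p.2‖ ^ 2)).indicator (fun _ => (1 : ℝ))) s ≤
      ∑ p ∈ E, max (z.im / ‖(p.1 : ℂ) * z + p.2‖ ^ 2 - y) 0 := by
    simp only [Finset.sum_apply]
    rw [intervalIntegral.integral_finsetSum (fun p _ => hint p)]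
    exact Finset.sum_le_sum fun p _ => integral_indicator_Iio_le hys
  refine le_trans ?_ (hmono.trans hsum)
  rw [Real.log_div hs₀.ne' hy.ne', one_div, one_div, Real.log_inv, Real.log_inv]
  linarith

/-! ### The fundamental domain and the stabilisers of its points. -/

/-- The corner `e^{iπ/3}` of the fundamental domain. -/
noncomputable def rho : ℂ := ⟨1 / 2, √3 / 2⟩

open Classical in
/-- Half the order of the stabiliser of a point of the fundamental domain. -/
noncomputable def ellipticOrder (z : ℂ) : ℕ := if z = Complex.I then 2 else if z = rho then 3 else 1

open Classical in
/-- The entries `((a, b), (c, d))` of the matrices fixing a point of the fundamental domain. -/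
noncomputable def stabilizerList (z : ℂ) : Finset ((ℤ × ℤ) × (ℤ × ℤ)) :=
  if z = Complex.I then
    {((1, 0), (0, 1)), ((-1, 0), (0, -1)), ((0, -1), (1, 0)), ((0, 1), (-1, 0))}
  else if z = rho then
    {((1, 0), (0, 1)), ((-1, 0), (0, -1)), ((1, -1), (1, 0)), ((-1, 1), (-1, 0)),
      ((0, -1), (1, -1)), ((0, 1), (-1, 1))}
  else {((1, 0), (0, 1)), ((-1, 0), (0, -1))}

theorem I_ne_rho : Complex.I ≠ rho := by
  intro h
  have := congrArg Complex.re h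
  norm_num [rho] at this

theorem card_stabilizerList_le (z : ℂ) : (stabilizerList z).card ≤ 2 * ellipticOrder z := by
  unfold stabilizerList ellipticOrder
  split_ifs
  · exact Finset.card_le_four
  · exact Finset.card_le_six
  · exact Finset.card_le_two

theorem one_mem_stabilizerList (z : ℂ) : ((1, 0), (0, 1)) ∈ stabilizerList z := by
  unfold stabilizerList
  split_ifs <;> decide

theorem neg_mem_stabilizerList {z : ℂ} {a b c d : ℤ} (h : ((-a, -b), (-c, -d)) ∈ stabilizerList z) :
    ((a, b), (c, d)) ∈ stabilizerList z := by
  have key : ∀ t ∈ stabilizerList z, ((-t.1.1, -t.1.2), (-t.2.1, -t.2.2)) ∈ stabilizerList z := by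
    unfold stabilizerList
    split_ifs <;> decide
  simpa using key _ h

theorem inv_mem_stabilizerList {z : ℂ} {a b c d : ℤ} (h : ((d, -b), (-c, a)) ∈ stabilizerList z) :
    ((a, b), (c, d)) ∈ stabilizerList z := by
  have key : ∀ t ∈ stabilizerList z, ((t.2.2, -t.1.2), (-t.2.1, t.1.1)) ∈ stabilizerList z := by
    unfold stabilizerList
    split_ifs <;> decide
  simpa using key _ h

theorem normSq_eq_re_im (z : ℂ) : ‖z‖ ^ 2 = z.re ^ 2 + z.im ^ 2 := by
  rw [← Complex.normSq_eq_norm_sq, Complex.normSq_apply]; ring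

/-- The fundamental domain in Cartesian coordinates. -/
theorem mem_fundDomain_iff (z : ℂ) :
    z ∈ fundDomain ↔ 0 < z.im ∧ 1 ≤ z.re ^ 2 + z.im ^ 2 ∧ -(1 / 2) < z.re ∧ z.re ≤ 1 / 2 ∧
      (z.re ^ 2 + z.im ^ 2 = 1 → 0 ≤ z.re) := by
  unfold fundDomain
  rw [Set.mem_union, Set.mem_ofPred_eq, Set.mem_ofPred_eq, ← normSq_eq_re_im]
  have h0 := norm_nonneg z
  have harg : ‖z‖ = 1 → 0 < z.im → (z.arg ∈ Set.Icc (Real.pi / 3) (Real.pi / 2) ↔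
      0 ≤ z.re ∧ z.re ≤ 1 / 2) := by
    intro h1 h2
    have hcos : Real.cos z.arg = z.re := by
      have := Complex.norm_mul_cos_arg z
      rwa [h1, one_mul] at this
    have hnn : 0 ≤ z.arg := Complex.arg_nonneg_iff.mpr h2.le
    have hpi := Complex.arg_le_pi z
    have hp := Real.pi_pos
    rw [← hcos]
    constructor
    · rintro ⟨h3, h4⟩
      refine ⟨Real.cos_nonneg_of_neg_pi_div_two_le_of_le (by linarith) h4, ?_⟩
      rw [← Real.cos_pi_div_three]
      exact Real.cos_le_cos_of_nonneg_of_le_pi (by linarith) hpi h3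
    · rintro ⟨h3, h4⟩
      refine ⟨?_, ?_⟩
      · rw [← Real.cos_pi_div_three] at h4
        exact (Real.strictAntiOn_cos.le_iff_ge ⟨hnn, hpi⟩ ⟨by linarith, by linarith⟩).mp h4
      · rw [← Real.cos_pi_div_two] at h3
        exact (Real.strictAntiOn_cos.le_iff_ge ⟨by linarith, by linarith⟩ ⟨hnn, hpi⟩).mp h3
  constructor
  · rintro (⟨h1, h2, h3, h4⟩ | ⟨h1, h2, h3⟩)
    · refine ⟨h1, by nlinarith, h3, h4, fun h => ?_⟩
      nlinarith
    · have := (harg h2 h1).mp h3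
      exact ⟨h1, by rw [h2]; norm_num, by linarith, this.2, fun _ => this.1⟩
  · rintro ⟨h1, h2, h3, h4, h5⟩
    have h6 : 1 ≤ ‖z‖ := by nlinarith
    rcases h6.lt_or_eq with h7 | h7
    · exact Or.inl ⟨h1, h7, h3, h4⟩
    · exact Or.inr ⟨h1, h7.symm, (harg h7.symm h1).mpr ⟨h5 (by rw [← h7]; norm_num), h4⟩⟩

theorem eq_rho_of_re_of_norm {z : ℂ} (h0 : 0 < z.im) (h1 : z.re = 1 / 2)
    (h2 : z.re ^ 2 + z.im ^ 2 = 1) : z = rho := by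
  refine Complex.ext h1 ?_
  rw [h1] at h2
  have h3 : z.im ^ 2 = (√3 / 2) ^ 2 := by
    rw [div_pow, Real.sq_sqrt (by norm_num)]; linarith
  show z.im = √3 / 2
  exact (pow_left_inj₀ h0.le (by positivity) two_ne_zero).mp h3

theorem eq_I_of_re_of_norm {z : ℂ} (h0 : 0 < z.im) (h1 : z.re = 0)
    (h2 : z.re ^ 2 + z.im ^ 2 = 1) : z = Complex.I := by
  refine Complex.ext h1 ?_
  rw [h1] at h2
  show z.im = 1
  nlinarith

theorem moebius_mul_denom {a b c d : ℤ} (h : a * d - b * c = 1) {z w : ℂ} (hz : 0 < z.im)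
    (hw : w = ((a : ℂ) * z + b) / ((c : ℂ) * z + d)) :
    w.re * (c * z.re + d) - w.im * (c * z.im) = a * z.re + b ∧
      w.re * (c * z.im) + w.im * (c * z.re + d) = a * z.im := by
  have hcop : IsCoprime c d := ⟨-b, a, by linarith⟩
  rw [eq_div_iff (denom_ne_zero hcop hz)] at hw
  have h1 := congrArg Complex.re hw
  have h2 := congrArg Complex.im hw
  simp at h1 h2
  exact ⟨by linarith, by linarith⟩

/-- From Im w ≥ Im z follows |cz+d| ≤ 1, and (Im z)² ≥ 3/4 then leaves c ≤ 1 and d ∈ {0, -1} when c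
= 1. Because half of the boundary is removed, the surviving cases are the identity and the
stabilisers of i and ρ. Fixing the sign of (c,d) halves the number of cases. -/
theorem equiv_fundDomain_of_im_le_of_nonneg {a b c d : ℤ} (h : a * d - b * c = 1) {z w : ℂ}
    (hz : z ∈ fundDomain) (hw : w ∈ fundDomain)
    (hzw : w = ((a : ℂ) * z + b) / ((c : ℂ) * z + d)) (him : z.im ≤ w.im)
    (hc : 0 < c ∨ c = 0 ∧ 0 < d) :
    z = w ∧ ((a, b), (c, d)) ∈ stabilizerList z := by
  rw [mem_fundDomain_iff] at hz hw
  obtain ⟨hz1, hz2, hz3, hz4, hz5⟩ := hz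
  obtain ⟨hw1, hw2, hw3, hw4, hw5⟩ := hw
  have hcop : IsCoprime c d := ⟨-b, a, by linarith⟩
  have hwim : w.im = z.im / ‖(c : ℂ) * z + d‖ ^ 2 := by rw [hzw, moebius_im h]
  have hnpos := norm_pos_iff.mpr (denom_ne_zero hcop hz1)
  obtain ⟨e1, e2⟩ := moebius_mul_denom h hz1 hzw
  have hn : ‖(c : ℂ) * z + d‖ ^ 2 = (c * z.re + d) ^ 2 + (c * z.im) ^ 2 := by
    rw [normSq_eq_re_im]; simp
  rw [eq_div_iff (by positivity), hn] at hwim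
  have hle : ((c : ℝ) * z.re + d) ^ 2 + (c * z.im) ^ 2 ≤ 1 := by
    by_contra! hcon
    nlinarith
  rcases hc with hc | ⟨rfl, hd⟩
  · have hy : 3 / 4 ≤ z.im ^ 2 := by nlinarith
    have hc1 : c = 1 := by
      by_contra hne
      have : 2 ≤ c := by omega
      have h2 : (2 : ℝ) ≤ c := by exact_mod_cast this
      have h3 : (c : ℝ) ^ 2 * z.im ^ 2 ≤ 1 := by nlinarith [sq_nonneg ((c : ℝ) * z.re + d)]
      nlinarith
    subst hc1
    push_cast at *
    have hd : d = 0 ∨ d = -1 := by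
      have h4 : (d : ℝ) ^ 2 + 2 * d * z.re ≤ 0 := by nlinarith
      by_contra! hne
      have h5 : 1 ≤ d ∨ d ≤ -2 := by omega
      rcases h5 with h5 | h5
      · have : (1 : ℝ) ≤ d := by exact_mod_cast h5
        nlinarith
      · have : (d : ℝ) ≤ -2 := by exact_mod_cast h5
        nlinarith
    rcases hd with rfl | rfl
    · have hb : b = -1 := by linarith
      subst hb
      push_cast at *
      have hsimp : (1 * z.re + 0) ^ 2 + (1 * z.im) ^ 2 = z.re ^ 2 + z.im ^ 2 := by ring
      have hnorm : z.re ^ 2 + z.im ^ 2 = 1 := le_antisymm (hsimp ▸ hle) hz2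
      have hx := hz5 hnorm
      have him' : w.im = z.im := by rw [hsimp, hnorm, mul_one] at hwim; exact hwim
      have hre : w.re = a - z.re := by
        have h6 : w.re * z.im = (a - z.re) * z.im := by rw [him'] at e2; linarith
        exact mul_right_cancel₀ hz1.ne' h6
      have ha : a = 0 ∨ a = 1 := by
        have h7 : (-1 : ℝ) < a := by linarith
        have h8 : (a : ℝ) < 2 := by linarith
        have h7' : -1 < a := by exact_mod_cast h7
        have h8' : a < 2 := by exact_mod_cast h8
        omega
      rcases ha with rfl | rfl
      · push_cast at *
        have : 0 ≤ w.re := hw5 (by rw [him', hre]; nlinarith)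
        have hx0 : z.re = 0 := by linarith
        have hzI := eq_I_of_re_of_norm hz1 hx0 hnorm
        refine ⟨Complex.ext (by linarith) him'.symm, ?_⟩
        rw [stabilizerList, if_pos hzI]
        decide
      · push_cast at *
        have hx0 : z.re = 1 / 2 := by linarith
        have hzr := eq_rho_of_re_of_norm hz1 hx0 hnorm
        refine ⟨Complex.ext (by linarith) him'.symm, ?_⟩
        rw [stabilizerList, if_neg (by rw [hzr]; exact I_ne_rho.symm), if_pos hzr]
        decide
    · push_cast at *
      have hsimp : (1 * z.re + -1) ^ 2 + (1 * z.im) ^ 2 = z.re ^ 2 + z.im ^ 2 + 1 - 2 * z.re := by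
        ring
      have hx0 : z.re = 1 / 2 := by rw [hsimp] at hle; linarith
      have hnorm : z.re ^ 2 + z.im ^ 2 = 1 := by rw [hsimp] at hle; linarith
      have hzr := eq_rho_of_re_of_norm hz1 hx0 hnorm
      have him' : w.im = z.im := by
        rw [hsimp, hnorm, hx0] at hwim
        linarith
      have hre : w.re = a + 1 / 2 := by
        have h6 : w.re * z.im = (a + 1 / 2) * z.im := by rw [him', hx0] at e2; linarith
        exact mul_right_cancel₀ hz1.ne' h6
      have ha : a = 0 := by
        have h7 : (-1 : ℝ) < a := by linarith
        have h8 : (a : ℝ) < 1 := by linarith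
        have h7' : -1 < a := by exact_mod_cast h7
        have h8' : a < 1 := by exact_mod_cast h8
        omega
      subst ha
      have hb : b = -1 := by linarith
      subst hb
      refine ⟨Complex.ext (by rw [hre, hx0]; norm_num) him'.symm, ?_⟩
      rw [stabilizerList, if_neg (by rw [hzr]; exact I_ne_rho.symm), if_pos hzr]
      decide
  · have hd1 : d = 1 := by
      have : a * d = 1 := by linarith
      rcases Int.isUnit_iff.mp (IsUnit.of_mul_eq_one_right a this) with h | h <;> omega
    subst hd1
    have ha : a = 1 := by linarith
    subst ha
    push_cast at *
    have hb : b = 0 := by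
      have h7 : (-1 : ℝ) < b := by linarith
      have h8 : (b : ℝ) < 1 := by linarith
      have h7' : -1 < b := by exact_mod_cast h7
      have h8' : b < 1 := by exact_mod_cast h8
      omega
    subst hb
    exact ⟨by rw [hzw]; simp, one_mem_stabilizerList z⟩

theorem equiv_fundDomain_of_im_le {a b c d : ℤ} (h : a * d - b * c = 1) {z w : ℂ}
    (hz : z ∈ fundDomain) (hw : w ∈ fundDomain)
    (hzw : w = ((a : ℂ) * z + b) / ((c : ℂ) * z + d)) (him : z.im ≤ w.im) :
    z = w ∧ ((a, b), (c, d)) ∈ stabilizerList z := by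
  by_cases hc : 0 < c ∨ c = 0 ∧ 0 < d
  · exact equiv_fundDomain_of_im_le_of_nonneg h hz hw hzw him hc
  · have hd0 : ¬(c = 0 ∧ d = 0) := by rintro ⟨rfl, rfl⟩; simp at h
    have h2 := equiv_fundDomain_of_im_le_of_nonneg (a := -a) (b := -b) (c := -c) (d := -d)
      (by linarith) hz hw (by
        rw [hzw]; push_cast
        rw [show -(a : ℂ) * z + -b = -(a * z + b) by ring,
          show -(c : ℂ) * z + -d = -(c * z + d) by ring, neg_div_neg_eq]) him (by omega)
    exact ⟨h2.1, neg_mem_stabilizerList h2.2⟩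

theorem equiv_fundDomain {a b c d : ℤ} (h : a * d - b * c = 1) {z w : ℂ}
    (hz : z ∈ fundDomain) (hw : w ∈ fundDomain)
    (hzw : w = ((a : ℂ) * z + b) / ((c : ℂ) * z + d)) :
    z = w ∧ ((a, b), (c, d)) ∈ stabilizerList z := by
  rcases le_total z.im w.im with him | him
  · exact equiv_fundDomain_of_im_le h hz hw hzw him
  · have hz1 := ((mem_fundDomain_iff z).mp hz).1
    have hcop : IsCoprime c d := ⟨-b, a, by linarith⟩
    have h0 := denom_ne_zero hcop hz1
    have h1 : z = (((d : ℤ) : ℂ) * w + ((-b : ℤ) : ℂ)) / (((-c : ℤ) : ℂ) * w + ((a : ℤ) : ℂ)) := by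
      have hdet : (a : ℂ) * d - b * c = 1 := by exact_mod_cast h
      have e1 : ((d : ℤ) : ℂ) * w + ((-b : ℤ) : ℂ) = z / ((c : ℂ) * z + d) := by
        rw [hzw, eq_div_iff h0, add_mul, mul_assoc, div_mul_cancel₀ _ h0]
        push_cast
        linear_combination z * hdet
      have e2 : ((-c : ℤ) : ℂ) * w + ((a : ℤ) : ℂ) = 1 / ((c : ℂ) * z + d) := by
        rw [hzw, eq_div_iff h0, add_mul, mul_assoc, div_mul_cancel₀ _ h0]
        push_cast
        linear_combination hdet
      rw [e1, e2, div_div_div_cancel_right₀ h0, div_one]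
    have h2 := equiv_fundDomain_of_im_le (a := d) (b := -b) (c := -c) (d := a)
      (by linarith) hw hz h1 him
    exact ⟨h2.1.symm, h2.1 ▸ inv_mem_stabilizerList h2.2⟩

/-! ### Cuspidal functions in the variable q, and Jensen's formula. -/

/-- Holomorphic functions on the upper half plane which transform like modular forms of weight
`2 l` for the full modular group and satisfy the growth bound of cusp forms. -/
structure IsCuspidal (f : ℂ → ℂ) (l : ℕ) : Prop where
  differentiableOn : DifferentiableOn ℂ f {z : ℂ | 0 < z.im}
  moebius : ∀ {a b c d : ℤ}, a * d - b * c = 1 → ∀ {z : ℂ}, 0 < z.im →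
    f (((a : ℂ) * z + b) / ((c : ℂ) * z + d)) = ((c : ℂ) * z + d) ^ (2 * l) * f z
  bound : ∃ B : ℝ, ∀ z : ℂ, 0 < z.im → ‖f z‖ * z.im ^ l ≤ B

open Classical in
/-- The function of `q = exp (2 π i z)` attached to a function periodic on the upper half plane. -/
noncomputable def cuspMap (f : ℂ → ℂ) : ℂ → ℂ :=
  Function.Periodic.cuspFunction 1 (fun z => if 0 < z.im then f z else 0)

namespace IsCuspidal

variable {f : ℂ → ℂ} {l : ℕ}

open Classical in
theorem periodic (hf : IsCuspidal f l) :
    Function.Periodic (fun z : ℂ => if 0 < z.im then f z else 0) ((1 : ℝ) : ℂ) := by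
  intro z
  have him : (z + ((1 : ℝ) : ℂ)).im = z.im := by simp
  simp only [him]
  split_ifs with h
  · have := hf.moebius (a := 1) (b := 1) (c := 0) (d := 1) (by norm_num) h
    simpa using this
  · rfl

theorem cuspMap_qParam (hf : IsCuspidal f l) {z : ℂ} (hz : 0 < z.im) :
    cuspMap f (Function.Periodic.qParam 1 z) = f z := by
  unfold cuspMap
  rw [Function.Periodic.eq_cuspFunction one_ne_zero hf.periodic, if_pos hz]

theorem analyticOnNhd (hf : IsCuspidal f l) : AnalyticOnNhd ℂ f {z : ℂ | 0 < z.im} :=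
  hf.differentiableOn.analyticOnNhd isOpen_upper

theorem exists_qParam {q : ℂ} (h0 : q ≠ 0) (h1 : ‖q‖ < 1) :
    ∃ z : ℂ, 0 < z.im ∧ Function.Periodic.qParam 1 z = q := by
  refine ⟨Function.Periodic.invQParam 1 q, ?_,
    Function.Periodic.qParam_right_inv one_ne_zero h0⟩
  rw [Function.Periodic.im_invQParam]
  have h2 : Real.log ‖q‖ < 0 := Real.log_neg (norm_pos_iff.mpr h0) h1
  have := Real.pi_pos
  have h3 : -1 / (2 * Real.pi) < 0 := div_neg_of_neg_of_pos (by norm_num) (by positivity)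
  exact mul_pos_of_neg_of_neg h3 h2

-- Away from q = 0 a local logarithm gives analyticity. At q = 0 the singularity is removable, since
-- the growth bound makes f bounded on Im z ≥ 1.
open Classical in
theorem analyticOnNhd_cuspMap (hf : IsCuspidal f l) :
    AnalyticOnNhd ℂ (cuspMap f) (Metric.ball 0 1) := by
  have hd : ∀ z : ℂ, 0 < z.im → DifferentiableAt ℂ (fun z : ℂ => if 0 < z.im then f z else 0) z := by
    intro z hz
    refine (hf.differentiableOn.differentiableAt (isOpen_upper.mem_nhds hz)).congr_of_eventuallyEq ?_
    filter_upwards [isOpen_upper.mem_nhds hz] with w hw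
    exact if_pos hw
  refine DifferentiableOn.analyticOnNhd (fun q hq => ?_) Metric.isOpen_ball
  rw [mem_ball_zero_iff] at hq
  refine DifferentiableAt.differentiableWithinAt ?_
  by_cases h0 : q = 0
  · subst h0
    refine Function.Periodic.differentiableAt_cuspFunction_zero one_pos hf.periodic ?_ ?_
    · exact (tendsto_comap.eventually (eventually_gt_atTop (0 : ℝ))).mono fun z hz => hd z hz
    · obtain ⟨B, hB⟩ := hf.bound
      refine Asymptotics.IsBigO.of_bound B ?_
      filter_upwards [tendsto_comap.eventually (eventually_ge_atTop (1 : ℝ))] with z hz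
      have hz0 : 0 < z.im := by linarith
      rw [if_pos hz0]
      simp only [Pi.one_apply, norm_one, mul_one]
      refine le_trans ?_ (hB z hz0)
      exact le_mul_of_one_le_right (norm_nonneg _) (one_le_pow₀ hz)
  · obtain ⟨z, hz, rfl⟩ := exists_qParam h0 hq
    exact Function.Periodic.differentiableAt_cuspFunction one_ne_zero hf.periodic (hd z hz)

/-- The map z ↦ q has nowhere vanishing derivative, hence preserves orders of vanishing. -/
theorem analyticOrderAt_cuspMap (hf : IsCuspidal f l) {z : ℂ} (hz : 0 < z.im) :
    analyticOrderAt (cuspMap f) (Function.Periodic.qParam 1 z) = analyticOrderAt f z := by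
  have hder : deriv (Function.Periodic.qParam 1) z ≠ 0 := by
    have h1 : HasDerivAt (Function.Periodic.qParam 1)
        (Complex.exp (2 * Real.pi * Complex.I * z / (1 : ℝ)) *
          (2 * Real.pi * Complex.I * 1 / (1 : ℝ))) z :=
      (((hasDerivAt_id z).const_mul (2 * Real.pi * Complex.I)).div_const ((1 : ℝ) : ℂ)).cexp
    rw [h1.deriv]
    simp [Real.pi_ne_zero, Complex.exp_ne_zero]
  have hq : AnalyticAt ℂ (Function.Periodic.qParam 1) z :=
    Function.Periodic.differentiable_qParam.analyticAt z
  rw [← analyticOrderAt_comp_of_deriv_ne_zero hq hder]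
  refine analyticOrderAt_congr ?_
  filter_upwards [isOpen_upper.mem_nhds hz] with w hw
  exact hf.cuspMap_qParam hw

theorem analyticOrderAt_moebius (hf : IsCuspidal f l) {a b c d : ℤ} (h : a * d - b * c = 1)
    {z : ℂ} (hz : 0 < z.im) :
    analyticOrderAt f (((a : ℂ) * z + b) / ((c : ℂ) * z + d)) = analyticOrderAt f z := by
  have hcop : IsCoprime c d := ⟨-b, a, by linarith⟩
  have h0 := denom_ne_zero hcop hz
  have hdetC : (a : ℂ) * d - b * c = 1 := by exact_mod_cast h
  set g : ℂ → ℂ := fun z => ((a : ℂ) * z + b) / ((c : ℂ) * z + d)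
  have hg : HasDerivAt g ((a * ((c : ℂ) * z + d) - ((a : ℂ) * z + b) * c) / ((c : ℂ) * z + d) ^ 2)
      z := by
    have h1 : HasDerivAt (fun z : ℂ => (a : ℂ) * z + b) a z := by
      simpa using ((hasDerivAt_id z).const_mul (a : ℂ)).add_const (b : ℂ)
    have h2 : HasDerivAt (fun z : ℂ => (c : ℂ) * z + d) c z := by
      simpa using ((hasDerivAt_id z).const_mul (c : ℂ)).add_const (d : ℂ)
    exact h1.div h2 h0
  have hder : deriv g z ≠ 0 := by
    rw [hg.deriv, show (a : ℂ) * ((c : ℂ) * z + d) - ((a : ℂ) * z + b) * c = 1 by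
      linear_combination hdetC]
    exact div_ne_zero one_ne_zero (pow_ne_zero _ h0)
  have hden : AnalyticAt ℂ (fun z : ℂ => (c : ℂ) * z + d) z := by fun_prop
  have hga : AnalyticAt ℂ g z := AnalyticAt.div (by fun_prop) hden h0
  show analyticOrderAt f (g z) = _
  rw [← analyticOrderAt_comp_of_deriv_ne_zero hga hder]
  have h3 : f ∘ g =ᶠ[nhds z] (fun z => (c : ℂ) * z + d) ^ (2 * l) * f := by
    filter_upwards [isOpen_upper.mem_nhds hz] with w hw
    exact hf.moebius h hw
  rw [analyticOrderAt_congr h3, analyticOrderAt_mul (hden.pow _) (hf.analyticOnNhd z hz),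
    (hden.pow (2 * l)).analyticOrderAt_eq_zero.mpr (pow_ne_zero _ h0), zero_add]

end IsCuspidal

/-- This is Jensen's formula with the mean of log|g| bounded by log M. All contributions of zeros
are nonnegative, so any finite set of them may be kept. The order and the leading coefficient at 0
replace log|g(0)|, because a cusp form vanishes there. -/
theorem sum_analyticOrderNatAt_mul_log_le {g : ℂ → ℂ} (hg : AnalyticOnNhd ℂ g (Metric.ball 0 1))
    {R M : ℝ} (hR : 0 < R) (hR1 : R < 1) (hM : 1 ≤ M)
    (hb : ∀ q : ℂ, ‖q‖ = R → ‖g q‖ ≤ M) {Q : Finset ℂ} (hQ : ∀ u ∈ Q, u ≠ 0 ∧ ‖u‖ ≤ R) :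
    ∑ u ∈ Q, analyticOrderNatAt g u * Real.log (R / ‖u‖) ≤
      Real.log M + analyticOrderNatAt g 0 * Real.log (1 / R) -
        Real.log ‖meromorphicTrailingCoeffAt g 0‖ := by
  have hsub : Metric.closedBall (0 : ℂ) |R| ⊆ Metric.ball 0 1 := by
    rw [abs_of_pos hR]; exact Metric.closedBall_subset_ball hR1
  have hg' : AnalyticOnNhd ℂ g (Metric.closedBall 0 |R|) := hg.mono hsub
  have hJ := hg'.meromorphicOn.circleAverage_log_norm hR.ne'
  have hle : Real.circleAverage (fun z => Real.log ‖g z‖) 0 R ≤ Real.log M := by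
    refine Real.circleAverage_mono_on_of_le_circle ?_ fun q hq => ?_
    · exact (hg'.mono Metric.sphere_subset_closedBall).meromorphicOn.circleIntegrable_log_norm
    · have hq' : ‖q‖ = R := by simpa [abs_of_pos hR] using hq
      by_cases h0 : g q = 0
      · rw [h0, norm_zero, Real.log_zero]; exact Real.log_nonneg hM
      · exact Real.log_le_log (norm_pos_iff.mpr h0) (hb q hq')
  set D := MeromorphicOn.divisor g (Metric.closedBall 0 |R|) with hD
  have hDapp : ∀ u : ℂ, ‖u‖ ≤ R → (D u : ℝ) = analyticOrderNatAt g u := by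
    intro u hu
    have hu' : u ∈ Metric.closedBall (0 : ℂ) |R| := by simpa [abs_of_pos hR] using hu
    rw [hD, MeromorphicOn.AnalyticOnNhd.divisor_apply hg' hu', analyticOrderNatAt]
    cases analyticOrderAt g u <;> simp
  have hDnn : ∀ u, (0 : ℝ) ≤ D u := fun u => by
    exact_mod_cast MeromorphicOn.AnalyticOnNhd.divisor_nonneg hg' u
  have hDout : ∀ u : ℂ, ¬ ‖u‖ ≤ R → D u = 0 := by
    intro u hu
    refine Function.locallyFinsuppWithin.apply_eq_zero_of_notMem _ ?_
    simpa [abs_of_pos hR] using hu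
  have hfin := D.finiteSupport (isCompact_closedBall 0 |R|)
  have hnn : ∀ u : ℂ, 0 ≤ (D u : ℝ) * Real.log (R * ‖0 - u‖⁻¹) := by
    intro u
    by_cases hu : ‖u‖ ≤ R
    · refine mul_nonneg (hDnn u) ?_
      by_cases hu0 : u = 0
      · simp [hu0]
      · refine Real.log_nonneg ?_
        rw [zero_sub, norm_neg, ← div_eq_mul_inv]
        exact (one_le_div (norm_pos_iff.mpr hu0)).mpr hu
    · rw [hDout u hu]; simp
  have hsum : ∑ u ∈ Q, analyticOrderNatAt g u * Real.log (R / ‖u‖) ≤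
      ∑ᶠ u, (D u : ℝ) * Real.log (R * ‖0 - u‖⁻¹) := by
    classical
    rw [finsum_eq_sum_of_support_subset (s := Q ∪ hfin.toFinset)]
    · calc _ = ∑ u ∈ Q, (D u : ℝ) * Real.log (R * ‖0 - u‖⁻¹) := by
            refine Finset.sum_congr rfl fun u hu => ?_
            rw [hDapp u (hQ u hu).2, zero_sub, norm_neg, div_eq_mul_inv]
        _ ≤ _ := Finset.sum_le_sum_of_subset_of_nonneg Finset.subset_union_left
            fun u _ _ => hnn u
    · intro u hu
      rw [Function.mem_support] at hu
      simp only [Finset.coe_union, Set.Finite.coe_toFinset, Set.mem_union, Function.mem_support]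
      right
      intro h0
      rw [h0] at hu
      simp at hu
  have h0 := hDapp 0 (by simpa using hR.le)
  rw [h0] at hJ
  rw [one_div, Real.log_inv]
  have hle' : Real.circleAverage (Real.log ‖g ·‖) 0 R ≤ Real.log M := hle
  linarith

/-! ### Orbits of zeros in the q-disc and the valence inequality. -/

theorem moebius_inv {a b c d : ℤ} (h : a * d - b * c = 1) {z w : ℂ} (hz : 0 < z.im)
    (hw : w = ((a : ℂ) * z + b) / ((c : ℂ) * z + d)) :
    z = (d * w - b) / (-c * w + a) := by
  have hcop : IsCoprime c d := ⟨-b, a, by linarith⟩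
  have h0 := denom_ne_zero hcop hz
  have hdet : (a : ℂ) * d - b * c = 1 := by exact_mod_cast h
  have e1 : (d : ℂ) * w - b = z / ((c : ℂ) * z + d) := by
    rw [hw, eq_div_iff h0, sub_mul, mul_assoc, div_mul_cancel₀ _ h0]
    linear_combination z * hdet
  have e2 : -(c : ℂ) * w + a = 1 / ((c : ℂ) * z + d) := by
    rw [hw, eq_div_iff h0, add_mul, mul_assoc, div_mul_cancel₀ _ h0]
    linear_combination hdet
  rw [e1, e2, div_div_div_cancel_right₀ h0, div_one]

/-- The image of `z` under the matrix used in `term` for the bottom row `p`. -/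
noncomputable def orbitPoint (z : ℂ) (p : ℤ × ℤ) : ℂ :=
  ((Int.gcdB p.1 p.2 : ℂ) * z + ((-Int.gcdA p.1 p.2 : ℤ) : ℂ)) / ((p.1 : ℂ) * z + p.2)

theorem orbitPoint_im {p : ℤ × ℤ} (hp : IsCoprime p.1 p.2) (z : ℂ) :
    (orbitPoint z p).im = z.im / ‖(p.1 : ℂ) * z + p.2‖ ^ 2 :=
  moebius_im (topRow_det hp) z

theorem orbitPoint_im_pos {p : ℤ × ℤ} (hp : IsCoprime p.1 p.2) {z : ℂ} (hz : 0 < z.im) :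
    0 < (orbitPoint z p).im :=
  moebius_im_pos (topRow_det hp) hz

/-- Equal values of q mean that the orbit points differ by an integer translation, so z and w are
equivalent, hence equal, and the pairs differ by a stabilising matrix. A point of the q-disc is
therefore reached at most as often as the stabiliser has elements. -/
theorem qParam_orbitPoint_eq {p p' : ℤ × ℤ} (hp : IsCoprime p.1 p.2) (hp' : IsCoprime p'.1 p'.2)
    {z w : ℂ} (hz : z ∈ fundDomain) (hw : w ∈ fundDomain)
    (h : Function.Periodic.qParam 1 (orbitPoint z p) =
      Function.Periodic.qParam 1 (orbitPoint w p')) :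
    z = w ∧ ∃ t ∈ stabilizerList w,
      p = (p'.1 * t.1.1 + p'.2 * t.2.1, p'.1 * t.1.2 + p'.2 * t.2.2) := by
  have hz0 := ((mem_fundDomain_iff z).mp hz).1
  have hw0 := ((mem_fundDomain_iff w).mp hw).1
  obtain ⟨n, hn⟩ : ∃ n : ℤ, orbitPoint w p' = orbitPoint z p - n := by
    unfold Function.Periodic.qParam at h
    rw [Complex.exp_eq_exp_iff_exists_int] at h
    obtain ⟨n, hn⟩ := h
    refine ⟨n, ?_⟩
    have h2 : (2 * Real.pi * Complex.I) ≠ 0 := Complex.two_pi_I_ne_zero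
    simp only [Complex.ofReal_one, div_one] at hn
    have h3 : 2 * Real.pi * Complex.I * (orbitPoint w p') =
        2 * Real.pi * Complex.I * (orbitPoint z p - n) := by
      rw [mul_sub, hn]; ring
    exact mul_left_cancel₀ h2 h3
  obtain ⟨c, d⟩ := p
  obtain ⟨c', d'⟩ := p'
  have hdet := topRow_det hp
  have hdet' := topRow_det hp'
  have h0 := denom_ne_zero hp hz0
  unfold orbitPoint at hn
  simp only at hn hdet hdet' h0 hp hp'
  set a := Int.gcdB c d
  set b := -Int.gcdA c d
  set a' := Int.gcdB c' d'
  set b' := -Int.gcdA c' d'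
  have hw1 := moebius_inv hdet' hw0 hn.symm
  set α := a - n * c
  set β := b - n * d
  have hX : ((a : ℂ) * z + b) / ((c : ℂ) * z + d) - n = (α * z + β) / ((c : ℂ) * z + d) := by
    rw [eq_div_iff h0, sub_mul, div_mul_cancel₀ _ h0]
    simp only [α, β]
    push_cast
    ring
  rw [hX] at hw1
  have hdet2 : (d' * α - b' * c) * (-c' * β + a' * d) - (d' * β - b' * d) * (-c' * α + a' * c)
      = 1 := by
    have h1 : α * d - β * c = 1 := by simp only [α, β]; linear_combination hdet
    linear_combination hdet' + (d' * a' - b' * c') * h1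
  have hw2 : w = (((d' * α - b' * c : ℤ) : ℂ) * z + ((d' * β - b' * d : ℤ) : ℂ)) /
      (((-c' * α + a' * c : ℤ) : ℂ) * z + ((-c' * β + a' * d : ℤ) : ℂ)) := by
    rw [hw1, ← div_div_div_cancel_right₀ h0 (((d' * α - b' * c : ℤ) : ℂ) * z + _)]
    congr 1
    · rw [eq_div_iff h0, sub_mul, mul_assoc, div_mul_cancel₀ _ h0]; push_cast; ring
    · rw [eq_div_iff h0, add_mul, mul_assoc, div_mul_cancel₀ _ h0]; push_cast; ring
  obtain ⟨hzw, hmem⟩ := equiv_fundDomain hdet2 hz hw hw2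
  refine ⟨hzw, _, hzw ▸ hmem, ?_⟩
  ext
  · simp only
    linear_combination -c * hdet'
  · simp only
    linear_combination -d * hdet'

namespace IsCuspidal

variable {f : ℂ → ℂ} {l : ℕ}

/-- On the circle |q| = exp(-2πy), which is the height y, the growth bound reads |f| ≤ M y^(-l). The
terms of Jensen's formula at q = 0 stay bounded because log(1/R) = 2πy ≤ 2π. -/
theorem exists_sum_cuspMap_le_of_le_one (hf : IsCuspidal f l) :
    ∃ B' : ℝ, 0 ≤ B' ∧ ∀ y : ℝ, 0 < y → y ≤ 1 → ∀ Q : Finset ℂ, (∀ u ∈ Q, u ≠ 0 ∧ ‖u‖ < 1) →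
      ∑ u ∈ Q, analyticOrderNatAt (cuspMap f) u * max (-Real.log ‖u‖ - 2 * Real.pi * y) 0 ≤
        l * Real.log (1 / y) + B' := by
  obtain ⟨B, hB⟩ := hf.bound
  set g := cuspMap f
  set M := max B 1
  have hM : 1 ≤ M := le_max_right _ _
  have hM0 : 0 < M := by linarith
  refine ⟨Real.log M + analyticOrderNatAt g 0 * (2 * Real.pi) +
    |Real.log ‖meromorphicTrailingCoeffAt g 0‖|, ?_, fun y hy hy1 Q hQ => ?_⟩
  · have := Real.log_nonneg hM
    have := Real.pi_pos
    positivity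
  have hpi := Real.pi_pos
  set R := Real.exp (-(2 * Real.pi * y))
  have hR : 0 < R := Real.exp_pos _
  have hR1 : R < 1 := by rw [Real.exp_lt_one_iff]; have : 0 < 2 * Real.pi * y := by positivity
                         linarith
  have hlogR : Real.log R = -(2 * Real.pi * y) := Real.log_exp _
  classical
  have hyl : y ^ l ≤ 1 := pow_le_one₀ hy.le hy1
  have h1 := sum_analyticOrderNatAt_mul_log_le hf.analyticOnNhd_cuspMap hR hR1
    (M := M / y ^ l) ((one_le_div (by positivity)).mpr (hyl.trans hM)) (fun q hq => by
      have hq0 : q ≠ 0 := norm_pos_iff.mp (hq ▸ hR)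
      obtain ⟨z, hz, rfl⟩ := exists_qParam hq0 (hq ▸ hR1)
      rw [hf.cuspMap_qParam hz, le_div_iff₀ (by positivity)]
      have hzy : z.im = y := by
        rw [Function.Periodic.norm_qParam] at hq
        have h2 := Real.exp_injective hq
        rw [div_one] at h2
        have h3 : 2 * Real.pi * (z.im - y) = 0 := by linarith
        have h4 : (2 * Real.pi : ℝ) ≠ 0 := by positivity
        rcases mul_eq_zero.mp h3 with h5 | h5
        · exact absurd h5 h4
        · linarith
      rw [← hzy]
      exact (hB z hz).trans (le_max_left _ _)) (Q := Q.filter fun u => ‖u‖ ≤ R)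
    (fun u hu => ⟨(hQ u (Finset.mem_filter.mp hu).1).1, (Finset.mem_filter.mp hu).2⟩)
  have h2 : ∑ u ∈ Q, analyticOrderNatAt g u * max (-Real.log ‖u‖ - 2 * Real.pi * y) 0 =
      ∑ u ∈ Q.filter (fun u => ‖u‖ ≤ R), analyticOrderNatAt g u * Real.log (R / ‖u‖) := by
    rw [Finset.sum_filter]
    refine Finset.sum_congr rfl fun u hu => ?_
    have hu0 := norm_pos_iff.mpr (hQ u hu).1
    split_ifs with hle
    · have h3 : Real.log ‖u‖ ≤ Real.log R := Real.log_le_log hu0 hle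
      rw [Real.log_div hR.ne' hu0.ne', hlogR, max_eq_left (by linarith)]
      ring
    · have h3 : Real.log R ≤ Real.log ‖u‖ := Real.log_le_log hR (not_le.mp hle).le
      rw [max_eq_right (by linarith), mul_zero]
  rw [h2]
  refine h1.trans ?_
  rw [Real.log_div hM0.ne' (by positivity), Real.log_pow, one_div, one_div, Real.log_inv,
    Real.log_inv, hlogR]
  have h4 := neg_abs_le (Real.log ‖meromorphicTrailingCoeffAt g 0‖)
  have h5 : (analyticOrderNatAt g 0 : ℝ) * (2 * Real.pi * y) ≤
      analyticOrderNatAt g 0 * (2 * Real.pi) := by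
    refine mul_le_mul_of_nonneg_left ?_ (Nat.cast_nonneg _)
    nlinarith
  have h6 : (analyticOrderNatAt g 0 : ℝ) * - -(2 * Real.pi * y) =
    (analyticOrderNatAt g 0 : ℝ) * (2 * Real.pi * y) := by ring
  linarith

/-- The left side decreases in y, so heights above 1 are covered by y = 1. They are needed later,
when y is replaced by n² y. -/
theorem exists_sum_cuspMap_le (hf : IsCuspidal f l) :
    ∃ B' : ℝ, 0 ≤ B' ∧ ∀ y : ℝ, 0 < y → ∀ Q : Finset ℂ, (∀ u ∈ Q, u ≠ 0 ∧ ‖u‖ < 1) →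
      ∑ u ∈ Q, analyticOrderNatAt (cuspMap f) u * max (-Real.log ‖u‖ - 2 * Real.pi * y) 0 ≤
        l * max (Real.log (1 / y)) 0 + B' := by
  obtain ⟨B', hB', h⟩ := hf.exists_sum_cuspMap_le_of_le_one
  refine ⟨B', hB', fun y hy Q hQ => ?_⟩
  rcases le_total y 1 with h1 | h1
  · refine (h y hy h1 Q hQ).trans ?_
    gcongr
    exact le_max_left _ _
  · have h2 := h 1 one_pos le_rfl Q hQ
    rw [div_one, Real.log_one, mul_zero, zero_add] at h2
    have h3 : (0 : ℝ) ≤ l * max (Real.log (1 / y)) 0 := by positivity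
    refine le_trans (Finset.sum_le_sum fun u _ => ?_) (h2.trans (by linarith))
    have := Real.pi_pos
    gcongr

/-- An orbit point of height h has -log|q| = 2πh, and each q arises from at most twice
`ellipticOrder z` pairs. The quotient of these two factors is the weight π over `ellipticOrder z`.
-/
theorem sum_orbit_le (hf : IsCuspidal f l) :
    ∃ B' : ℝ, 0 ≤ B' ∧ ∀ y : ℝ, 0 < y → ∀ S : Finset ℂ, (∀ z ∈ S, z ∈ fundDomain) →
      ∀ C : Finset (ℤ × ℤ), (∀ p ∈ C, IsCoprime p.1 p.2) →
      ∑ z ∈ S, Real.pi * (analyticOrderNatAt f z / ellipticOrder z) *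
        ∑ p ∈ C, max (z.im / ‖(p.1 : ℂ) * z + p.2‖ ^ 2 - y) 0 ≤
          l * max (Real.log (1 / y)) 0 + B' := by
  obtain ⟨B', hB', h⟩ := hf.exists_sum_cuspMap_le
  refine ⟨B', hB', fun y hy S hS C hC => ?_⟩
  classical
  have hpi := Real.pi_pos
  have hS0 : ∀ z ∈ S, 0 < z.im := fun z hz => ((mem_fundDomain_iff z).mp (hS z hz)).1
  set Φ : ℂ × (ℤ × ℤ) → ℂ := fun x => Function.Periodic.qParam 1 (orbitPoint x.1 x.2)
  set G : ℂ → ℝ := fun u =>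
    analyticOrderNatAt (cuspMap f) u * max (-Real.log ‖u‖ - 2 * Real.pi * y) 0
  have hG : ∀ u, 0 ≤ G u := fun u => by positivity
  have h1 := h y hy ((S ×ˢ C).image Φ) (fun u hu => by
    obtain ⟨⟨z, p⟩, hx, rfl⟩ := Finset.mem_image.mp hu
    rw [Finset.mem_product] at hx
    exact ⟨Function.Periodic.qParam_ne_zero _, Function.Periodic.norm_qParam_lt_one one_pos
      (orbitPoint_im_pos (hC p hx.2) (hS0 z hx.1))⟩)
  refine le_trans ?_ h1
  have hterm : ∀ z ∈ S, ∀ p ∈ C, Real.pi * (analyticOrderNatAt f z / ellipticOrder z) *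
      max (z.im / ‖(p.1 : ℂ) * z + p.2‖ ^ 2 - y) 0 =
        1 / (2 * ellipticOrder z) * G (Φ (z, p)) := by
    intro z hz p hp
    have e1 : analyticOrderNatAt (cuspMap f) (Φ (z, p)) = analyticOrderNatAt f z := by
      unfold analyticOrderNatAt
      rw [hf.analyticOrderAt_cuspMap (orbitPoint_im_pos (hC p hp) (hS0 z hz))]
      unfold orbitPoint
      rw [hf.analyticOrderAt_moebius (topRow_det (hC p hp)) (hS0 z hz)]
    have e2 : -Real.log ‖Φ (z, p)‖ = 2 * Real.pi * (z.im / ‖(p.1 : ℂ) * z + p.2‖ ^ 2) := by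
      rw [Function.Periodic.norm_qParam, Real.log_exp, orbitPoint_im (hC p hp)]
      ring
    simp only [G]
    have e3 : ∀ a : ℝ, max (2 * Real.pi * a - 2 * Real.pi * y) 0 = 2 * Real.pi * max (a - y) 0 := by
      intro a
      rw [← mul_sub, mul_max_of_nonneg _ _ (by positivity), mul_zero]
    rw [e1, e2, e3, one_div_mul_eq_div, mul_div_assoc', mul_comm (2 : ℝ) (ellipticOrder z : ℝ),
      ← div_div, mul_div_right_comm]
    ring
  calc _ = ∑ x ∈ S ×ˢ C, 1 / (2 * (ellipticOrder x.1 : ℝ)) * G (Φ x) := by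
        rw [Finset.sum_product]
        refine Finset.sum_congr rfl fun z hz => ?_
        rw [Finset.mul_sum]
        exact Finset.sum_congr rfl fun p hp => hterm z hz p hp
    _ = ∑ u ∈ (S ×ˢ C).image Φ, ∑ x ∈ S ×ˢ C with Φ x = u,
          1 / (2 * (ellipticOrder x.1 : ℝ)) * G (Φ x) :=
        (Finset.sum_fiberwise_of_maps_to (fun x hx => Finset.mem_image_of_mem Φ hx) _).symm
    _ ≤ ∑ u ∈ (S ×ˢ C).image Φ, G u := by
        refine Finset.sum_le_sum fun u hu => ?_
        obtain ⟨⟨w, p'⟩, hx', rfl⟩ := Finset.mem_image.mp hu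
        rw [Finset.mem_product] at hx'
        have hfib : ∀ x ∈ (S ×ˢ C).filter (fun x => Φ x = Φ (w, p')), x.1 = w ∧
            ∃ t ∈ stabilizerList w,
              x.2 = (p'.1 * t.1.1 + p'.2 * t.2.1, p'.1 * t.1.2 + p'.2 * t.2.2) := by
          intro x hx
          rw [Finset.mem_filter, Finset.mem_product] at hx
          exact qParam_orbitPoint_eq (hC _ hx.1.2) (hC _ hx'.2) (hS _ hx.1.1) (hS _ hx'.1) hx.2
        have hcard : ((S ×ˢ C).filter (fun x => Φ x = Φ (w, p'))).card ≤ 2 * ellipticOrder w := by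
          refine le_trans ?_ (card_stabilizerList_le w)
          refine le_trans (Finset.card_le_card_of_injOn (fun x => x.2)
            (t := (stabilizerList w).image
              fun t => (p'.1 * t.1.1 + p'.2 * t.2.1, p'.1 * t.1.2 + p'.2 * t.2.2)) ?_ ?_)
            Finset.card_image_le
          · intro x hx
            obtain ⟨-, t, ht, h2⟩ := hfib x hx
            exact Finset.mem_coe.mpr (Finset.mem_image.mpr ⟨t, ht, h2.symm⟩)
          · intro x hx x' hx' hxx
            exact Prod.ext ((hfib x hx).1.trans (hfib x' hx').1.symm) hxx
        have hepos : (0 : ℝ) < 2 * ellipticOrder w := by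
          have : 0 < ellipticOrder w := by unfold ellipticOrder; split_ifs <;> norm_num
          positivity
        calc _ = ∑ x ∈ S ×ˢ C with Φ x = Φ (w, p'),
              1 / (2 * (ellipticOrder w : ℝ)) * G (Φ (w, p')) := by
              refine Finset.sum_congr rfl fun x hx => ?_
              rw [(hfib x hx).1, (Finset.mem_filter.mp hx).2]
          _ = (((S ×ˢ C).filter (fun x => Φ x = Φ (w, p'))).card : ℝ) / (2 * ellipticOrder w) *
                G (Φ (w, p')) := by
              rw [Finset.sum_const, nsmul_eq_mul]; ring
          _ ≤ 1 * G (Φ (w, p')) := by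
              refine mul_le_mul_of_nonneg_right ?_ (hG _)
              rw [div_le_one hepos]
              exact_mod_cast hcard
          _ = G (Φ (w, p')) := one_mul _

/-- Every nonzero pair is n times a coprime pair. The pairs of content n give 1/n² times the coprime
sum at height n² y, whose bound is no larger than the one at y. Summing 1/n² produces π²/6. -/
theorem sum_lattice_le (hf : IsCuspidal f l) :
    ∃ B' : ℝ, ∀ y : ℝ, 0 < y → y ≤ 1 → ∀ S : Finset ℂ, (∀ z ∈ S, z ∈ fundDomain) →
      ∀ E : Finset (ℤ × ℤ), (0 : ℤ × ℤ) ∉ E →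
      ∑ z ∈ S, Real.pi * (analyticOrderNatAt f z / ellipticOrder z) *
        ∑ p ∈ E, max (z.im / ‖(p.1 : ℂ) * z + p.2‖ ^ 2 - y) 0 ≤
          Real.pi ^ 2 / 6 * (l * Real.log (1 / y) + B') := by
  obtain ⟨B', hB', h⟩ := hf.sum_orbit_le
  refine ⟨B', fun y hy hy1 S hS E hE => ?_⟩
  classical
  have hpi := Real.pi_pos
  set prim : ℤ × ℤ → ℤ × ℤ := fun p => (p.1 / Int.gcd p.1 p.2, p.2 / Int.gcd p.1 p.2)
  set cont : ℤ × ℤ → ℕ := fun p => Int.gcd p.1 p.2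
  have hcont : ∀ p ∈ E, 0 < cont p := by
    intro p hp
    refine Nat.pos_of_ne_zero fun h0 => hE ?_
    have h1 := Int.gcd_eq_zero_iff.mp h0
    have : p = 0 := Prod.ext h1.1 h1.2
    rwa [this] at hp
  have hprim : ∀ p ∈ E, IsCoprime (prim p).1 (prim p).2 := by
    intro p hp
    rw [Int.isCoprime_iff_gcd_eq_one]
    exact Int.gcd_div_gcd_div_gcd (hcont p hp)
  have hfac : ∀ p : ℤ × ℤ, p = (cont p * (prim p).1, cont p * (prim p).2) := by
    intro p
    exact Prod.ext (Int.mul_ediv_cancel' (Int.gcd_dvd_left _ _)).symm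
      (Int.mul_ediv_cancel' (Int.gcd_dvd_right _ _)).symm
  set C := E.image prim
  set N := E.image cont
  have hC : ∀ p ∈ C, IsCoprime p.1 p.2 := by
    intro p hp
    obtain ⟨q, hq, rfl⟩ := Finset.mem_image.mp hp
    exact hprim q hq
  have hN : ∀ n ∈ N, 0 < n := by
    intro n hn
    obtain ⟨q, hq, rfl⟩ := Finset.mem_image.mp hn
    exact hcont q hq
  set W : ℂ → ℝ := fun z => Real.pi * (analyticOrderNatAt f z / ellipticOrder z)
  have hW : ∀ z, 0 ≤ W z := fun z => by positivity
  have hlog : 0 ≤ Real.log (1 / y) := Real.log_nonneg ((one_le_div hy).mpr hy1)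
  have hlevel : ∀ n ∈ N, ∑ z ∈ S, W z * ∑ p ∈ C,
      max (z.im / ‖((n : ℂ) * p.1) * z + n * p.2‖ ^ 2 - y) 0 ≤
        1 / (n : ℝ) ^ 2 * (l * Real.log (1 / y) + B') := by
    intro n hn
    have hn0 : (0 : ℝ) < n := by exact_mod_cast hN n hn
    have hn1 : (1 : ℝ) ≤ n := by exact_mod_cast hN n hn
    have h1 := h ((n : ℝ) ^ 2 * y) (by positivity) S hS C hC
    have h2 : max (Real.log (1 / ((n : ℝ) ^ 2 * y))) 0 ≤ Real.log (1 / y) := by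
      refine max_le (Real.log_le_log (by positivity) ?_) hlog
      refine one_div_le_one_div_of_le hy ?_
      exact le_mul_of_one_le_left hy.le (one_le_pow₀ hn1)
    have h3 : ∀ z : ℂ, ∀ p : ℤ × ℤ, max (z.im / ‖((n : ℂ) * p.1) * z + n * p.2‖ ^ 2 - y) 0 =
        1 / (n : ℝ) ^ 2 * max (z.im / ‖(p.1 : ℂ) * z + p.2‖ ^ 2 - n ^ 2 * y) 0 := by
      intro z p
      rw [mul_max_of_nonneg _ _ (by positivity), mul_zero,
        show ((n : ℂ) * p.1) * z + n * p.2 = n * (p.1 * z + p.2) by ring, norm_mul,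
        Complex.norm_natCast, mul_pow, mul_sub]
      congr 2
      · rw [one_div, ← div_div, div_right_comm, div_eq_inv_mul]
      · field_simp
    simp_rw [h3, ← Finset.mul_sum, mul_left_comm (W _), ← Finset.mul_sum]
    refine mul_le_mul_of_nonneg_left (h1.trans ?_) (by positivity)
    gcongr
  have hsumE : ∀ z : ℂ, ∑ p ∈ E, max (z.im / ‖(p.1 : ℂ) * z + p.2‖ ^ 2 - y) 0 ≤
      ∑ n ∈ N, ∑ p ∈ C, max (z.im / ‖((n : ℂ) * p.1) * z + n * p.2‖ ^ 2 - y) 0 := by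
    intro z
    rw [← Finset.sum_product' N C
      (fun n p => max (z.im / ‖((n : ℂ) * p.1) * z + n * p.2‖ ^ 2 - y) 0)]
    have hinj : Set.InjOn (fun p => (cont p, prim p)) E := by
      intro p _ q _ hpq
      have h1 : cont p = cont q := (Prod.ext_iff.mp hpq).1
      have h2 : prim p = prim q := (Prod.ext_iff.mp hpq).2
      rw [hfac p, hfac q, h1, h2]
    calc _ = ∑ p ∈ E, (fun x : ℕ × (ℤ × ℤ) =>
            max (z.im / ‖((x.1 : ℂ) * x.2.1) * z + x.1 * x.2.2‖ ^ 2 - y) 0) (cont p, prim p) := by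
          refine Finset.sum_congr rfl fun p _ => ?_
          have h4 := hfac p
          have h5 : (p.1 : ℂ) = (cont p : ℂ) * (prim p).1 := by
            exact_mod_cast congrArg (fun x : ℤ × ℤ => (x.1 : ℂ)) h4
          have h6 : (p.2 : ℂ) = (cont p : ℂ) * (prim p).2 := by
            exact_mod_cast congrArg (fun x : ℤ × ℤ => (x.2 : ℂ)) h4
          simp only
          rw [← h5, ← h6]
      _ = ∑ x ∈ E.image (fun p => (cont p, prim p)),
            max (z.im / ‖((x.1 : ℂ) * x.2.1) * z + x.1 * x.2.2‖ ^ 2 - y) 0 :=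
          (Finset.sum_image (f := fun x : ℕ × (ℤ × ℤ) =>
            max (z.im / ‖((x.1 : ℂ) * x.2.1) * z + x.1 * x.2.2‖ ^ 2 - y) 0) hinj).symm
      _ ≤ _ := by
          refine Finset.sum_le_sum_of_subset_of_nonneg ?_ fun _ _ _ => le_max_right _ _
          intro x hx
          obtain ⟨p, hp, rfl⟩ := Finset.mem_image.mp hx
          exact Finset.mem_product.mpr
            ⟨Finset.mem_image_of_mem _ hp, Finset.mem_image_of_mem _ hp⟩
  calc _ ≤ ∑ z ∈ S, W z * ∑ n ∈ N, ∑ p ∈ C,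
        max (z.im / ‖((n : ℂ) * p.1) * z + n * p.2‖ ^ 2 - y) 0 :=
        Finset.sum_le_sum fun z _ => mul_le_mul_of_nonneg_left (hsumE z) (hW z)
    _ = ∑ n ∈ N, ∑ z ∈ S, W z * ∑ p ∈ C,
        max (z.im / ‖((n : ℂ) * p.1) * z + n * p.2‖ ^ 2 - y) 0 := by
        simp_rw [Finset.mul_sum (s := N)]
        exact Finset.sum_comm
    _ ≤ ∑ n ∈ N, 1 / (n : ℝ) ^ 2 * (l * Real.log (1 / y) + B') := Finset.sum_le_sum hlevel
    _ = (∑ n ∈ N, 1 / (n : ℝ) ^ 2) * (l * Real.log (1 / y) + B') := by rw [Finset.sum_mul]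
    _ ≤ _ := by
        refine mul_le_mul_of_nonneg_right ?_ (by positivity)
        exact sum_le_hasSum N (fun n _ => by positivity) hasSum_zeta_two

/-- The valence inequality. -/
theorem sum_order_le (hf : IsCuspidal f l) {S : Finset ℂ} (hS : ∀ z ∈ S, z ∈ fundDomain) :
    ∑ z ∈ S, (analyticOrderNatAt f z / ellipticOrder z : ℝ) ≤ (2 * l : ℕ) / 12 := by
  obtain ⟨B', h⟩ := hf.sum_lattice_le
  classical
  have hpi := Real.pi_pos
  set V := ∑ z ∈ S, (analyticOrderNatAt f z / ellipticOrder z : ℝ)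
  -- Both sides of the Jensen bound grow like log(1/y). Comparing their coefficients as y → 0 gives
  -- the claim, with δ removed afterwards.
  have key : ∀ δ, 0 < δ → δ < Real.pi → Real.pi * V * (Real.pi - δ) ≤ Real.pi ^ 2 / 6 * l := by
    intro δ hδ hδ'
    have hz0 : ∀ z ∈ S, 0 < z.im := fun z hz => ((mem_fundDomain_iff z).mp (hS z hz)).1
    choose! B s hs hE using fun z (hz : z ∈ S) => exists_lattice_sum_ge (hz0 z hz) hδ hδ'
    obtain ⟨s₀, hs₀, hs₁, hs₂⟩ : ∃ s₀ : ℝ, 0 < s₀ ∧ s₀ ≤ 1 ∧ ∀ z ∈ S, s₀ ≤ s z := by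
      rcases S.eq_empty_or_nonempty with rfl | hne
      · exact ⟨1, one_pos, le_rfl, by simp⟩
      · refine ⟨min 1 (S.inf' hne s), lt_min one_pos ?_, min_le_left _ _, fun z hz => ?_⟩
        · rw [Finset.lt_inf'_iff]; exact hs
        · exact (min_le_right _ _).trans (Finset.inf'_le _ hz)
    by_contra! hcon
    set K := ∑ z ∈ S, Real.pi * (analyticOrderNatAt f z / ellipticOrder z) * B z
    have hineq : ∀ y, 0 < y → y ≤ s₀ →
        (Real.pi * V * (Real.pi - δ) - Real.pi ^ 2 / 6 * l) * Real.log (1 / y) ≤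
          Real.pi ^ 2 / 6 * B' + K := by
      intro y hy hys
      choose! E hE0 hE1 using fun z (hz : z ∈ S) => hE z hz y hy (hys.trans (hs₂ z hz))
      have h1 := h y hy (hys.trans hs₁) S hS (S.biUnion E) (by
        rw [Finset.mem_biUnion]
        rintro ⟨z, hz, h0⟩
        exact hE0 z hz h0)
      have h2 : ∑ z ∈ S, Real.pi * (analyticOrderNatAt f z / ellipticOrder z) *
          ((Real.pi - δ) * Real.log (1 / y) - B z) ≤ _ :=
        (Finset.sum_le_sum fun z hz => mul_le_mul_of_nonneg_left
          ((hE1 z hz).trans (Finset.sum_le_sum_of_subset_of_nonneg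
            (Finset.subset_biUnion_of_mem E hz) fun _ _ _ => le_max_right _ _))
          (by positivity)).trans h1
      have h3 : ∑ z ∈ S, Real.pi * (analyticOrderNatAt f z / ellipticOrder z) *
          ((Real.pi - δ) * Real.log (1 / y) - B z) =
            Real.pi * V * (Real.pi - δ) * Real.log (1 / y) - K := by
        simp only [K, V, Finset.mul_sum, Finset.sum_mul, ← Finset.sum_sub_distrib]
        exact Finset.sum_congr rfl fun z _ => by ring
      rw [h3] at h2
      linarith
    set A := Real.pi * V * (Real.pi - δ) - Real.pi ^ 2 / 6 * l
    have hA : 0 < A := by simp only [A]; linarith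
    set D := Real.pi ^ 2 / 6 * B' + K
    -- This height makes log(1/y) at least D/A + 1, so that A log(1/y) exceeds D.
    have h4 := hineq (min s₀ (Real.exp (-(D / A + 1)))) (lt_min hs₀ (Real.exp_pos _))
      (min_le_left _ _)
    have h5 : D / A + 1 ≤ Real.log (1 / min s₀ (Real.exp (-(D / A + 1)))) := by
      rw [one_div, Real.log_inv]
      have h6 : Real.log (min s₀ (Real.exp (-(D / A + 1)))) ≤ -(D / A + 1) := by
        rw [Real.log_le_iff_le_exp (lt_min hs₀ (Real.exp_pos _))]
        exact min_le_right _ _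
      linarith
    have h6 : A * (D / A + 1) = D + A := by field_simp
    nlinarith
  have hlim : Real.pi * V * Real.pi ≤ Real.pi ^ 2 / 6 * l := by
    have ht : Tendsto (fun δ : ℝ => Real.pi * V * (Real.pi - δ)) (nhdsWithin 0 (Set.Ioi 0))
        (nhds (Real.pi * V * (Real.pi - 0))) :=
      (Continuous.tendsto (by fun_prop) 0).mono_left nhdsWithin_le_nhds
    rw [sub_zero] at ht
    refine le_of_tendsto ht ?_
    filter_upwards [Ioo_mem_nhdsGT hpi] with δ hδ
    exact key δ hδ.1 hδ.2
  have h7 : Real.pi ^ 2 * V ≤ Real.pi ^ 2 * (l / 6) := by nlinarith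
  have h8 := le_of_mul_le_mul_left h7 (by positivity)
  push_cast
  linarith

end IsCuspidal

theorem isCuspidal_poincare {l m : ℕ} (hl : 3 ≤ l) (hm : 1 ≤ m) :
    IsCuspidal (poincare (2 * l) m) l where
  differentiableOn := differentiableOn_poincare (by omega) m
  moebius := fun h _ hz => poincare_moebius (2 * l) m h hz
  bound := exists_norm_poincare_mul_pow_le hl hm

/-! ### Approximation of the series by its dominant terms. -/

/-- The modulus of the terms of the Poincaré series with `|c z + d| = r` at height `y`. -/
noncomputable def termSize (k m : ℕ) (y r : ℝ) : ℝ :=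
  Real.exp (-(2 * Real.pi * m * (y / r ^ 2))) / r ^ k

theorem termSize_pos (k m : ℕ) (y : ℝ) {r : ℝ} (hr : 0 < r) : 0 < termSize k m y r := by
  unfold termSize; positivity

theorem termSize_eq_exp (k m : ℕ) (y : ℝ) {r : ℝ} (hr : 0 < r) :
    termSize k m y r = Real.exp (-(2 * Real.pi * m * (y / r ^ 2)) - k * Real.log r) := by
  rw [Real.exp_sub, termSize, mul_comm (k : ℝ), Real.exp_mul, Real.exp_log hr, Real.rpow_natCast]

/-- The derivative of log `termSize` with respect to log r is 4πmy/r² - k, which is at most -κk for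
r ≥ R. The integrated form uses 1 - 1/s ≤ log s at s = (r/R)². -/
theorem termSize_le {k m : ℕ} {y r R κ : ℝ} (hR : 0 < R) (hr : R ≤ r) (hκ : κ ≤ 1)
    (h : 4 * Real.pi * m * y ≤ (1 - κ) * k * R ^ 2) :
    termSize k m y r ≤ termSize k m y R * (R / r) ^ (κ * k) := by
  have hr0 : 0 < r := hR.trans_le hr
  rw [termSize_eq_exp _ _ _ hR, termSize_eq_exp _ _ _ hr0, Real.rpow_def_of_pos (by positivity),
    ← Real.exp_add, Real.exp_le_exp, Real.log_div hR.ne' hr0.ne']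
  have hs := Real.one_sub_inv_le_log_of_pos (show 0 < (r / R) ^ 2 by positivity)
  rw [Real.log_pow, Real.log_div hr0.ne' hR.ne'] at hs
  push_cast at hs
  have h1 : 2 * Real.pi * m * (y / R ^ 2) ≤ (1 - κ) * k / 2 := by
    rw [mul_div_assoc', div_le_iff₀ (by positivity)]
    linarith
  have h2 : 0 ≤ 1 - ((r / R) ^ 2)⁻¹ := by
    have : 1 ≤ (r / R) ^ 2 := one_le_pow₀ ((one_le_div hR).mpr hr)
    linarith [inv_le_one_of_one_le₀ this]
  have h3 : 2 * Real.pi * m * (y / r ^ 2) =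
      2 * Real.pi * m * (y / R ^ 2) * ((r / R) ^ 2)⁻¹ := by field_simp
  have h4 : 0 ≤ (1 - κ) * k / 2 := by
    have : (0 : ℝ) ≤ k := Nat.cast_nonneg k
    have : 0 ≤ 1 - κ := by linarith
    positivity
  have h5 : 2 * Real.pi * m * (y / R ^ 2) * (1 - ((r / R) ^ 2)⁻¹) ≤
      (1 - κ) * k / 2 * (2 * (Real.log r - Real.log R)) :=
    (mul_le_mul_of_nonneg_right h1 h2).trans (mul_le_mul_of_nonneg_left hs h4)
  rw [h3]
  linarith

theorem norm_term_eq_termSize (k m : ℕ) {c d : ℤ} (h : IsCoprime c d) (z : ℂ) :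
    ‖term k m c d z‖ = termSize k m z.im ‖(c : ℂ) * z + d‖ :=
  norm_term k m h z

/-- Off `F` every term carries a factor (R/r)^(κk) with R/r ≤ 1/(1+δ). Three of these powers make
the sum over pairs converge; the others tend to 0 with k, uniformly in m, z, R and `F`. -/
theorem exists_norm_poincare_sub_le (Y : ℝ) {κ δ η : ℝ} (hκ : 0 < κ) (hκ1 : κ ≤ 1) (hδ : 0 < δ)
    (hη : 0 < η) : ∃ K : ℕ, ∀ k m : ℕ, K ≤ k → ∀ z : ℂ, |z.re| ≤ 1 / 2 → 1 / 2 ≤ z.im →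
      ∀ R : ℝ, 0 < R → R ≤ Y → 4 * Real.pi * m * z.im ≤ (1 - κ) * k * R ^ 2 →
      ∀ F : Finset CoprimePair,
        (∀ p : CoprimePair, p ∉ F → (1 + δ) * R ≤ ‖(p.1.1 : ℂ) * z + p.1.2‖) →
        ‖poincare k m z - 1 / 2 * ∑ p ∈ F, term k m p.1.1 p.1.2 z‖ ≤ η * termSize k m z.im R := by
  obtain ⟨r, hr, hb⟩ := exists_mul_pairNorm_le (1 / 2) (B := 1 / 2) (by norm_num)
  set S := ∑' p : CoprimePair, 1 / pairNorm p.1.1 p.1.2 ^ 3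
  set q : ℝ := 1 / (1 + δ)
  have hq0 : 0 < q := by positivity
  have hq1 : q < 1 := by rw [div_lt_one (by positivity)]; linarith
  have htend : Tendsto (fun k : ℕ => q ^ (κ * k - 3) * ((Y / r) ^ 3 * S)) atTop (nhds 0) := by
    have h1 : Tendsto (fun k : ℕ => κ * (k : ℝ) - 3) atTop atTop :=
      tendsto_atTop_add_const_right _ _
        (tendsto_natCast_atTop_atTop.const_mul_atTop hκ)
    have h2 := (tendsto_rpow_atTop_of_base_lt_one q (by linarith) hq1).comp h1
    simpa using h2.mul_const ((Y / r) ^ 3 * S)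
  obtain ⟨K₁, hK₁⟩ := eventually_atTop.mp (htend.eventually_lt_const hη)
  obtain ⟨K₂, hK₂⟩ := exists_nat_ge (3 / κ)
  refine ⟨max (max K₁ K₂) 3, fun k m hk z hx hy R hR hRY hm F hF => ?_⟩
  have hk1 : K₁ ≤ k := ((le_max_left _ _).trans (le_max_left _ _)).trans hk
  have hk2 : 3 ≤ κ * k := by
    have h1 : (K₂ : ℝ) ≤ k := by
      exact_mod_cast ((le_max_right K₁ K₂).trans (le_max_left _ _)).trans hk
    rw [div_le_iff₀ hκ] at hK₂
    nlinarith
  have hk3 : 3 ≤ k := (le_max_right _ _).trans hk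
  have hz : 0 < z.im := by linarith
  have hT := termSize_pos k m z.im hR
  have hsum := summable_term hk3 m hz
  have hbound : ∀ p : CoprimePair, p ∉ F → ‖term k m p.1.1 p.1.2 z‖ ≤
      termSize k m z.im R * (q ^ (κ * k - 3) * (Y / r) ^ 3) * (1 / pairNorm p.1.1 p.1.2 ^ 3) := by
    intro p hp
    set w := ‖(p.1.1 : ℂ) * z + p.1.2‖ with hw
    have hN := one_le_pairNorm p.2
    have hwR := hF p hp
    have hw0 : 0 < w := lt_of_lt_of_le (by positivity) hwR
    have hRw : R ≤ w := by nlinarith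
    have hwN := hb z hx hy p.1.1 p.1.2
    rw [norm_term_eq_termSize k m p.2]
    refine (termSize_le hR hRw hκ1 hm).trans ?_
    rw [mul_assoc, mul_assoc]
    refine mul_le_mul_of_nonneg_left ?_ hT.le
    have h1 : (R / w) ^ (κ * k) = (R / w) ^ (κ * k - 3) * (R / w) ^ 3 := by
      rw [← Real.rpow_natCast, ← Real.rpow_add (by positivity)]
      norm_num
    have h2 : R / w ≤ q := by
      rw [div_le_div_iff₀ hw0 (by positivity)]
      linarith
    have h3 : R / w ≤ Y / r * (1 / pairNorm p.1.1 p.1.2) := by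
      rw [div_mul_div_comm, mul_one]
      have hY : 0 < Y := hR.trans_le hRY
      gcongr
    rw [h1]
    calc (R / w) ^ (κ * k - 3) * (R / w) ^ 3
        ≤ q ^ (κ * k - 3) * (Y / r * (1 / pairNorm p.1.1 p.1.2)) ^ 3 := by
          gcongr
      _ = q ^ (κ * k - 3) * ((Y / r) ^ 3 * (1 / pairNorm p.1.1 p.1.2 ^ 3)) := by
          rw [mul_pow, div_pow 1, one_pow]
  have hsplit := hsum.sum_add_tsum_compl (s := F)
  have hrest : poincare k m z - 1 / 2 * ∑ p ∈ F, term k m p.1.1 p.1.2 z =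
      1 / 2 * ∑' p : ((F : Set CoprimePair)ᶜ : Set CoprimePair), term k m p.1.1.1 p.1.1.2 z := by
    unfold poincare
    rw [← hsplit]
    ring
  set A := termSize k m z.im R * (q ^ (κ * k - 3) * (Y / r) ^ 3)
  have hA : 0 ≤ A := by
    have hY : 0 < Y := hR.trans_le hRY
    positivity
  rw [hrest, norm_mul]
  have hsub : Summable fun p : ((F : Set CoprimePair)ᶜ : Set CoprimePair) =>
      A * (1 / pairNorm p.1.1.1 p.1.1.2 ^ 3) :=
    (summable_pairNorm.mul_left A).subtype _
  have h4 : ‖∑' p : ((F : Set CoprimePair)ᶜ : Set CoprimePair), term k m p.1.1.1 p.1.1.2 z‖ ≤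
      A * S := by
    refine (tsum_of_norm_bounded hsub.hasSum fun p => hbound p.1 p.2).trans ?_
    simp only [S]
    rw [← tsum_mul_left]
    exact Summable.tsum_subtype_le (fun p : CoprimePair => A * (1 / pairNorm p.1.1 p.1.2 ^ 3)) _
      (fun p => by
        have := one_le_pairNorm p.2
        positivity) (summable_pairNorm.mul_left A)
  have h5 : A * S ≤ η * termSize k m z.im R := by
    have := (hK₁ k hk1).le
    calc A * S = (q ^ (κ * k - 3) * ((Y / r) ^ 3 * S)) * termSize k m z.im R := by
          simp only [A]; ring
      _ ≤ _ := by gcongr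
  have h6 : ‖(1 / 2 : ℂ)‖ = 1 / 2 := by norm_num
  rw [h6]
  have := norm_nonneg
    (∑' p : ((F : Set CoprimePair)ᶜ : Set CoprimePair), term k m p.1.1.1 p.1.1.2 z)
  linarith

/-- Turns an additive gap between squares into the multiplicative gap required for the tail. For t ≤
1 one has (1+t)² a² ≤ a² + 3tM², which explains the choice of t. -/
theorem exists_one_add_mul_le {ε M : ℝ} (hε : 0 < ε) (hM : 0 < M) :
    ∃ t > 0, ∀ a b : ℝ, 0 < a → a ≤ M → 0 ≤ b → a ^ 2 + ε ≤ b ^ 2 → (1 + t) * a ≤ b := by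
  refine ⟨min 1 (ε / (3 * M ^ 2)), by positivity, fun a b ha haM hb h => ?_⟩
  set t := min 1 (ε / (3 * M ^ 2))
  have ht0 : 0 < t := by positivity
  have ht1 : t ≤ 1 := min_le_left _ _
  have ht2 : t * (3 * M ^ 2) ≤ ε := by
    have : t ≤ ε / (3 * M ^ 2) := min_le_right _ _
    rwa [le_div_iff₀ (by positivity)] at this
  refine abs_le_of_sq_le_sq' ?_ hb |>.2
  have h1 : a ^ 2 ≤ M ^ 2 := by gcongr
  have h2 : t ^ 2 ≤ t := by nlinarith
  have h3 : t * a ^ 2 ≤ t * M ^ 2 := by gcongr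
  have h4 : t ^ 2 * a ^ 2 ≤ t * a ^ 2 := by gcongr
  nlinarith

theorem normSq_denom (c d : ℤ) (z : ℂ) :
    ‖(c : ℂ) * z + d‖ ^ 2 = (c * z.re + d) ^ 2 + (c * z.im) ^ 2 := by
  rw [normSq_eq_re_im]; simp

theorem term_zero_one (k m : ℕ) {z : ℂ} (hz : 0 < z.im) :
    term k m 0 1 z = Complex.exp (2 * Real.pi * Complex.I * m * z) := by
  rw [term_eq k m (a := 1) (b := 0) (by norm_num) hz]
  simp

theorem term_one_zero (k m : ℕ) {z : ℂ} (hz : 0 < z.im) :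
    term k m 1 0 z = Complex.exp (2 * Real.pi * Complex.I * m * (-1 / z)) / z ^ k := by
  rw [term_eq k m (a := 0) (b := -1) (by norm_num) hz]
  simp

theorem term_one_neg_one (k m : ℕ) {z : ℂ} (hz : 0 < z.im) :
    term k m 1 (-1) z =
      Complex.exp (2 * Real.pi * Complex.I * m * (-1 / (z - 1))) / (z - 1) ^ k := by
  rw [term_eq k m (a := 0) (b := -1) (by norm_num) hz]
  simp [sub_eq_add_neg]

/-- A coprime pair as an element of the index type. -/
def mkPair (c d : ℤ) (h : IsCoprime c d) : CoprimePair := ⟨(c, d), h⟩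

open Classical in
/-- The pairs `±(0, 1)` and `±(1, 0)`. -/
noncomputable def innerPairs : Finset CoprimePair :=
  -- The entries -0 (and - -1 below) keep the shape of a negated pair, so that `term_neg` rewrites
  -- them.
  {mkPair 0 1 (by norm_num), mkPair (-0) (-1) (by norm_num), mkPair 1 0 (by norm_num),
    mkPair (-1) (-0) (by norm_num)}

open Classical in
/-- The pairs `±(0, 1)`, `±(1, 0)` and `±(1, -1)`. -/
noncomputable def edgePairs : Finset CoprimePair :=
  {mkPair 1 (-1) (by norm_num), mkPair (-1) (- -1) (by norm_num)} ∪ innerPairs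

theorem sum_innerPairs {k : ℕ} (hk : Even k) (m : ℕ) {z : ℂ} (hz : 0 < z.im) :
    1 / 2 * ∑ p ∈ innerPairs, term k m p.1.1 p.1.2 z = term k m 0 1 z + term k m 1 0 z := by
  classical
  unfold innerPairs
  rw [Finset.sum_insert (by simp [mkPair]), Finset.sum_insert (by simp [mkPair]),
    Finset.sum_insert (by simp [mkPair]), Finset.sum_singleton]
  simp only [mkPair]
  rw [term_neg hk m (by norm_num) hz, term_neg hk m (by norm_num) hz]
  ring

theorem sum_edgePairs {k : ℕ} (hk : Even k) (m : ℕ) {z : ℂ} (hz : 0 < z.im) :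
    1 / 2 * ∑ p ∈ edgePairs, term k m p.1.1 p.1.2 z =
      term k m 0 1 z + term k m 1 0 z + term k m 1 (-1) z := by
  classical
  unfold edgePairs
  rw [Finset.sum_union, mul_add, sum_innerPairs hk m hz, Finset.sum_insert (by simp [mkPair]),
    Finset.sum_singleton]
  · simp only [mkPair]
    rw [term_neg hk m (by norm_num) hz]
    ring
  · rw [Finset.disjoint_left]
    simp [innerPairs, mkPair]

/-- For c = ±1 and d ≠ 0 the difference |cz+d|² - |z|² is at least |d|(|d| - 1 + 2δ). For |c| ≥ 2
the term 4 (Im z)² suffices. -/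
theorem norm_denom_sq_ge_of_notMem_innerPairs {δ : ℝ} (hδ : 0 < δ) {z : ℂ}
    (hx : |z.re| ≤ 1 / 2 - δ) (hz1 : 1 ≤ ‖z‖) {p : CoprimePair} (hp : p ∉ innerPairs) :
    ‖z‖ ^ 2 + 2 * δ ≤ ‖(p.1.1 : ℂ) * z + p.1.2‖ ^ 2 := by
  obtain ⟨⟨c, d⟩, hcd⟩ := p
  have hcd' : IsCoprime c d := hcd
  rw [normSq_denom, normSq_eq_re_im]
  have hz2 : 1 ≤ z.re ^ 2 + z.im ^ 2 := by rw [← normSq_eq_re_im]; nlinarith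
  obtain ⟨hx1, hx2⟩ := abs_le.mp hx
  have hy : 3 / 4 ≤ z.im ^ 2 := by nlinarith
  simp only [innerPairs, mkPair, Finset.mem_insert, Finset.mem_singleton, Subtype.mk.injEq,
    Prod.mk.injEq, not_or] at hp
  have hc0 : c ≠ 0 := by
    rintro rfl
    rw [isCoprime_zero_left, Int.isUnit_iff] at hcd'
    omega
  show z.re ^ 2 + z.im ^ 2 + 2 * δ ≤ ((c : ℝ) * z.re + d) ^ 2 + (c * z.im) ^ 2
  by_cases hc : c = 1 ∨ c = -1
  · have hd0 : d ≠ 0 := by rintro rfl; omega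
    have hd1 : (1 : ℝ) ≤ |(d : ℝ)| := by exact_mod_cast Int.one_le_abs hd0
    have hmain : ∀ e : ℝ, |e| = |(d : ℝ)| → 2 * δ ≤ 2 * e * z.re + e ^ 2 := by
      intro e he
      rw [← he] at hd1
      have h1 : -(|e| * (1 / 2 - δ)) ≤ e * z.re := by
        have := neg_abs_le (e * z.re)
        rw [abs_mul] at this
        have h2 : |e| * |z.re| ≤ |e| * (1 / 2 - δ) := by gcongr
        linarith
      rw [← sq_abs e]
      nlinarith
    rcases hc with rfl | rfl
    · have := hmain d rfl
      push_cast
      nlinarith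
    · have := hmain (-d) (abs_neg _)
      push_cast
      nlinarith
  · have hc2 : 2 ≤ |c| := by
      rcases abs_cases c with ⟨h, _⟩ | ⟨h, _⟩ <;> omega
    have hc3 : (2 : ℝ) ≤ |(c : ℝ)| := by exact_mod_cast hc2
    have hc4 : 4 ≤ (c : ℝ) ^ 2 := by rw [← sq_abs]; nlinarith
    have h1 : 4 * z.im ^ 2 ≤ (c : ℝ) ^ 2 * z.im ^ 2 := by gcongr
    nlinarith [sq_nonneg ((c : ℝ) * z.re + d)]

/-- On Re z = 1/2 one has |z - 1| = |z|, so (1,-1) must join the main pairs; beyond it the gap e² +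
e is at least 2. -/
theorem norm_denom_sq_ge_of_notMem_edgePairs {z : ℂ}
    (hx : z.re = 1 / 2) (hz1 : 1 ≤ ‖z‖) {p : CoprimePair} (hp : p ∉ edgePairs) :
    ‖z‖ ^ 2 + 2 ≤ ‖(p.1.1 : ℂ) * z + p.1.2‖ ^ 2 := by
  obtain ⟨⟨c, d⟩, hcd⟩ := p
  have hcd' : IsCoprime c d := hcd
  rw [normSq_denom, normSq_eq_re_im]
  have hz2 : 1 ≤ z.re ^ 2 + z.im ^ 2 := by rw [← normSq_eq_re_im]; nlinarith
  rw [hx] at hz2 ⊢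
  have hy : 3 / 4 ≤ z.im ^ 2 := by nlinarith
  simp only [edgePairs, innerPairs, mkPair, Finset.mem_insert, Finset.mem_singleton,
    Finset.mem_union, Subtype.mk.injEq, Prod.mk.injEq, not_or] at hp
  have hc0 : c ≠ 0 := by
    rintro rfl
    rw [isCoprime_zero_left, Int.isUnit_iff] at hcd'
    omega
  show (1 / 2) ^ 2 + z.im ^ 2 + 2 ≤ ((c : ℝ) * (1 / 2) + d) ^ 2 + (c * z.im) ^ 2
  have hmain : ∀ e : ℤ, e ≠ 0 → e ≠ -1 → 2 ≤ (e : ℝ) + (e : ℝ) ^ 2 := by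
    intro e h1 h2
    have : 2 ≤ e + e ^ 2 := by
      rcases (by omega : 1 ≤ e ∨ e ≤ -2) with h | h <;> nlinarith
    exact_mod_cast this
  by_cases hc : c = 1 ∨ c = -1
  · rcases hc with rfl | rfl
    · have := hmain d (by omega) (by omega)
      push_cast
      nlinarith
    · have := hmain (-d) (by omega) (by omega)
      push_cast at *
      nlinarith
  · have hc2 : 2 ≤ |c| := by
      rcases abs_cases c with ⟨h, _⟩ | ⟨h, _⟩ <;> omega
    have hc3 : (2 : ℝ) ≤ |(c : ℝ)| := by exact_mod_cast hc2
    have hc4 : 4 ≤ (c : ℝ) ^ 2 := by rw [← sq_abs]; nlinarith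
    have h1 : 4 * z.im ^ 2 ≤ (c : ℝ) ^ 2 * z.im ^ 2 := by gcongr
    nlinarith [sq_nonneg ((c : ℝ) * (1 / 2) + d)]

theorem half_le_im_of_one_le_norm {z : ℂ} (hx : |z.re| ≤ 1 / 2) (hz1 : 1 ≤ ‖z‖) (hz : 0 < z.im) :
    1 / 2 ≤ z.im := by
  have h1 : 1 ≤ z.re ^ 2 + z.im ^ 2 := by rw [← normSq_eq_re_im]; nlinarith
  obtain ⟨hx1, hx2⟩ := abs_le.mp hx
  nlinarith

theorem norm_le_im_add_one {z : ℂ} (hx : |z.re| ≤ 1 / 2) (hz : 0 < z.im) : ‖z‖ ≤ z.im + 1 := by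
  have := Complex.norm_le_abs_re_add_abs_im z
  rw [abs_of_pos hz] at this
  linarith

/-- This is how 4πα < 1 enters: since Im z ≤ |z|² for |z| ≥ 1, the decay hypothesis holds at every
such point with R = |z|. -/
theorem weight_condition {k m : ℕ} {κ : ℝ} (hm : 4 * Real.pi * m ≤ (1 - κ) * k) {z : ℂ}
    (hz : 0 < z.im) (hz1 : 1 ≤ ‖z‖) : 4 * Real.pi * m * z.im ≤ (1 - κ) * k * ‖z‖ ^ 2 := by
  have h1 : z.im ≤ ‖z‖ ^ 2 := by
    have := (Complex.abs_im_le_norm z)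
    rw [abs_of_pos hz] at this
    nlinarith
  have h2 : 0 ≤ 4 * Real.pi * m := by have := Real.pi_pos; positivity
  calc 4 * Real.pi * m * z.im ≤ 4 * Real.pi * m * ‖z‖ ^ 2 := by gcongr
    _ ≤ _ := by gcongr

theorem exists_approx_inner (Y : ℝ) {κ δ η : ℝ} (hκ : 0 < κ) (hκ1 : κ ≤ 1) (hδ : 0 < δ)
    (hη : 0 < η) : ∃ K : ℕ, ∀ k m : ℕ, K ≤ k → Even k → 4 * Real.pi * m ≤ (1 - κ) * k →
      ∀ z : ℂ, |z.re| ≤ 1 / 2 - δ → 1 ≤ ‖z‖ → 0 < z.im → z.im ≤ Y →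
        ‖poincare k m z - (term k m 0 1 z + term k m 1 0 z)‖ ≤ η * termSize k m z.im ‖z‖ := by
  obtain ⟨t, ht, hts⟩ := exists_one_add_mul_le (ε := 2 * δ) (M := max Y 0 + 1) (by positivity)
    (by positivity)
  obtain ⟨K, hK⟩ := exists_norm_poincare_sub_le (max Y 0 + 1) hκ hκ1 ht hη
  refine ⟨K, fun k m hk hev hm z hx hz1 hz hzY => ?_⟩
  have hx' : |z.re| ≤ 1 / 2 := by linarith
  have hzM : ‖z‖ ≤ max Y 0 + 1 := (norm_le_im_add_one hx' hz).trans (by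
    have := le_max_left Y 0
    linarith)
  rw [← sum_innerPairs hev m hz]
  refine hK k m hk z hx' (half_le_im_of_one_le_norm hx' hz1 hz) ‖z‖ (by linarith) hzM
    (weight_condition hm hz hz1) innerPairs fun p hp => ?_
  exact hts _ _ (by linarith) hzM (norm_nonneg _)
    (norm_denom_sq_ge_of_notMem_innerPairs hδ hx hz1 hp)

theorem exists_approx_edge (Y : ℝ) {κ η : ℝ} (hκ : 0 < κ) (hκ1 : κ ≤ 1)
    (hη : 0 < η) : ∃ K : ℕ, ∀ k m : ℕ, K ≤ k → Even k → 4 * Real.pi * m ≤ (1 - κ) * k →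
      ∀ z : ℂ, z.re = 1 / 2 → 1 ≤ ‖z‖ → 0 < z.im → z.im ≤ Y →
        ‖poincare k m z - (term k m 0 1 z + term k m 1 0 z + term k m 1 (-1) z)‖ ≤
          η * termSize k m z.im ‖z‖ := by
  obtain ⟨t, ht, hts⟩ := exists_one_add_mul_le (ε := 2) (M := max Y 0 + 1) (by positivity)
    (by positivity)
  obtain ⟨K, hK⟩ := exists_norm_poincare_sub_le (max Y 0 + 1) hκ hκ1 ht hη
  refine ⟨K, fun k m hk hev hm z hx hz1 hz hzY => ?_⟩
  have hx' : |z.re| ≤ 1 / 2 := by rw [hx]; norm_num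
  have hzM : ‖z‖ ≤ max Y 0 + 1 := (norm_le_im_add_one hx' hz).trans (by
    have := le_max_left Y 0
    linarith)
  rw [← sum_edgePairs hev m hz]
  refine hK k m hk z hx' (half_le_im_of_one_le_norm hx' hz1 hz) ‖z‖ (by linarith) hzM
    (weight_condition hm hz hz1) edgePairs fun p hp => ?_
  exact hts _ _ (by linarith) hzM (norm_nonneg _)
    (norm_denom_sq_ge_of_notMem_edgePairs hx hz1 hp)

/-! ### Zeros from sign changes on the arc and on the line. -/

/-- Where φ = nπ the function has the sign of (-1)^n, so it vanishes between consecutive such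
points. Rounding at the two ends costs at most 2. -/
theorem exists_zeros_of_cos_approx {f φ A : ℝ → ℝ} {a b : ℝ} (hab : a ≤ b)
    (hf : ContinuousOn f (Set.Icc a b)) (hφ : ContinuousOn φ (Set.Icc a b))
    (hA : ∀ t ∈ Set.Icc a b, |f t - A t * Real.cos (φ t)| < A t) :
    ∃ Z : Finset ℝ, (∀ t ∈ Z, t ∈ Set.Ioo a b ∧ f t = 0) ∧
      (φ b - φ a) / Real.pi - 2 ≤ (Z.card : ℝ) := by
  have hpi := Real.pi_pos
  set p : ℤ := ⌈φ a / Real.pi⌉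
  set q : ℤ := ⌊φ b / Real.pi⌋
  have hp : ∀ n : ℤ, p ≤ n → φ a ≤ n * Real.pi := fun n hn => by
    have := Int.ceil_le.mp hn
    rwa [div_le_iff₀ hpi] at this
  have hq : ∀ n : ℤ, n ≤ q → n * Real.pi ≤ φ b := fun n hn => by
    have := Int.le_floor.mp hn
    rwa [le_div_iff₀ hpi] at this
  set L : ℤ → Set ℝ := fun n => {t | t ∈ Set.Icc a b ∧ φ t = n * Real.pi}
  -- First hitting times of the levels nπ are increasing in n even if φ is not monotone.
  set τ : ℤ → ℝ := fun n => sInf (L n)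
  have hτ : ∀ n, p ≤ n → n ≤ q → τ n ∈ L n := by
    intro n h1 h2
    have hne : (L n).Nonempty := by
      obtain ⟨t, ht, hte⟩ := intermediate_value_Icc hab hφ ⟨hp n h1, hq n h2⟩
      exact ⟨t, ht, hte⟩
    have hcl : IsClosed (L n) := by
      have := hφ.preimage_isClosed_of_isClosed isClosed_Icc (isClosed_singleton (x := n * Real.pi))
      exact this
    exact hcl.csInf_mem hne ⟨a, fun t ht => ht.1.1⟩
  have hτlt : ∀ n m, p ≤ n → n < m → m ≤ q → τ n < τ m := by
    intro n m h1 h2 h3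
    have hm := hτ m (h1.trans h2.le) h3
    have hnm : (n : ℝ) * Real.pi < m * Real.pi := by
      have : (n : ℝ) < m := by exact_mod_cast h2
      gcongr
    obtain ⟨t, ht, hte⟩ := intermediate_value_Icc hm.1.1
      (hφ.mono (Set.Icc_subset_Icc_right hm.1.2)) ⟨hp n h1, by rw [hm.2]; exact hnm.le⟩
    have hle : τ n ≤ t := csInf_le ⟨a, fun t ht => ht.1.1⟩ ⟨⟨ht.1, ht.2.trans hm.1.2⟩, hte⟩
    refine lt_of_le_of_ne (hle.trans ht.2) fun heq => ?_
    have := (hτ n h1 (h2.le.trans h3)).2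
    rw [heq, hm.2] at this
    linarith
  have hsign : ∀ n, p ≤ n → n ≤ q → (Even n → 0 < f (τ n)) ∧ (¬ Even n → f (τ n) < 0) := by
    intro n h1 h2
    obtain ⟨hmem, hval⟩ := hτ n h1 h2
    have h := abs_lt.mp (hA _ hmem)
    rw [hval, Real.cos_int_mul_pi] at h
    constructor
    · intro he
      rw [he.neg_one_zpow] at h
      linarith [h.1]
    · intro ho
      rw [(Int.not_even_iff_odd.mp ho).neg_one_zpow] at h
      linarith [h.2]
  have hzero : ∀ n, p ≤ n → n < q → ∃ s ∈ Set.Ioo (τ n) (τ (n + 1)), f s = 0 := by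
    intro n h1 h2
    have hlt := hτlt n (n + 1) h1 (by omega) (by omega)
    have hm1 := (hτ n h1 h2.le).1
    have hm2 := (hτ (n + 1) (by omega) (by omega)).1
    have hcont : ContinuousOn f (Set.Icc (τ n) (τ (n + 1))) :=
      hf.mono (Set.Icc_subset_Icc hm1.1 hm2.2)
    have hs1 := hsign n h1 h2.le
    have hs2 := hsign (n + 1) (by omega) (by omega)
    by_cases he : Even n
    · have ho : ¬ Even (n + 1) := by rw [Int.even_add_one]; exact not_not.mpr he
      obtain ⟨s, hs, h0⟩ := intermediate_value_Ioo' hlt.le hcont ⟨hs2.2 ho, hs1.1 he⟩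
      exact ⟨s, hs, h0⟩
    · have ho : Even (n + 1) := by rw [Int.even_add_one]; exact he
      obtain ⟨s, hs, h0⟩ := intermediate_value_Ioo hlt.le hcont ⟨hs1.2 he, hs2.1 ho⟩
      exact ⟨s, hs, h0⟩
  choose! s hs hs0 using hzero
  have hinj : Set.InjOn s (Finset.Ico p q) := by
    have key : ∀ n m, p ≤ n → n < m → m < q → s n < s m := by
      intro n m h1 h2 h3
      have h4 : τ (n + 1) ≤ τ m := by
        rcases (by omega : n + 1 = m ∨ n + 1 < m) with h | h
        · rw [h]
        · exact (hτlt _ _ (by omega) h h3.le).le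
      exact (hs n h1 (h2.trans h3)).2.trans_le (h4.trans (hs m (h1.trans h2.le) h3).1.le)
    intro n hn m hm hnm
    rw [Finset.coe_Ico, Set.mem_Ico] at hn hm
    rcases lt_trichotomy n m with h | h | h
    · exact absurd hnm (key n m hn.1 h hm.2).ne
    · exact h
    · exact absurd hnm (key m n hm.1 h hn.2).ne'
  refine ⟨(Finset.Ico p q).image s, fun t ht => ?_, ?_⟩
  · obtain ⟨n, hn, rfl⟩ := Finset.mem_image.mp ht
    rw [Finset.mem_Ico] at hn
    have h1 := hs n hn.1 hn.2
    have hm1 := (hτ n hn.1 hn.2.le).1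
    have hm2 := (hτ (n + 1) (by omega) (by omega)).1
    exact ⟨⟨hm1.1.trans_lt h1.1, h1.2.trans_le hm2.2⟩, hs0 n hn.1 hn.2⟩
  · rw [Finset.card_image_of_injOn hinj, Int.card_Ico]
    have h1 : ((q - p : ℤ) : ℝ) ≤ ((q - p).toNat : ℝ) := by exact_mod_cast Int.self_le_toNat _
    have h2 : φ a / Real.pi + 1 > p := Int.ceil_lt_add_one _
    have h3 : φ b / Real.pi - 1 < q := Int.sub_one_lt_floor _
    push_cast at h1
    rw [sub_div]
    linarith

theorem continuousAt_poincare {k : ℕ} (hk : 3 ≤ k) (m : ℕ) {z : ℂ} (hz : 0 < z.im) :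
    ContinuousAt (poincare k m) z :=
  ((differentiableOn_poincare hk m).differentiableAt (isOpen_upper.mem_nhds hz)).continuousAt

theorem conj_two_pi_I_mul (m : ℕ) (z : ℂ) :
    starRingEnd ℂ (2 * Real.pi * Complex.I * m * z) =
      2 * Real.pi * Complex.I * m * (-starRingEnd ℂ z) := by
  simp only [map_mul, map_ofNat, Complex.conj_ofReal, Complex.conj_I, map_natCast]
  ring

/-- On |z| = 1 one has -1/z = -z̄, so modularity and reflection make e^(ikθ/2) P real and its two
main terms conjugate. Their sum is 2 exp(-2πm sin θ) cos(kθ/2 + 2πm cos θ), whose phase increases by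
π(k/12 - m) from π/3 to π/2. -/
theorem exists_zeros_arc {κ ε : ℝ} (hκ : 0 < κ) (hκ1 : κ ≤ 1) (hε : 0 < ε) :
    ∃ K : ℕ, ∀ k m : ℕ, K ≤ k → Even k → 4 * Real.pi * m ≤ (1 - κ) * k →
      ∃ Z : Finset ℂ, (∀ z ∈ Z, poincare k m z = 0 ∧ 0 < z.im ∧ ‖z‖ = 1 ∧ 0 < z.re ∧
        z.re < 1 / 2) ∧ (1 / 12 - ε) * k - m ≤ (Z.card : ℝ) := by
  have hpi := Real.pi_pos
  -- The interval starts δ beyond π/3, since at ρ the pair (1,-1) is as large as (1,0). The lost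
  -- phase kδ/2 is absorbed in ε.
  set δ : ℝ := min ε (Real.pi / 12)
  have hδ : 0 < δ := by positivity
  have hδε : δ ≤ ε := min_le_left _ _
  have hδ1 : δ ≤ Real.pi / 12 := min_le_right _ _
  set a := Real.pi / 3 + δ
  set b := Real.pi / 2
  have hab : a ≤ b := by simp only [a, b]; linarith
  have hcosa : Real.cos a < 1 / 2 := by
    rw [← Real.cos_pi_div_three]
    exact Real.cos_lt_cos_of_nonneg_of_le_pi (by positivity) (by simp only [a]; linarith)
      (by simp only [a]; linarith)
  obtain ⟨K, hK⟩ := exists_approx_inner 1 hκ hκ1 (δ := 1 / 2 - Real.cos a) (by linarith) one_pos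
  obtain ⟨K₂, hK₂⟩ := exists_nat_ge (4 / ε)
  refine ⟨max (max K K₂) 3, fun k m hk hev hm => ?_⟩
  have hk1 : K ≤ k := ((le_max_left _ _).trans (le_max_left _ _)).trans hk
  have hk3 : 3 ≤ k := (le_max_right _ _).trans hk
  have hk2 : 4 ≤ ε * k := by
    have h1 : (K₂ : ℝ) ≤ k := by
      exact_mod_cast ((le_max_right K K₂).trans (le_max_left _ _)).trans hk
    rw [div_le_iff₀ hε] at hK₂
    nlinarith
  set z : ℝ → ℂ := fun θ => Complex.exp (θ * Complex.I)
  have hzre : ∀ θ, (z θ).re = Real.cos θ := fun θ => Complex.exp_ofReal_mul_I_re θ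
  have hzim : ∀ θ, (z θ).im = Real.sin θ := fun θ => Complex.exp_ofReal_mul_I_im θ
  have hznorm : ∀ θ, ‖z θ‖ = 1 := fun θ => Complex.norm_exp_ofReal_mul_I θ
  have hsin : ∀ θ ∈ Set.Icc a b, 0 < Real.sin θ := fun θ hθ =>
    Real.sin_pos_of_pos_of_lt_pi (lt_of_lt_of_le (by positivity) hθ.1)
      (hθ.2.trans_lt (by simp only [b]; linarith))
  set E : ℝ → ℂ := fun θ => Complex.exp (k * θ / 2 * Complex.I)
  have hEnorm : ∀ θ, ‖E θ‖ = 1 := fun θ => by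
    have := Complex.norm_exp_ofReal_mul_I (k * θ / 2)
    push_cast at this
    exact this
  have hEz : ∀ θ, E θ * E θ = z θ ^ k := fun θ => by
    simp only [E, z]
    rw [← Complex.exp_add, ← Complex.exp_nat_mul]
    congr 1
    ring
  have hEconj : ∀ θ, starRingEnd ℂ (E θ) * E θ = 1 := fun θ => by
    rw [mul_comm, Complex.mul_conj, Complex.normSq_eq_norm_sq, hEnorm]
    norm_num
  have hzconj : ∀ θ, -1 / z θ = -starRingEnd ℂ (z θ) := fun θ => by
    have h0 : z θ ≠ 0 := Complex.exp_ne_zero _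
    rw [div_eq_iff h0, neg_mul, mul_comm, Complex.mul_conj, Complex.normSq_eq_norm_sq, hznorm]
    norm_num
  have hreal : ∀ θ ∈ Set.Icc a b, (E θ * poincare k m (z θ)).im = 0 := by
    intro θ hθ
    have hz0 : 0 < (z θ).im := by rw [hzim]; exact hsin θ hθ
    rw [← Complex.conj_eq_iff_im, map_mul, ← poincare_neg_conj k m hz0, ← hzconj]
    have := poincare_moebius k m (a := 0) (b := -1) (c := 1) (d := 0) (by norm_num) hz0
    simp only [Int.cast_zero, zero_mul, Int.cast_neg, Int.cast_one, zero_add, one_mul,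
      add_zero] at this
    rw [this, ← hEz, ← mul_assoc, ← mul_assoc, hEconj, one_mul]
  set f : ℝ → ℝ := fun θ => (E θ * poincare k m (z θ)).re
  set φ : ℝ → ℝ := fun θ => k * θ / 2 + 2 * Real.pi * m * Real.cos θ
  set A : ℝ → ℝ := fun θ => 2 * Real.exp (-(2 * Real.pi * m * Real.sin θ))
  have hmain : ∀ θ ∈ Set.Icc a b, |f θ - A θ * Real.cos (φ θ)| < A θ := by
    intro θ hθ
    have hz0 : 0 < (z θ).im := by rw [hzim]; exact hsin θ hθ
    have hre : |(z θ).re| ≤ 1 / 2 - (1 / 2 - Real.cos a) := by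
      rw [hzre, sub_sub_cancel, abs_of_nonneg]
      · exact Real.cos_le_cos_of_nonneg_of_le_pi (by positivity)
          (hθ.2.trans (by simp only [b]; linarith)) hθ.1
      · refine Real.cos_nonneg_of_neg_pi_div_two_le_of_le ?_ hθ.2
        have : 0 < θ := lt_of_lt_of_le (by positivity) hθ.1
        linarith
    have h1 := hK k m hk1 hev hm (z θ) hre (hznorm θ).ge hz0
      (by rw [hzim]; exact Real.sin_le_one θ)
    rw [hznorm, termSize, one_pow, one_pow, div_one, div_one, one_mul, hzim] at h1
    set w : ℂ := E θ * Complex.exp (2 * Real.pi * Complex.I * m * z θ)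
    have hw1 : E θ * term k m 0 1 (z θ) = w := by rw [term_zero_one k m hz0]
    have hw2 : E θ * term k m 1 0 (z θ) = starRingEnd ℂ w := by
      rw [term_one_zero k m hz0, hzconj, ← conj_two_pi_I_mul, Complex.exp_conj]
      simp only [w]
      rw [map_mul, ← hEz]
      have hE0 : E θ ≠ 0 := Complex.exp_ne_zero _
      rw [eq_div_of_mul_eq hE0 (hEconj θ)]
      field_simp
    have hwre : w.re = Real.exp (-(2 * Real.pi * m * Real.sin θ)) * Real.cos (φ θ) := by
      simp only [w, E]
      rw [← Complex.exp_add]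
      have h3 : (k : ℂ) * θ / 2 * Complex.I + 2 * Real.pi * Complex.I * m * z θ =
          ((-(2 * Real.pi * m * Real.sin θ) : ℝ) : ℂ) + (φ θ : ℝ) * Complex.I := by
        have h4 : z θ = Real.cos θ + Real.sin θ * Complex.I := by
          simp only [z]; rw [Complex.exp_mul_I, Complex.ofReal_cos, Complex.ofReal_sin]
        rw [h4]
        simp only [φ]
        push_cast
        linear_combination (2 * Real.pi * m * Complex.sin θ : ℂ) * Complex.I_sq
      rw [h3, Complex.exp_add, ← Complex.ofReal_exp, Complex.re_ofReal_mul,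
        Complex.exp_ofReal_mul_I_re]
    have h2 : f θ - A θ * Real.cos (φ θ) =
        (E θ * (poincare k m (z θ) - (term k m 0 1 (z θ) + term k m 1 0 (z θ)))).re := by
      rw [mul_sub, mul_add, hw1, hw2, Complex.sub_re, Complex.add_re, Complex.conj_re, hwre]
      simp only [f, A]
      ring
    rw [h2]
    refine (Complex.abs_re_le_norm _).trans_lt ?_
    rw [norm_mul, hEnorm, one_mul]
    refine h1.trans_lt ?_
    simp only [A]
    linarith [Real.exp_pos (-(2 * Real.pi * m * Real.sin θ))]
  have hfc : ContinuousOn f (Set.Icc a b) := by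
    intro θ hθ
    refine ContinuousAt.continuousWithinAt ?_
    have hz0 : 0 < (z θ).im := by rw [hzim]; exact hsin θ hθ
    have hzc : ContinuousAt z θ := by simp only [z]; fun_prop
    have h1 : ContinuousAt (fun θ => poincare k m (z θ)) θ :=
      ContinuousAt.comp (g := poincare k m) (continuousAt_poincare hk3 m hz0) hzc
    have h2 : ContinuousAt E θ := by simp only [E]; fun_prop
    exact Complex.continuous_re.continuousAt.comp (h2.mul h1)
  have hφc : ContinuousOn φ (Set.Icc a b) := by simp only [φ]; fun_prop
  obtain ⟨Z, hZ, hcard⟩ := exists_zeros_of_cos_approx hab hfc hφc hmain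
  have hinj : Set.InjOn z Z := by
    intro θ hθ θ' hθ' h
    have h1 := (hZ θ hθ).1
    have h2 := (hZ θ' hθ').1
    have h3 : Real.cos θ = Real.cos θ' := by rw [← hzre, ← hzre, h]
    have ha : 0 ≤ a := by positivity
    have hb : b ≤ Real.pi := by simp only [b]; linarith
    exact Real.injOn_cos ⟨ha.trans h1.1.le, h1.2.le.trans hb⟩ ⟨ha.trans h2.1.le, h2.2.le.trans hb⟩ h3
  classical
  refine ⟨Z.image z, fun w hw => ?_, ?_⟩
  · obtain ⟨θ, hθ, rfl⟩ := Finset.mem_image.mp hw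
    obtain ⟨h1, h2⟩ := hZ θ hθ
    have h3 : θ ∈ Set.Icc a b := Set.Ioo_subset_Icc_self h1
    have h4 : E θ * poincare k m (z θ) = 0 := Complex.ext h2 (hreal θ h3)
    have hE0 : E θ ≠ 0 := Complex.exp_ne_zero _
    have ha : 0 ≤ a := by positivity
    refine ⟨(mul_eq_zero.mp h4).resolve_left hE0, by rw [hzim]; exact hsin θ h3, hznorm θ, ?_, ?_⟩
    · rw [hzre]
      exact Real.cos_pos_of_mem_Ioo ⟨by linarith [h1.1], h1.2⟩
    · rw [hzre]
      refine lt_trans (Real.cos_lt_cos_of_nonneg_of_le_pi ha ?_ h1.1) hcosa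
      have := h1.2
      simp only [b] at this
      linarith
  · rw [Finset.card_image_of_injOn hinj]
    refine le_trans ?_ hcard
    have h1 : (φ b - φ a) / Real.pi = (k : ℝ) / 12 - k * δ / (2 * Real.pi) - 2 * m * Real.cos a := by
      simp only [φ, b]
      rw [Real.cos_pi_div_two]
      simp only [a]
      field_simp
      ring
    rw [h1]
    have h2 : (m : ℝ) * Real.cos a ≤ m * (1 / 2) := by gcongr
    have h3 : k * δ / (2 * Real.pi) ≤ ε * k / 2 := by
      rw [div_le_div_iff₀ (by positivity) (by norm_num)]
      have h4 : (k : ℝ) * δ ≤ k * ε := by gcongr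
      have := Real.pi_gt_three
      have h5 : 0 ≤ (k : ℝ) * ε := by positivity
      nlinarith
    linarith

theorem arg_mk_half (t : ℝ) : (⟨1 / 2, t⟩ : ℂ).arg = Real.arctan (2 * t) := by
  have h1 : |(⟨1 / 2, t⟩ : ℂ).arg| < Real.pi / 2 :=
    Complex.abs_arg_lt_pi_div_two_iff.mpr (Or.inl (by norm_num))
  rw [← Real.arctan_tan (abs_lt.mp h1).1 (abs_lt.mp h1).2, Complex.tan_arg]
  congr 1
  simp only
  ring

/-- Translation by 1 and reflection make P real on Re z = 1/2 and the terms of (1,0) and (1,-1)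
conjugate. The hypothesis on t says that the term of (0,1) is no larger than either of them. -/
theorem exists_zeros_line {κ : ℝ} (Y : ℝ) (hκ : 0 < κ) (hκ1 : κ ≤ 1) :
    ∃ K : ℕ, ∀ k m : ℕ, K ≤ k → Even k → 4 * Real.pi * m ≤ (1 - κ) * k →
      ∀ a b : ℝ, √3 / 2 ≤ a → a ≤ b → b ≤ Y →
      (∀ t ∈ Set.Icc a b, k * Real.log (1 / 4 + t ^ 2) / 2 ≤
        2 * Real.pi * m * (t - t / (1 / 4 + t ^ 2))) →
      ∃ Z : Finset ℂ, (∀ z ∈ Z, poincare k m z = 0 ∧ z.re = 1 / 2 ∧ a < z.im ∧ z.im < b) ∧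
        (k * Real.arctan (2 * b) + Real.pi * m / (1 / 4 + b ^ 2) -
          (k * Real.arctan (2 * a) + Real.pi * m / (1 / 4 + a ^ 2))) / Real.pi - 2 ≤
          (Z.card : ℝ) := by
  have hpi := Real.pi_pos
  -- The tail costs 1/2 and the term of (0,1) at most 1, together less than the amplitude 2 of the
  -- cosine.
  obtain ⟨K, hK⟩ := exists_approx_edge Y hκ hκ1 (η := 1 / 2) (by norm_num)
  refine ⟨max K 3, fun k m hk hev hm a b ha hab hb hdom => ?_⟩
  have hk1 : K ≤ k := (le_max_left _ _).trans hk
  have hk3 : 3 ≤ k := (le_max_right _ _).trans hk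
  have h3 : (√3) ^ 2 = 3 := Real.sq_sqrt (by norm_num)
  have h3' : 0 < √3 := by positivity
  set z : ℝ → ℂ := fun t => ⟨1 / 2, t⟩
  have hzpos : ∀ t ∈ Set.Icc a b, 0 < t := fun t ht => by linarith [ht.1]
  have hv : ∀ t : ℝ, 0 < 1 / 4 + t ^ 2 := fun t => by positivity
  have hznorm : ∀ t, ‖z t‖ = √(1 / 4 + t ^ 2) := fun t => by
    rw [eq_comm, Real.sqrt_eq_iff_eq_sq (hv t).le (norm_nonneg _), normSq_eq_re_im]
    norm_num [z]
  have hzne : ∀ t, z t ≠ 0 := fun t h => by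
    have := congrArg Complex.re h
    norm_num [z] at this
  have harg : ∀ t, (z t).arg = Real.arctan (2 * t) := arg_mk_half
  set φ : ℝ → ℝ := fun t => k * Real.arctan (2 * t) + Real.pi * m / (1 / 4 + t ^ 2)
  set A : ℝ → ℝ := fun t => 2 * termSize k m t ‖z t‖
  have hexp : ∀ t ∈ Set.Icc a b, term k m 1 0 (z t) =
      Complex.exp (2 * Real.pi * Complex.I * m * (-1 / z t) - k * Complex.log (z t)) := by
    intro t ht
    rw [term_one_zero k m (z := z t) (hzpos t ht), Complex.exp_sub, Complex.exp_nat_mul,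
      Complex.exp_log (hzne t)]
  have hexponent : ∀ t ∈ Set.Icc a b,
      2 * Real.pi * Complex.I * m * (-1 / z t) - k * Complex.log (z t) =
        ((-(2 * Real.pi * m * (t / ‖z t‖ ^ 2)) - k * Real.log ‖z t‖ : ℝ) : ℂ) +
          ((-φ t : ℝ) : ℂ) * Complex.I := by
    intro t ht
    have h1 : Complex.log (z t) = (Real.log ‖z t‖ : ℝ) + (Real.arctan (2 * t) : ℝ) * Complex.I := by
      rw [Complex.log, harg]
    have h2 : -1 / z t = ((-(1 / 2) / (1 / 4 + t ^ 2) : ℝ) : ℂ) +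
        ((t / (1 / 4 + t ^ 2) : ℝ) : ℂ) * Complex.I := by
      have h4 : ((1 / 4 + t ^ 2 : ℝ) : ℂ) ≠ 0 := by exact_mod_cast (hv t).ne'
      have h5 : z t = 1 / 2 + t * Complex.I := by
        apply Complex.ext <;> simp [z]
      rw [div_eq_iff (hzne t), h5]
      push_cast at h4 ⊢
      generalize hu : (1 / 4 + (t : ℂ) ^ 2) = u at h4 ⊢
      have h6 : (-(1 / 2) / u + t / u * Complex.I) * (1 / 2 + t * Complex.I) =
          (-(1 / 4) + t ^ 2 * Complex.I ^ 2) / u := by ring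
      rw [h6, eq_div_iff h4, Complex.I_sq, ← hu]
      ring
    rw [h1, h2, hznorm, Real.sq_sqrt (hv t).le]
    simp only [φ]
    push_cast
    linear_combination (2 * Real.pi * m * (t / (1 / 4 + t ^ 2)) : ℂ) * Complex.I_sq
  have hre10 : ∀ t ∈ Set.Icc a b,
      (term k m 1 0 (z t)).re = termSize k m t ‖z t‖ * Real.cos (φ t) := by
    intro t ht
    have h0 : 0 < ‖z t‖ := norm_pos_iff.mpr (hzne t)
    rw [hexp t ht, hexponent t ht, Complex.exp_add, ← Complex.ofReal_exp, Complex.re_ofReal_mul,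
      Complex.exp_ofReal_mul_I_re, Real.cos_neg, termSize_eq_exp _ _ _ h0]
  have hsub : ∀ t, z t - 1 = -starRingEnd ℂ (z t) := fun t => by
    apply Complex.ext <;> norm_num [z]
  have hconj : ∀ t ∈ Set.Icc a b,
      term k m 1 (-1) (z t) = starRingEnd ℂ (term k m 1 0 (z t)) := by
    intro t ht
    rw [term_one_neg_one k m (z := z t) (hzpos t ht), term_one_zero k m (z := z t) (hzpos t ht),
      map_div₀, ← Complex.exp_conj, conj_two_pi_I_mul, hsub, map_div₀, map_neg, map_one, map_pow,
      hev.neg_pow, neg_div_neg_eq, ← neg_div, neg_neg]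
  have hreal : ∀ t ∈ Set.Icc a b, (poincare k m (z t)).im = 0 := by
    intro t ht
    rw [← Complex.conj_eq_iff_im, ← poincare_neg_conj k m (z := z t) (hzpos t ht), ← hsub]
    have := poincare_moebius k m (a := 1) (b := -1) (c := 0) (d := 1) (by norm_num) (z := z t)
      (hzpos t ht)
    simpa [sub_eq_add_neg] using this
  have hmain : ∀ t ∈ Set.Icc a b,
      |(poincare k m (z t)).re - A t * Real.cos (φ t)| < A t := by
    intro t ht
    have ht0 := hzpos t ht
    have h0 : 0 < ‖z t‖ := norm_pos_iff.mpr (hzne t)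
    have hone : 1 ≤ ‖z t‖ := by
      rw [hznorm, Real.one_le_sqrt]
      nlinarith [ht.1]
    have h1 := hK k m hk1 hev hm (z t) rfl hone ht0 (ht.2.trans hb)
    have h2 : ‖term k m 0 1 (z t)‖ ≤ termSize k m t ‖z t‖ := by
      rw [term_zero_one k m (z := z t) ht0, Complex.norm_exp, termSize_eq_exp _ _ _ h0, Real.exp_le_exp,
        hznorm, Real.sq_sqrt (hv t).le, Real.log_sqrt (hv t).le]
      have h4 := hdom t ht
      have h5 : (2 * Real.pi * Complex.I * m * z t).re = -(2 * Real.pi * m * t) := by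
        simp [z]
      rw [h5]
      linarith
    have h6 : (poincare k m (z t)).re - A t * Real.cos (φ t) =
        ((poincare k m (z t) - (term k m 0 1 (z t) + term k m 1 0 (z t) + term k m 1 (-1) (z t))) +
          term k m 0 1 (z t)).re := by
      rw [hconj t ht]
      simp only [Complex.add_re, Complex.sub_re, Complex.conj_re, hre10 t ht, A]
      ring
    rw [h6]
    refine (Complex.abs_re_le_norm _).trans_lt ?_
    refine (norm_add_le _ _).trans_lt ?_
    refine (add_le_add h1 h2).trans_lt ?_
    have h7 : 0 < termSize k m t ‖z t‖ := termSize_pos _ _ _ h0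
    simp only [A]
    change 1 / 2 * termSize k m t ‖z t‖ + _ < _
    linarith
  have hfc : ContinuousOn (fun t => (poincare k m (z t)).re) (Set.Icc a b) := by
    intro t ht
    refine ContinuousAt.continuousWithinAt ?_
    have hzc : ContinuousAt z t := by
      have : z = fun t : ℝ => (1 / 2 : ℂ) + t * Complex.I := by
        funext s
        apply Complex.ext <;> simp [z]
      rw [this]
      fun_prop
    have h1 : ContinuousAt (fun t => poincare k m (z t)) t :=
      ContinuousAt.comp (g := poincare k m)
        (continuousAt_poincare hk3 m (z := z t) (hzpos t ht)) hzc
    exact Complex.continuous_re.continuousAt.comp h1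
  have hφc : ContinuousOn φ (Set.Icc a b) := by
    simp only [φ]
    have : Continuous fun t : ℝ => Real.pi * m / (1 / 4 + t ^ 2) :=
      continuous_const.div (by fun_prop) fun t => (hv t).ne'
    fun_prop
  obtain ⟨Z, hZ, hcard⟩ := exists_zeros_of_cos_approx hab hfc hφc hmain
  have hinj : Function.Injective z := fun t s h => congrArg Complex.im h
  classical
  refine ⟨Z.image z, fun w hw => ?_, ?_⟩
  · obtain ⟨t, ht, rfl⟩ := Finset.mem_image.mp hw
    obtain ⟨h1, h2⟩ := hZ t ht
    exact ⟨Complex.ext h2 (hreal t (Set.Ioo_subset_Icc_self h1)), rfl, h1.1, h1.2⟩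
  · rw [Finset.card_image_of_injective _ hinj]
    exact hcard

/-! ### Monotonicity of the height function and positivity of the proportion near the curve. -/

/-- The non-strict inequality at s = √v becomes strict at v; the gain is governed by (s - 1)³ > 0.
-/
theorem two_mul_sub_div_lt_log {v : ℝ} (hv : 1 < v) : 2 * (v - 1) / (v + 1) < Real.log v := by
  set s := √v
  have hs2 : s ^ 2 = v := Real.sq_sqrt (by linarith)
  have hs : 1 < s := by rw [Real.lt_sqrt (by norm_num)]; linarith
  have h1 := Real.le_log_one_add_of_nonneg (x := s - 1) (by linarith)
  rw [add_sub_cancel] at h1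
  have h2 : Real.log v = 2 * Real.log s := by rw [← hs2, Real.log_pow]; norm_num
  rw [h2, ← hs2]
  refine lt_of_lt_of_le ?_ (mul_le_mul_of_nonneg_left h1 (by norm_num))
  rw [← mul_div_assoc, div_lt_div_iff₀ (by positivity) (by linarith)]
  have h3 : 0 < (s - 1) ^ 3 := pow_pos (by linarith) 3
  nlinarith

/-- The function `r log r / (r² - 1)`, in terms of which the curve is
`Im z = ‖z‖ * slopeFun ‖z‖ / (2 π α)`. -/
noncomputable def slopeFun (r : ℝ) : ℝ := r * Real.log r / (r ^ 2 - 1)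

theorem hasDerivAt_slopeFun {r : ℝ} (hr : 1 < r) :
    HasDerivAt slopeFun
      (((Real.log r + 1) * (r ^ 2 - 1) - r * Real.log r * (2 * r)) / (r ^ 2 - 1) ^ 2) r := by
  have h0 : r ≠ 0 := by positivity
  have h1 : r ^ 2 - 1 ≠ 0 := by nlinarith
  have h2 : HasDerivAt (fun r : ℝ => r * Real.log r) (Real.log r + 1) r := by
    simpa [h0, add_comm] using Real.hasDerivAt_mul_log h0
  have h3 : HasDerivAt (fun r : ℝ => r ^ 2 - 1) (2 * r) r := by
    simpa using (hasDerivAt_pow 2 r).sub_const 1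
  exact h2.div h3 h1

theorem continuousOn_slopeFun : ContinuousOn slopeFun (Set.Ioi 1) := fun _ hr =>
  (hasDerivAt_slopeFun hr).continuousAt.continuousWithinAt

/-- The numerator of the derivative is (r² - 1) - (r² + 1) log r, negative by
`two_mul_sub_div_lt_log` at v = r². -/
theorem strictAntiOn_slopeFun : StrictAntiOn slopeFun (Set.Ioi 1) := by
  refine strictAntiOn_of_deriv_neg (convex_Ioi 1) continuousOn_slopeFun fun r hr => ?_
  rw [interior_Ioi] at hr
  have hr1 : 1 < r := hr
  rw [(hasDerivAt_slopeFun hr1).deriv]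
  have h1 : 0 < r ^ 2 - 1 := by nlinarith
  refine div_neg_of_neg_of_pos ?_ (by positivity)
  have h2 := two_mul_sub_div_lt_log (v := r ^ 2) (by nlinarith)
  rw [Real.log_pow, div_lt_iff₀ (by positivity)] at h2
  push_cast at h2
  nlinarith

/-- At r = 1/(2πα) - 1 this bound equals 2πα, which gives a starting point for the intermediate
value arguments. That radius exceeds 1 exactly when α < 1/(4π). -/
theorem one_div_add_one_le_slopeFun {r : ℝ} (hr : 1 < r) : 1 / (r + 1) ≤ slopeFun r := by
  have h1 : 0 < r ^ 2 - 1 := by nlinarith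
  have h2 := Real.one_sub_inv_le_log_of_pos (x := r) (by linarith)
  have h3 : r - 1 ≤ r * Real.log r := by
    have := mul_le_mul_of_nonneg_left h2 (by linarith : (0 : ℝ) ≤ r)
    rwa [mul_sub, mul_one, mul_inv_cancel₀ (by positivity)] at this
  rw [slopeFun, div_le_div_iff₀ (by linarith) h1]
  nlinarith

theorem slopeFun_le {r : ℝ} (hr : 2 ≤ r) : slopeFun r ≤ 3 / √r := by
  have h1 : 0 < r ^ 2 - 1 := by nlinarith
  set s := √r
  have hs2 : s ^ 2 = r := Real.sq_sqrt (by linarith)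
  have hs : 0 < s := Real.sqrt_pos.mpr (by linarith)
  have h2 : Real.log r ≤ 2 * s := by
    have := Real.log_le_sub_one_of_pos hs
    rw [← hs2, Real.log_pow]
    push_cast
    linarith
  rw [slopeFun, div_le_div_iff₀ h1 hs]
  calc r * Real.log r * s ≤ r * (2 * s) * s := by gcongr
    _ = 2 * r ^ 2 := by rw [← hs2]; ring
    _ ≤ _ := by nlinarith

theorem one_lt_sqrt_quarter_add {t : ℝ} (ht : √3 / 2 < t) : 1 < √(1 / 4 + t ^ 2) := by
  have h3 : (√3) ^ 2 = 3 := Real.sq_sqrt (by norm_num)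
  have h3' : 0 < √3 := by positivity
  rw [Real.lt_sqrt (by norm_num)]
  nlinarith

/-- At z = 1/2 + it, of modulus r, the curve equation is t = r · `slopeFun r` / (2πα). So F(t) is
the parameter α whose curve passes through z. -/
theorem heightFun_eq {t : ℝ} (ht : √3 / 2 < t) :
    heightFun t = √(1 / 4 + t ^ 2) / t * slopeFun √(1 / 4 + t ^ 2) / (2 * Real.pi) := by
  have hr := one_lt_sqrt_quarter_add ht
  have hr2 : √(1 / 4 + t ^ 2) ^ 2 = 1 / 4 + t ^ 2 := Real.sq_sqrt (by positivity)
  have ht0 : 0 < t := lt_trans (by positivity) ht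
  set r := √(1 / 4 + t ^ 2)
  have h1 : t ^ 2 - 3 / 4 = r ^ 2 - 1 := by rw [hr2]; ring
  have h2 : r ^ 2 - 1 ≠ 0 := by nlinarith
  rw [heightFun, ← hr2, Real.log_pow, h1, slopeFun]
  have := Real.pi_pos
  push_cast
  field_simp
  ring

theorem strictAntiOn_heightFun : StrictAntiOn heightFun (Set.Ioi (√3 / 2)) := by
  intro s hs t ht hst
  have hs' : √3 / 2 < s := hs
  have ht' : √3 / 2 < t := ht
  have hs0 : 0 < s := lt_trans (by positivity) hs'
  have ht0 : 0 < t := hs0.trans hst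
  rw [heightFun_eq hs', heightFun_eq ht']
  have h1 : √(1 / 4 + s ^ 2) < √(1 / 4 + t ^ 2) :=
    Real.sqrt_lt_sqrt (by positivity) (by gcongr)
  have h2 := strictAntiOn_slopeFun (one_lt_sqrt_quarter_add hs') (one_lt_sqrt_quarter_add ht') h1
  have h3 : 0 < slopeFun √(1 / 4 + t ^ 2) := lt_of_lt_of_le (by positivity)
    (one_div_add_one_le_slopeFun (one_lt_sqrt_quarter_add ht'))
  have h4 : √(1 / 4 + t ^ 2) / t ≤ √(1 / 4 + s ^ 2) / s := by
    rw [div_le_div_iff₀ ht0 hs0, ← abs_of_pos (mul_pos (Real.sqrt_pos.mpr (by positivity)) ht0),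
      ← abs_of_pos (mul_pos (Real.sqrt_pos.mpr (by positivity)) hs0)]
    refine sq_le_sq.mp ?_
    rw [mul_pow, mul_pow, Real.sq_sqrt (by positivity), Real.sq_sqrt (by positivity)]
    nlinarith
  have := Real.pi_pos
  have h5 : 0 < √(1 / 4 + s ^ 2) / s := div_pos (Real.sqrt_pos.mpr (by positivity)) hs0
  gcongr ?_ / _
  calc _ ≤ √(1 / 4 + s ^ 2) / s * slopeFun √(1 / 4 + t ^ 2) := by gcongr
    _ < _ := by gcongr

theorem continuousOn_heightFun : ContinuousOn heightFun (Set.Ioi (√3 / 2)) := by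
  have h3 : (√3) ^ 2 = 3 := Real.sq_sqrt (by norm_num)
  have h3' : 0 < √3 := by positivity
  intro t ht
  have ht' : √3 / 2 < t := ht
  have ht0 : t ≠ 0 := (lt_trans (by positivity) ht').ne'
  have h1 : t ^ 2 - 3 / 4 ≠ 0 := by nlinarith
  refine ContinuousAt.continuousWithinAt ?_
  unfold heightFun
  have h4 : ContinuousAt (fun t : ℝ => Real.log (1 / 4 + t ^ 2)) t :=
    ContinuousAt.log (by fun_prop) (by positivity)
  have h5 : ContinuousAt (fun t : ℝ => (1 / 4 + t ^ 2) * Real.log (1 / 4 + t ^ 2)) t :=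
    ContinuousAt.mul (by fun_prop) h4
  exact continuousAt_const.mul (h5.div (by fun_prop) (mul_ne_zero ht0 h1))

theorem one_lt_inv_two_pi_mul_sub {α : ℝ} (hα₀ : 0 < α) (hα₁ : α < 1 / (4 * Real.pi)) :
    1 < 1 / (2 * Real.pi * α) - 1 := by
  have hpi := Real.pi_pos
  rw [lt_div_iff₀ (by positivity)] at hα₁
  rw [lt_sub_iff_add_lt, lt_div_iff₀ (by positivity)]
  linarith

theorem exists_heightFun_eq {α : ℝ} (hα₀ : 0 < α) (hα₁ : α < 1 / (4 * Real.pi)) :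
    ∃ T, √3 / 2 < T ∧ heightFun T = α := by
  have hpi := Real.pi_pos
  have hra := one_lt_inv_two_pi_mul_sub hα₀ hα₁
  have h3 : (√3) ^ 2 = 3 := Real.sq_sqrt (by norm_num)
  have h3' : 0 < √3 := by positivity
  have hpar : ∀ r : ℝ, 1 < r → √3 / 2 < √(r ^ 2 - 1 / 4) ∧
      √(1 / 4 + √(r ^ 2 - 1 / 4) ^ 2) = r := by
    intro r hr
    constructor
    · rw [Real.lt_sqrt (by positivity)]
      nlinarith
    · rw [Real.sq_sqrt (by nlinarith), add_sub_cancel, Real.sqrt_sq (by linarith)]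
  set ra := 1 / (2 * Real.pi * α) - 1
  obtain ⟨ha1, ha2⟩ := hpar ra hra
  set s := √(ra ^ 2 - 1 / 4)
  have hs0 : 0 < s := lt_trans (by positivity) ha1
  have hs : α ≤ heightFun s := by
    rw [heightFun_eq ha1, ha2, le_div_iff₀ (by positivity)]
    have h1 := one_div_add_one_le_slopeFun hra
    have h2 : 1 / (ra + 1) = 2 * Real.pi * α := by
      simp only [ra]
      rw [sub_add_cancel, one_div_one_div]
    rw [h2] at h1
    have h4 : 1 ≤ ra / s := by
      rw [one_le_div hs0, Real.sqrt_le_left (by linarith)]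
      linarith
    calc α * (2 * Real.pi) = 1 * (2 * Real.pi * α) := by ring
      _ ≤ ra / s * slopeFun ra := by gcongr
  -- With √rb ≥ 1/α the slope is at most 3α, and rb/t ≤ 2, so the product is at most 6α ≤ 2πα.
  set rb := max (max 2 ra) ((1 / α) ^ 2)
  have hrb2 : 2 ≤ rb := (le_max_left _ _).trans (le_max_left _ _)
  have hrba : ra ≤ rb := (le_max_right _ _).trans (le_max_left _ _)
  obtain ⟨hb1, hb2⟩ := hpar rb (by linarith)
  set t := √(rb ^ 2 - 1 / 4)
  have ht0 : 0 < t := lt_trans (by positivity) hb1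
  have hst : s ≤ t := Real.sqrt_le_sqrt (by gcongr)
  have ht : heightFun t ≤ α := by
    rw [heightFun_eq hb1, hb2, div_le_iff₀ (by positivity)]
    have h1 := slopeFun_le hrb2
    have h4 : rb / t ≤ 2 := by
      rw [div_le_iff₀ ht0]
      have : rb ^ 2 ≤ (2 * t) ^ 2 := by
        rw [mul_pow, Real.sq_sqrt (by nlinarith)]
        nlinarith
      exact (sq_le_sq₀ (by positivity) (by positivity)).mp this
    have h5 : 1 / α ≤ √rb := by
      rw [Real.le_sqrt' (by positivity)]
      exact le_max_right _ _
    have h6 : 3 / √rb ≤ 3 * α := by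
      rw [div_le_iff₀ (Real.sqrt_pos.mpr (by linarith))]
      rw [div_le_iff₀ hα₀] at h5
      linarith
    have h7 : 0 < slopeFun rb :=
      lt_of_lt_of_le (by positivity) (one_div_add_one_le_slopeFun (by linarith))
    calc rb / t * slopeFun rb ≤ 2 * (3 * α) := by
          gcongr
          exact h1.trans h6
      _ ≤ _ := by nlinarith [Real.pi_gt_three]
  obtain ⟨T, hT, hTe⟩ := intermediate_value_Icc' hst
    (continuousOn_heightFun.mono fun x hx => ha1.trans_le hx.1) ⟨ht, hs⟩
  exact ⟨T, ha1.trans_le hT.1, hTe⟩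

/-- The proportion of zeros near the curve. -/
noncomputable def curveProportion (α T : ℝ) : ℝ :=
  α + α / (1 / 4 + T ^ 2) + Real.arctan (2 * T) / Real.pi - 1 / 2

/-- After arctan(2T) = π/2 - arctan(1/(2T)) and arctan x ≤ x, the equation F(T) = α reduces the
claim to `two_mul_sub_div_lt_log` at v = 1/4 + T². -/
theorem curveProportion_pos {α T : ℝ} (hT : √3 / 2 < T) (h : heightFun T = α) :
    0 < curveProportion α T := by
  have hpi := Real.pi_pos
  have hT0 : 0 < T := lt_trans (by positivity) hT
  have hr := one_lt_sqrt_quarter_add hT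
  have hv : 1 < 1 / 4 + T ^ 2 := by
    rw [Real.lt_sqrt (by norm_num)] at hr
    linarith
  have h1 := two_mul_sub_div_lt_log hv
  have hvT : T ^ 2 - 3 / 4 = (1 / 4 + T ^ 2) - 1 := by ring
  rw [heightFun, hvT] at h
  set v := 1 / 4 + T ^ 2
  have h2 : Real.arctan (2 * T) = Real.pi / 2 - Real.arctan (1 / (2 * T)) := by
    rw [one_div, Real.arctan_inv_of_pos (by positivity)]
    ring
  have h3 : Real.arctan (1 / (2 * T)) ≤ 1 / (2 * T) := by
    have := Real.lt_tan (x := Real.arctan (1 / (2 * T))) (Real.arctan_pos.mpr (by positivity))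
      (Real.arctan_lt_pi_div_two _)
    rw [Real.tan_arctan] at this
    exact this.le
  have h4 : curveProportion α T =
      (v + 1) * Real.log v / (4 * Real.pi * T * (v - 1)) - Real.arctan (1 / (2 * T)) / Real.pi := by
    have : v - 1 ≠ 0 := by linarith
    rw [curveProportion, h2, ← h]
    field_simp
    ring
  rw [h4, sub_pos]
  calc _ ≤ 1 / (2 * T) / Real.pi := by gcongr
    _ < _ := by
      rw [div_lt_iff₀ (by linarith)] at h1
      rw [div_div, div_lt_div_iff₀ (by positivity)
        (mul_pos (by positivity) (by linarith))]
      have : 0 < 2 * T * Real.pi := by positivity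
      nlinarith

/-! ### The phase along the curve. -/

/-- The function `2 π i α (z + 1/z) + log z`; along the curve its real part vanishes. -/
noncomputable def phase (α : ℝ) (z : ℂ) : ℂ :=
  2 * Real.pi * Complex.I * α * (z + 1 / z) + Complex.log z

/-- For α = m/k, exp(k · phase) is the quotient of the terms of (0,1) and (1,0). Vanishing of the
real part is the equation of the curve, and the imaginary part locates the cancellations. -/
theorem phase_eq (α : ℝ) {z : ℂ} (hz : z ≠ 0) :
    phase α z = ((Real.log ‖z‖ - 2 * Real.pi * α * z.im * (1 - 1 / ‖z‖ ^ 2) : ℝ) : ℂ) +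
      ((2 * Real.pi * α * z.re * (1 + 1 / ‖z‖ ^ 2) + z.arg : ℝ) : ℂ) * Complex.I := by
  have h0 : 0 < ‖z‖ := norm_pos_iff.mpr hz
  have h1 : 1 / z = ((z.re / ‖z‖ ^ 2 : ℝ) : ℂ) - ((z.im / ‖z‖ ^ 2 : ℝ) : ℂ) * Complex.I := by
    rw [one_div, Complex.inv_def, Complex.normSq_eq_norm_sq]
    apply Complex.ext
    · simp [Complex.mul_re, div_eq_mul_inv]
    · simp [Complex.mul_im, div_eq_mul_inv]
      ring
  rw [phase, h1, Complex.log]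
  push_cast
  linear_combination (2 * Real.pi * α * (z.im - z.im / ‖z‖ ^ 2) : ℂ) * Complex.I_sq -
    2 * Real.pi * Complex.I * α * Complex.re_add_im z

-- The right half of the curve is parametrised by r = |z|, the sine of the argument being u(r) =
-- `slopeFun r` / (2πα). It leads from the imaginary axis (u = 1) to 1/2 + iT. The imaginary part of
-- the phase goes from π/2 to π/2 + πC, and the intermediate value theorem gives every value
-- between.
set_option maxHeartbeats 400000 in
theorem exists_mem_curve_phase_eq {α T : ℝ} (hα₀ : 0 < α) (hα₁ : α < 1 / (4 * Real.pi))
    (hT : √3 / 2 < T) (hTα : heightFun T = α) {τ : ℝ} (hτ : Real.pi / 2 < τ)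
    (hτ' : τ < Real.pi / 2 + Real.pi * curveProportion α T) :
    ∃ w ∈ curve α, 0 < w.re ∧ w.re < 1 / 2 ∧ 0 < w.im ∧ 1 < ‖w‖ ∧
      phase α w = τ * Complex.I := by
  have hpi := Real.pi_pos
  have hra := one_lt_inv_two_pi_mul_sub hα₀ hα₁
  have hT0 : 0 < T := lt_trans (by positivity) hT
  set c := 2 * Real.pi * α
  have hc : 0 < c := by positivity
  set r₁ := √(1 / 4 + T ^ 2)
  have hr₁ : 1 < r₁ := one_lt_sqrt_quarter_add hT
  have hr₁2 : r₁ ^ 2 = 1 / 4 + T ^ 2 := Real.sq_sqrt (by positivity)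
  have hS₁ : slopeFun r₁ / c = T / r₁ := by
    rw [heightFun_eq hT] at hTα
    change r₁ / T * slopeFun r₁ / (2 * Real.pi) = α at hTα
    simp only [c]
    rw [← hTα]
    have : slopeFun r₁ ≠ 0 :=
      (lt_of_lt_of_le (by positivity) (one_div_add_one_le_slopeFun hr₁)).ne'
    field_simp
  have hS₁lt : slopeFun r₁ < c := by
    rw [← div_lt_one hc, hS₁, div_lt_one (by positivity)]
    exact lt_of_pow_lt_pow_left₀ 2 (by positivity) (by rw [hr₁2]; linarith)
  have hSa : c ≤ slopeFun (1 / c - 1) := by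
    have := one_div_add_one_le_slopeFun hra
    rwa [sub_add_cancel, one_div_one_div] at this
  have har : 1 / c - 1 ≤ r₁ := by
    by_contra! h
    exact absurd (strictAntiOn_slopeFun hr₁ hra h) (by linarith)
  -- At r₀ the slope equals 2πα, so the curve meets the imaginary axis there.
  obtain ⟨r₀, hr₀, hS₀⟩ := intermediate_value_Icc' har
    (continuousOn_slopeFun.mono fun x hx => hra.trans_le hx.1) ⟨hS₁lt.le, hSa⟩
  have hr₀1 : 1 < r₀ := hra.trans_le hr₀.1
  have hone : ∀ r ∈ Set.Icc r₀ r₁, 1 < r := fun r hr => hr₀1.trans_le hr.1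
  set u : ℝ → ℝ := fun r => slopeFun r / c
  have hupos : ∀ r ∈ Set.Icc r₀ r₁, 0 < u r := fun r hr => div_pos
    (lt_of_lt_of_le (one_div_pos.mpr (by linarith [hone r hr]))
      (one_div_add_one_le_slopeFun (hone r hr))) hc
  have hule : ∀ r ∈ Set.Icc r₀ r₁, u r ≤ 1 := fun r hr => by
    rw [div_le_one hc, ← hS₀]
    exact strictAntiOn_slopeFun.antitoneOn hr₀1 (hone r hr) hr.1
  set w : ℝ → ℂ := fun r => (r * √(1 - u r ^ 2) : ℝ) + (r * u r : ℝ) * Complex.I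
  have hwre : ∀ r, (w r).re = r * √(1 - u r ^ 2) := fun r => by simp [w]
  have hwim : ∀ r, (w r).im = r * u r := fun r => by simp [w]
  have hwnorm : ∀ r ∈ Set.Icc r₀ r₁, ‖w r‖ = r := fun r hr => by
    have h1 : 0 ≤ 1 - u r ^ 2 := by nlinarith [hupos r hr, hule r hr]
    rw [← sq_eq_sq₀ (norm_nonneg _) (by linarith [hone r hr]), normSq_eq_re_im, hwre, hwim,
      mul_pow, mul_pow, Real.sq_sqrt h1]
    ring
  have hwimpos : ∀ r ∈ Set.Icc r₀ r₁, 0 < (w r).im := fun r hr => by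
    rw [hwim]
    exact mul_pos (by linarith [hone r hr]) (hupos r hr)
  have huc : ContinuousOn u (Set.Icc r₀ r₁) :=
    (continuousOn_slopeFun.mono hone).div_const c
  have hwc : ContinuousOn w (Set.Icc r₀ r₁) := by
    have h1 : ContinuousOn (fun r => r * √(1 - u r ^ 2)) (Set.Icc r₀ r₁) :=
      continuousOn_id.mul (continuousOn_const.sub (huc.pow 2)).sqrt
    have h2 : ContinuousOn (fun r => r * u r) (Set.Icc r₀ r₁) := continuousOn_id.mul huc
    exact (Complex.continuous_ofReal.comp_continuousOn h1).add
      ((Complex.continuous_ofReal.comp_continuousOn h2).mul continuousOn_const)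
  set h : ℝ → ℝ := fun r => c * (w r).re * (1 + 1 / r ^ 2) + (w r).arg
  have hhc : ContinuousOn h (Set.Icc r₀ r₁) := by
    have h1 : ContinuousOn (fun r => (w r).re) (Set.Icc r₀ r₁) :=
      Complex.continuous_re.comp_continuousOn hwc
    have h2 : ContinuousOn (fun r => (w r).arg) (Set.Icc r₀ r₁) := by
      intro r hr
      exact ContinuousAt.comp_continuousWithinAt (g := Complex.arg)
        (Complex.continuousAt_arg (Or.inr (hwimpos r hr).ne')) (hwc r hr)
    have h3 : ContinuousOn (fun r : ℝ => 1 + 1 / r ^ 2) (Set.Icc r₀ r₁) :=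
      continuousOn_const.add (continuousOn_const.div (by fun_prop)
        fun r hr => (pow_pos (lt_trans one_pos (hone r hr)) 2).ne')
    exact ((continuousOn_const.mul h1).mul h3).add h2
  have hu₀ : u r₀ = 1 := by simp only [u]; rw [hS₀, div_self hc.ne']
  have hu₁ : u r₁ = T / r₁ := hS₁
  have hw₁re : (w r₁).re = 1 / 2 := by
    rw [hwre, hu₁]
    have h1 : 1 - (T / r₁) ^ 2 = (1 / 2 / r₁) ^ 2 := by
      field_simp
      rw [hr₁2]
      ring
    rw [h1, Real.sqrt_sq (by positivity)]
    field_simp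
  have hw₁ : w r₁ = ⟨1 / 2, T⟩ := by
    apply Complex.ext
    · exact hw₁re
    · rw [hwim, hu₁]
      field_simp
  have hh₀ : h r₀ = Real.pi / 2 := by
    have h1 : (w r₀).re = 0 := by rw [hwre, hu₀]; simp
    have h2 : (w r₀).arg = Real.pi / 2 :=
      Complex.arg_eq_pi_div_two_iff.mpr ⟨h1, hwimpos r₀ ⟨le_rfl, hr₀.2⟩⟩
    simp only [h]
    rw [h1, h2]
    ring
  have hh₁ : h r₁ = Real.pi / 2 + Real.pi * curveProportion α T := by
    simp only [h]
    rw [hw₁, arg_mk_half, hr₁2, curveProportion]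
    simp only [c]
    have : 1 / 4 + T ^ 2 ≠ 0 := by positivity
    field_simp
    ring
  obtain ⟨r, hr, hrτ⟩ := intermediate_value_Ioo hr₀.2 hhc
    (show τ ∈ Set.Ioo (h r₀) (h r₁) by rw [hh₀, hh₁]; exact ⟨hτ, hτ'⟩)
  have hrI : r ∈ Set.Icc r₀ r₁ := Set.Ioo_subset_Icc_self hr
  have hr1 := hone r hrI
  have hr0 : 0 < r := by linarith
  have hult : u r < 1 := by
    rw [div_lt_one hc, ← hS₀]
    exact strictAntiOn_slopeFun hr₀1 hr1 hr.1
  have hrepos : 0 < (w r).re := by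
    rw [hwre]
    refine mul_pos hr0 (Real.sqrt_pos.mpr ?_)
    nlinarith [hupos r hrI]
  have hrelt : (w r).re < 1 / 2 := by
    rw [← hw₁re, hwre, hwre]
    have h1 : u r₁ < u r :=
      div_lt_div_of_pos_right (strictAntiOn_slopeFun hr1 hr₁ hr.2) hc
    have h2 := hupos r₁ ⟨hr₀.2, le_rfl⟩
    have h3 : √(1 - u r ^ 2) ≤ √(1 - u r₁ ^ 2) := Real.sqrt_le_sqrt (by nlinarith)
    have h4 : 0 < √(1 - u r ^ 2) := Real.sqrt_pos.mpr (by nlinarith [hupos r hrI])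
    calc r * √(1 - u r ^ 2) < r₁ * √(1 - u r ^ 2) := by gcongr; exact hr.2
      _ ≤ _ := by gcongr
  have hy : c * (w r).im * (1 - 1 / r ^ 2) = Real.log r := by
    have h1 : r ^ 2 - 1 ≠ 0 := by nlinarith
    rw [hwim]
    simp only [u, slopeFun]
    field_simp
  refine ⟨w r, ⟨Or.inl ⟨hwimpos r hrI, by rw [hwnorm r hrI]; exact hr1, by linarith,
    hrelt.le⟩, by rw [hwnorm r hrI]; exact hr1, ?_⟩, hrepos, hrelt, hwimpos r hrI,
    by rw [hwnorm r hrI]; exact hr1, ?_⟩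
  · rw [hwnorm r hrI, zpow_neg, ← one_div, eq_div_iff, ← hy]
    · norm_cast
    · have : 1 / r ^ 2 < 1 := by rw [div_lt_one (by positivity)]; nlinarith
      have h2 : r ^ (2 : ℤ) = r ^ 2 := by norm_cast
      rw [h2]
      linarith
  · have hne : w r ≠ 0 := by
      rw [← norm_pos_iff, hwnorm r hrI]
      exact hr0
    rw [phase_eq α hne, hwnorm r hrI, ← hrτ, ← hy]
    simp [c, h]

/-! ### Zeros near the curve. -/

open scoped Topology

/-- A quantitative open mapping theorem, stable under small perturbations of the function. -/
theorem exists_ball_subset_image_of_hasDerivAt {φ : ℂ → ℂ} {φ' w : ℂ} (hφ : HasDerivAt φ φ' w)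
    (hne : φ' ≠ 0) {R : ℝ} (hR : 0 < R) (hc : ContinuousOn φ (Metric.ball w R)) :
    ∃ r, 0 < r ∧ r < R ∧ ∃ σ, 0 < σ ∧ ∀ G : ℂ → ℂ, DifferentiableOn ℂ G (Metric.ball w R) →
      (∀ z ∈ Metric.closedBall w r, ‖G z - φ z‖ ≤ σ) →
      Metric.ball (φ w) σ ⊆ G '' Metric.closedBall w r := by
  obtain ⟨r₀, hr₀, hr₀ne⟩ := Metric.eventually_nhds_iff.mp
    (eventually_nhdsWithin_iff.mp (hφ.eventually_ne (c := φ w) hne))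
  set r := min r₀ R / 2
  have hmin : 0 < min r₀ R := lt_min hr₀ hR
  have hr : 0 < r := half_pos hmin
  have hrR : r < R := (half_lt_self hmin).trans_le (min_le_right _ _)
  have hrr₀ : r < r₀ := (half_lt_self hmin).trans_le (min_le_left _ _)
  have hsph : Metric.sphere w r ⊆ Metric.ball w R :=
    Metric.sphere_subset_closedBall.trans (Metric.closedBall_subset_ball hrR)
  obtain ⟨z₀, hz₀, hzmin⟩ := (isCompact_sphere w r).exists_isMinOn
    (NormedSpace.sphere_nonempty.mpr hr.le)
    (((hc.mono hsph).sub continuousOn_const).norm : ContinuousOn (fun z => ‖φ z - φ w‖) _)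
  have hz₀w : z₀ ≠ w := Metric.ne_of_mem_sphere hz₀ hr.ne'
  have hμ : 0 < ‖φ z₀ - φ w‖ := by
    rw [norm_pos_iff, sub_ne_zero]
    exact hr₀ne (by rw [Metric.mem_sphere.mp hz₀]; exact hrr₀) hz₀w
  set μ := ‖φ z₀ - φ w‖
  -- A perturbation by σ = μ/8 leaves |G - G(w)| ≥ 6σ on the sphere, so the image contains the ball
  -- of radius 3σ about G(w). This contains the ball of radius σ about φ(w), as G(w) is within σ of
  -- φ(w).
  refine ⟨r, hr, hrR, μ / 8, by positivity, fun G hG hGφ => ?_⟩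
  have hGw := hGφ w (Metric.mem_closedBall_self hr.le)
  have hbound : ∀ z ∈ Metric.sphere w r, 6 * (μ / 8) ≤ ‖G z - G w‖ := by
    intro z hz
    have h1 : μ ≤ ‖φ z - φ w‖ := hzmin hz
    have h2 := hGφ z (Metric.sphere_subset_closedBall hz)
    have h3 : ‖φ z - φ w‖ ≤ ‖G z - G w‖ + ‖G z - φ z‖ + ‖G w - φ w‖ := by
      have : φ z - φ w = (G z - G w) - (G z - φ z) + (G w - φ w) := by ring
      rw [this]
      exact (norm_add_le _ _).trans (by gcongr; exact norm_sub_le _ _)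
    linarith
  have hcont : DiffContOnCl ℂ G (Metric.ball w r) := by
    refine DifferentiableOn.diffContOnCl ?_
    rw [closure_ball w hr.ne']
    exact hG.mono (Metric.closedBall_subset_ball hrR)
  -- If G were constant near w, the identity theorem would make it constant on the sphere, against
  -- the lower bound.
  have hfreq : ∃ᶠ z in 𝓝 w, G z ≠ G w := by
    intro h
    have h1 : G =ᶠ[𝓝 w] fun _ => G w := by
      filter_upwards [h] with z hz
      exact not_not.mp hz
    have h2 : AnalyticOnNhd ℂ G (Metric.ball w R) := hG.analyticOnNhd Metric.isOpen_ball
    have h3 := h2.eqOn_of_preconnected_of_eventuallyEq analyticOnNhd_const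
      (convex_ball w R).isPreconnected (Metric.mem_ball_self hR) h1
    have h4 := hbound z₀ hz₀
    rw [h3 (hsph hz₀), sub_self, norm_zero] at h4
    linarith
  refine subset_trans ?_ (hcont.ball_subset_image_closedBall hr hbound hfreq)
  intro ζ hζ
  rw [Metric.mem_ball] at hζ ⊢
  have h5 := dist_triangle ζ (φ w) (G w)
  rw [dist_comm (φ w), dist_eq_norm (G w)] at h5
  linarith

/-- The quotient of `poincare k m - exp (2 π i m z)` by the term of the pair `(1, 0)`. -/
noncomputable def tailQuotient (k m : ℕ) (z : ℂ) : ℂ :=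
  (poincare k m z - Complex.exp (2 * Real.pi * Complex.I * m * z)) *
    (z ^ k / Complex.exp (2 * Real.pi * Complex.I * m * (-1 / z)))

/-- The perturbation of `phase (m / k)` with
`poincare k m z = exp (2 π i m z) * (1 + exp (-k * exactPhase k m z))`. -/
noncomputable def exactPhase (k m : ℕ) (z : ℂ) : ℂ :=
  phase (m / k) z - Complex.log (tailQuotient k m z) / k

theorem ne_zero_of_im_pos {z : ℂ} (hz : 0 < z.im) : z ≠ 0 := fun h => by simp [h] at hz

theorem poincare_eq_exactPhase {k : ℕ} (hk : k ≠ 0) (m : ℕ) {z : ℂ} (hz : 0 < z.im)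
    (hQ : tailQuotient k m z ≠ 0) :
    poincare k m z = Complex.exp (2 * Real.pi * Complex.I * m * z) *
      (1 + Complex.exp (-(k * exactPhase k m z))) := by
  have hz0 := ne_zero_of_im_pos hz
  have hk0 : (k : ℂ) ≠ 0 := by exact_mod_cast hk
  have h1 : -(k * exactPhase k m z) = (-(2 * Real.pi * Complex.I * m * z) +
      2 * Real.pi * Complex.I * m * (-1 / z)) + Complex.log (tailQuotient k m z) -
      k * Complex.log z := by
    rw [exactPhase, phase]
    push_cast
    field_simp
    ring
  rw [h1, Complex.exp_sub, Complex.exp_add, Complex.exp_add, Complex.exp_neg, Complex.exp_log hQ,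
    Complex.exp_nat_mul, Complex.exp_log hz0, tailQuotient]
  have h2 := Complex.exp_ne_zero (2 * Real.pi * Complex.I * m * z)
  have h3 := Complex.exp_ne_zero (2 * Real.pi * Complex.I * m * (-1 / z))
  generalize Complex.exp (2 * Real.pi * Complex.I * m * z) = A at *
  generalize Complex.exp (2 * Real.pi * Complex.I * m * (-1 / z)) = B at *
  field_simp
  ring

/-- The quotient minus 1 is the tail divided by the term of (1,0). With a bound 1/2 its logarithm is
at most 1, so the exact phase differs from `phase (m / k)` by at most 1/k. -/
theorem norm_tailQuotient_sub_one_le {k m : ℕ} {η : ℝ} {z : ℂ} (hz : 0 < z.im)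
    (h : ‖poincare k m z - (term k m 0 1 z + term k m 1 0 z)‖ ≤ η * termSize k m z.im ‖z‖) :
    ‖tailQuotient k m z - 1‖ ≤ η := by
  have hz0 := ne_zero_of_im_pos hz
  have h1 : term k m 1 0 z ≠ 0 := by
    rw [term_one_zero k m hz]
    exact div_ne_zero (Complex.exp_ne_zero _) (pow_ne_zero _ hz0)
  have h2 : tailQuotient k m z - 1 =
      (poincare k m z - (term k m 0 1 z + term k m 1 0 z)) / term k m 1 0 z := by
    rw [eq_div_iff h1, sub_mul, tailQuotient, term_zero_one k m hz, term_one_zero k m hz]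
    have h3 := Complex.exp_ne_zero (2 * Real.pi * Complex.I * m * (-1 / z))
    generalize Complex.exp (2 * Real.pi * Complex.I * m * (-1 / z)) = B at *
    field_simp
    ring
  have h4 : ‖term k m 1 0 z‖ = termSize k m z.im ‖z‖ := by
    have := norm_term_eq_termSize k m (c := 1) (d := 0) isCoprime_one_left z
    simpa using this
  rw [h2, norm_div, h4, div_le_iff₀ (termSize_pos _ _ _ (norm_pos_iff.mpr hz0))]
  exact h

theorem norm_exactPhase_sub_phase_le {k m : ℕ} (hk : k ≠ 0) (α : ℝ) {z : ℂ} (hz : 1 ≤ ‖z‖)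
    (hQ : ‖tailQuotient k m z - 1‖ ≤ 1 / 2) :
    ‖exactPhase k m z - phase α z‖ ≤ 2 * Real.pi * |(m / k : ℝ) - α| * (‖z‖ + 1) + 1 / k := by
  have hpi := Real.pi_pos
  have h1 : exactPhase k m z - phase α z =
      2 * Real.pi * Complex.I * ((m / k : ℝ) - α : ℝ) * (z + 1 / z) -
        Complex.log (tailQuotient k m z) / k := by
    rw [exactPhase, phase, phase]
    push_cast
    ring
  have h2 : ‖Complex.log (tailQuotient k m z)‖ ≤ 1 := by
    have := Complex.norm_log_one_add_half_le_self hQ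
    rw [add_sub_cancel] at this
    linarith
  have h3 : ‖z + 1 / z‖ ≤ ‖z‖ + 1 := by
    refine (norm_add_le _ _).trans ?_
    rw [norm_div, norm_one]
    gcongr
    exact div_le_one_of_le₀ hz (by positivity)
  rw [h1]
  refine (norm_sub_le _ _).trans ?_
  rw [norm_div, Complex.norm_natCast]
  gcongr
  rw [norm_mul, norm_mul, norm_mul, norm_mul, Complex.norm_I, Complex.norm_real, Complex.norm_real,
    Real.norm_eq_abs, Real.norm_eq_abs, abs_of_pos hpi, mul_one, Complex.norm_two]
  gcongr

theorem differentiableAt_exactPhase {k : ℕ} (hk : 3 ≤ k) (m : ℕ) {z : ℂ} (hz : 0 < z.im)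
    (hQ : ‖tailQuotient k m z - 1‖ ≤ 1 / 2) : DifferentiableAt ℂ (exactPhase k m) z := by
  have hz0 := ne_zero_of_im_pos hz
  have h1 : DifferentiableAt ℂ (poincare k m) z :=
    (differentiableOn_poincare hk m).differentiableAt (isOpen_upper.mem_nhds hz)
  have h2 : DifferentiableAt ℂ (tailQuotient k m) z := by
    unfold tailQuotient
    have h3 : DifferentiableAt ℂ (fun z : ℂ => -1 / z) z :=
      (differentiableAt_const _).div differentiableAt_id hz0
    have h4 : DifferentiableAt ℂ (fun z : ℂ =>
        Complex.exp (2 * Real.pi * Complex.I * m * (-1 / z))) z := (h3.const_mul _).cexp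
    have h5 : DifferentiableAt ℂ (fun z : ℂ => z ^ k /
        Complex.exp (2 * Real.pi * Complex.I * m * (-1 / z))) z :=
      DifferentiableAt.div (by fun_prop) h4 (Complex.exp_ne_zero _)
    exact (h1.sub (by fun_prop)).mul h5
  have h6 : tailQuotient k m z ∈ Complex.slitPlane := by
    have := Complex.mem_slitPlane_of_norm_lt_one (z := tailQuotient k m z - 1) (by linarith)
    rwa [add_sub_cancel] at this
  have h7 : DifferentiableAt ℂ (phase (m / k)) z := by
    unfold phase
    have h8 : DifferentiableAt ℂ (fun z : ℂ => 1 / z) z :=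
      (differentiableAt_const _).div differentiableAt_id hz0
    exact ((differentiableAt_id.add h8).const_mul _).add
      (Complex.differentiableAt_log (Or.inr hz.ne'))
  exact h7.sub ((h2.clog h6).div_const _)

theorem hasDerivAt_phase (α : ℝ) {z : ℂ} (hz : 0 < z.im) :
    HasDerivAt (phase α) (2 * Real.pi * Complex.I * α * (1 - 1 / z ^ 2) + 1 / z) z := by
  have hz0 := ne_zero_of_im_pos hz
  have h1 : HasDerivAt (fun z : ℂ => z + 1 / z) (1 - 1 / z ^ 2) z := by
    have := (hasDerivAt_id' z).fun_add (hasDerivAt_inv hz0)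
    simpa only [one_div, sub_eq_add_neg] using this
  have h2 : HasDerivAt Complex.log (1 / z) z := by
    simpa using Complex.hasDerivAt_log (Or.inr hz.ne' : z ∈ Complex.slitPlane)
  exact (h1.const_mul _).add h2

/-- Multiplied by z, the derivative has imaginary part 2πα Re z (1 - 1/|z|²), nonzero off the
imaginary axis and the unit circle. -/
theorem deriv_phase_ne_zero (α : ℝ) {z : ℂ} (hz : 0 < z.im) (hre : 0 < z.re) (hα : α ≠ 0)
    (hn : 1 < ‖z‖) : 2 * Real.pi * Complex.I * α * (1 - 1 / z ^ 2) + 1 / z ≠ 0 := by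
  have hz0 := ne_zero_of_im_pos hz
  intro h
  have h1 : 2 * Real.pi * Complex.I * α * (z - 1 / z) + 1 = 0 := by
    have : 2 * Real.pi * Complex.I * α * (z - 1 / z) + 1 =
        (2 * Real.pi * Complex.I * α * (1 - 1 / z ^ 2) + 1 / z) * z := by
      field_simp
    rw [this, h, zero_mul]
  have h2 := congrArg Complex.im h1
  have h3 : (z - 1 / z).re = z.re * (1 - 1 / ‖z‖ ^ 2) := by
    rw [one_div, Complex.sub_re, Complex.inv_re, Complex.normSq_eq_norm_sq]
    ring
  have h4 : (2 * Real.pi * Complex.I * α * (z - 1 / z) + 1).im =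
      2 * Real.pi * α * (z - 1 / z).re := by
    have : 2 * Real.pi * Complex.I * α * (z - 1 / z) + 1 =
        ((2 * Real.pi * α : ℝ) : ℂ) * (Complex.I * (z - 1 / z)) + 1 := by
      push_cast; ring
    rw [this, Complex.add_im, Complex.im_ofReal_mul, Complex.I_mul_im]
    simp
  rw [h4, h3, Complex.zero_im] at h2
  have h5 : 1 / ‖z‖ ^ 2 < 1 := by
    rw [div_lt_one (by positivity)]
    nlinarith
  have h6 : z.re * (1 - 1 / ‖z‖ ^ 2) ≠ 0 := (mul_pos hre (by linarith)).ne'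
  have h7 : 2 * Real.pi * α ≠ 0 := mul_ne_zero (by positivity) hα
  exact (mul_ne_zero h7 h6) h2

/-- The exact phase converges to the phase uniformly near w, and the phase is open at w. So for all
large indices the exact phase takes every imaginary value in a fixed interval about that of w, at
points close to w. -/
theorem exists_exactPhase_eq {α κ ε τ₀ : ℝ} {k m : ℕ → ℕ} (hα : α ≠ 0) (hκ : 0 < κ) (hκ1 : κ ≤ 1)
    (hev : ∀ j, Even (k j)) (hk : Tendsto k atTop atTop)
    (hm : Tendsto (fun j => (m j : ℝ) / k j) atTop (𝓝 α))
    (hmk : ∀ᶠ j in atTop, 4 * Real.pi * m j ≤ (1 - κ) * k j)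
    {w : ℂ} (hre : 0 < w.re) (hre' : w.re < 1 / 2) (him : 0 < w.im) (hn : 1 < ‖w‖)
    (hw : phase α w = τ₀ * Complex.I) (hε : 0 < ε) :
    ∃ σ, 0 < σ ∧ ∀ᶠ j in atTop, ∀ τ : ℝ, |τ - τ₀| < σ →
      ∃ z : ℂ, dist z w ≤ ε ∧ 0 < z.re ∧ z.re < 1 / 2 ∧ 0 < z.im ∧ 1 < ‖z‖ ∧
        exactPhase (k j) (m j) z = τ * Complex.I ∧ tailQuotient (k j) (m j) z ≠ 0 := by
  have hpi := Real.pi_pos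
  set δ : ℝ := (1 / 2 - w.re) / 2
  have hδ : 0 < δ := by simp only [δ]; linarith
  -- The ball must stay to the right of the imaginary axis, above the real axis, outside the unit
  -- circle and at distance δ from Re z = 1/2.
  set R : ℝ := min (min ε δ) (min w.re (min w.im (‖w‖ - 1)))
  have hR : 0 < R := by
    simp only [R, lt_min_iff]
    exact ⟨⟨hε, hδ⟩, hre, him, by linarith⟩
  have hRε : R ≤ ε := (min_le_left _ _).trans (min_le_left _ _)
  have hRδ : R ≤ δ := (min_le_left _ _).trans (min_le_right _ _)
  have hRre : R ≤ w.re := (min_le_right _ _).trans (min_le_left _ _)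
  have hRim : R ≤ w.im := (min_le_right _ _).trans ((min_le_right _ _).trans (min_le_left _ _))
  have hRn : R ≤ ‖w‖ - 1 := (min_le_right _ _).trans ((min_le_right _ _).trans (min_le_right _ _))
  have hball : ∀ z ∈ Metric.ball w R, 0 < z.re ∧ z.re ≤ 1 / 2 - δ ∧ 0 < z.im ∧
      z.im ≤ 2 * w.im ∧ 1 < ‖z‖ ∧ ‖z‖ ≤ 2 * ‖w‖ := by
    intro z hz
    rw [Metric.mem_ball, dist_eq_norm] at hz
    have h1 := abs_lt.mp ((Complex.abs_re_le_norm (z - w)).trans_lt hz)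
    have h2 := abs_lt.mp ((Complex.abs_im_le_norm (z - w)).trans_lt hz)
    have h3 := abs_lt.mp ((abs_norm_sub_norm_le z w).trans_lt hz)
    rw [Complex.sub_re] at h1
    rw [Complex.sub_im] at h2
    have h4 : w.re = 1 / 2 - 2 * δ := by simp only [δ]; ring
    refine ⟨?_, ?_, ?_, ?_, ?_, ?_⟩ <;> linarith [h1.1, h1.2, h2.1, h2.2, h3.1, h3.2]
  obtain ⟨r, hr, hrR, σ, hσ, himage⟩ := exists_ball_subset_image_of_hasDerivAt
    (hasDerivAt_phase α him) (deriv_phase_ne_zero α him hre hα hn) hR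
    (fun z hz => (hasDerivAt_phase α (hball z hz).2.2.1).continuousAt.continuousWithinAt)
  obtain ⟨K, hK⟩ := exists_approx_inner (2 * w.im) hκ hκ1 hδ (η := 1 / 2) (by norm_num)
  refine ⟨σ, hσ, ?_⟩
  have hkR : Tendsto (fun j => (k j : ℝ)) atTop atTop := tendsto_natCast_atTop_atTop.comp hk
  have hlim : Tendsto (fun j => 2 * Real.pi * |(m j : ℝ) / k j - α| * (2 * ‖w‖ + 1) + 1 / k j)
      atTop (𝓝 0) := by
    have h1 : Tendsto (fun j => |(m j : ℝ) / k j - α|) atTop (𝓝 0) := by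
      have := (hm.sub_const α).abs
      simpa using this
    have h2 : Tendsto (fun j => 1 / (k j : ℝ)) atTop (𝓝 0) :=
      tendsto_const_nhds.div_atTop hkR
    have := ((h1.const_mul (2 * Real.pi)).mul_const (2 * ‖w‖ + 1)).add h2
    simpa using this
  filter_upwards [hmk, hlim.eventually_le_const hσ, hk.eventually_ge_atTop (max K 3)]
    with j hj hjσ hjk τ hτ
  have hk3 : 3 ≤ k j := (le_max_right _ _).trans hjk
  have hQ : ∀ z ∈ Metric.ball w R, ‖tailQuotient (k j) (m j) z - 1‖ ≤ 1 / 2 := by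
    intro z hz
    obtain ⟨h1, h2, h3, h4, h5, -⟩ := hball z hz
    exact norm_tailQuotient_sub_one_le h3 (hK (k j) (m j) ((le_max_left _ _).trans hjk) (hev j) hj
      z (by rw [abs_of_pos h1]; exact h2) h5.le h3 h4)
  have hmem : (τ * Complex.I : ℂ) ∈ Metric.ball (phase α w) σ := by
    rw [hw, Metric.mem_ball, dist_eq_norm, ← sub_mul, norm_mul, Complex.norm_I, mul_one,
      ← Complex.ofReal_sub, Complex.norm_real]
    exact hτ
  obtain ⟨z, hz, hze⟩ := himage (exactPhase (k j) (m j))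
    (fun z hz => (differentiableAt_exactPhase hk3 (m j) (hball z hz).2.2.1
      (hQ z hz)).differentiableWithinAt)
    (fun z hz => by
      have hzb := Metric.closedBall_subset_ball hrR hz
      obtain ⟨-, -, -, -, h5, h6⟩ := hball z hzb
      refine (norm_exactPhase_sub_phase_le (by omega) α h5.le (hQ z hzb)).trans (le_trans ?_ hjσ)
      gcongr) hmem
  have hzb := Metric.closedBall_subset_ball hrR hz
  obtain ⟨h1, h2, h3, -, h5, -⟩ := hball z hzb
  refine ⟨z, (Metric.mem_closedBall.mp hz).trans (hrR.le.trans hRε), h1, by linarith, h3, h5, hze,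
    fun h0 => ?_⟩
  have := hQ z hzb
  rw [h0, zero_sub, norm_neg, norm_one] at this
  norm_num at this

theorem neg_conj_mem_curve {α : ℝ} {w : ℂ} (hw : w ∈ curve α) (hre' : w.re < 1 / 2)
    (him : 0 < w.im) (hn : 1 < ‖w‖) : -starRingEnd ℂ w ∈ curve α := by
  have hnorm : ‖-starRingEnd ℂ w‖ = ‖w‖ := by rw [norm_neg, RCLike.norm_conj]
  obtain ⟨h1, -, h3⟩ := hw
  have h4 : -(1 / 2) < w.re := ((mem_fundDomain_iff w).mp h1).2.2.1
  refine ⟨Or.inl ⟨by simpa using him, by rwa [hnorm], ?_, ?_⟩, by rwa [hnorm], ?_⟩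
  · simp only [Complex.neg_re, Complex.conj_re]
    linarith
  · simp only [Complex.neg_re, Complex.conj_re]
    linarith
  · rw [hnorm]
    simpa using h3

theorem mem_nearCurve_of_dist_le {α ε : ℝ} {z w : ℂ} (hw : w ∈ curve α) (hd : dist z w ≤ ε)
    (hre0 : z.re ≠ 0) (hre : |z.re| < 1 / 2) (him : 0 < z.im) (hn : 1 < ‖z‖) :
    z ∈ nearCurve α ε := by
  have hre2 := abs_lt.mp hre
  refine ⟨⟨Or.inl ⟨him, hn, hre2.1, hre2.2.le⟩, ?_⟩, ?_⟩
  · rintro ((⟨θ, -, rfl⟩ | ⟨t, -, rfl⟩) | ⟨t, -, rfl⟩)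
    · rw [Complex.norm_exp_ofReal_mul_I] at hn
      exact lt_irrefl _ hn
    · norm_num at hre2
    · simp at hre0
  · refine (Metric.infEDist_le_edist_of_mem hw).trans ?_
    rw [edist_dist]
    exact ENNReal.ofReal_le_ofReal hd

/-- Zeros occur where the exact phase equals i(2n+1)π/k. Different values are taken at different
points, so a phase interval of length π(C - 2η) yields about k(C - 2η)/2 zeros with Re z > 0. Their
reflections have Re z < 0, which doubles the count. -/
theorem exists_zeros_nearCurve {α κ ε ε' T : ℝ} {k m : ℕ → ℕ} (hα₀ : 0 < α)
    (hα₁ : α < 1 / (4 * Real.pi)) (hT : √3 / 2 < T) (hTα : heightFun T = α)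
    (hκ : 0 < κ) (hκ1 : κ ≤ 1) (hev : ∀ j, Even (k j)) (hk : Tendsto k atTop atTop)
    (hm : Tendsto (fun j => (m j : ℝ) / k j) atTop (𝓝 α))
    (hmk : ∀ᶠ j in atTop, 4 * Real.pi * m j ≤ (1 - κ) * k j) (hε : 0 < ε) (hε' : 0 < ε') :
    ∀ᶠ j in atTop, ∃ Z : Finset ℂ,
      (∀ z ∈ Z, poincare (k j) (m j) z = 0 ∧ z ∈ nearCurve α ε) ∧
      (curveProportion α T - ε') * k j ≤ (Z.card : ℝ) := by
  have hpi := Real.pi_pos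
  have hC := curveProportion_pos hT hTα
  set C := curveProportion α T
  set η : ℝ := min (ε' / 4) (C / 4)
  have hη : 0 < η := by positivity
  have hηε : η ≤ ε' / 4 := min_le_left _ _
  set a := Real.pi / 2 + Real.pi * η
  set b := Real.pi / 2 + Real.pi * (C - η)
  -- Compactness of the phase interval makes the threshold for j, which is local in τ, uniform. For
  -- this reason the endpoints are cut off by πη.
  have hloc : ∀ᶠ j in atTop, ∀ τ ∈ Set.Icc a b, ∃ z w : ℂ, w ∈ curve α ∧ w.re < 1 / 2 ∧
      0 < w.im ∧ 1 < ‖w‖ ∧ dist z w ≤ ε ∧ 0 < z.re ∧ z.re < 1 / 2 ∧ 0 < z.im ∧ 1 < ‖z‖ ∧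
        exactPhase (k j) (m j) z = τ * Complex.I ∧ tailQuotient (k j) (m j) z ≠ 0 := by
    refine (isCompact_Icc (a := a) (b := b)).induction_on
      (p := fun s : Set ℝ => ∀ᶠ j in atTop, ∀ τ ∈ s, ∃ z w : ℂ,
      w ∈ curve α ∧ w.re < 1 / 2 ∧
      0 < w.im ∧ 1 < ‖w‖ ∧ dist z w ≤ ε ∧ 0 < z.re ∧ z.re < 1 / 2 ∧ 0 < z.im ∧ 1 < ‖z‖ ∧
        exactPhase (k j) (m j) z = τ * Complex.I ∧ tailQuotient (k j) (m j) z ≠ 0)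
      ?_ ?_ ?_ ?_
    · simp
    · intro s t hst h
      filter_upwards [h] with j hj τ hτ using hj τ (hst hτ)
    · intro s t hs ht
      filter_upwards [hs, ht] with j hj hj' τ hτ
      exact hτ.elim (hj τ) (hj' τ)
    · intro τ₀ hτ₀
      have h1 : 0 < Real.pi * η := by positivity
      obtain ⟨w, hw, hre, hre', him, hn, hph⟩ := exists_mem_curve_phase_eq hα₀ hα₁ hT hTα
        (τ := τ₀) (by
          have := hτ₀.1
          simp only [a] at this
          linarith) (by
          have := hτ₀.2
          simp only [b, mul_sub] at this
          linarith)
      obtain ⟨σ, hσ, hσj⟩ := exists_exactPhase_eq hα₀.ne' hκ hκ1 hev hk hm hmk hre hre' him hn hph hε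
      refine ⟨Metric.ball τ₀ σ, mem_nhdsWithin_of_mem_nhds (Metric.ball_mem_nhds _ hσ), ?_⟩
      filter_upwards [hσj] with j hj τ hτ
      obtain ⟨z, hz1, hz⟩ := hj τ hτ
      exact ⟨z, w, hw, hre', him, hn, hz1, hz⟩
  have hkR : Tendsto (fun j => (k j : ℝ)) atTop atTop := tendsto_natCast_atTop_atTop.comp hk
  filter_upwards [hloc, hkR.eventually_ge_atTop (4 / ε'), hk.eventually_ge_atTop 3]
    with j hj hjk hk3
  have hk0 : (0 : ℝ) < k j := by exact_mod_cast (by omega : 0 < k j)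
  choose! z w hw hwre hwim hwn hd hre hre' him hn hph hQ using hj
  -- At these phases exp(-k · exactPhase) = -1, so the factored form of P vanishes.
  set τ : ℤ → ℝ := fun n => (2 * n + 1) * Real.pi / k j
  have hτinj : Function.Injective τ := by
    intro n n' h
    have h1 : (2 * (n : ℝ) + 1) * Real.pi = (2 * n' + 1) * Real.pi := by
      have := congrArg (· * (k j : ℝ)) h
      simpa [τ, hk0.ne'] using this
    have h2 := mul_right_cancel₀ hpi.ne' h1
    have h3 : (n : ℝ) = n' := by linarith
    exact_mod_cast h3
  set I : Finset ℤ := Finset.Icc ⌈(k j * a / Real.pi - 1) / 2⌉ ⌊(k j * b / Real.pi - 1) / 2⌋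
  have hI : ∀ n ∈ I, τ n ∈ Set.Icc a b := by
    intro n hn
    rw [Finset.mem_Icc, Int.ceil_le, Int.le_floor] at hn
    obtain ⟨h1, h2⟩ := hn
    rw [div_le_iff₀ two_pos, sub_le_iff_le_add, div_le_iff₀ hpi] at h1
    rw [le_div_iff₀ two_pos, le_sub_iff_add_le, le_div_iff₀ hpi] at h2
    simp only [τ]
    constructor
    · rw [le_div_iff₀ hk0]; linarith
    · rw [div_le_iff₀ hk0]; linarith
  have hzero : ∀ n ∈ I, poincare (k j) (m j) (z (τ n)) = 0 := by
    intro n hn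
    have h1 := hI n hn
    rw [poincare_eq_exactPhase (by omega) _ (him _ h1) (hQ _ h1), hph _ h1]
    have h2 : -((k j : ℂ) * ((τ n : ℝ) * Complex.I)) =
        Real.pi * Complex.I + ((-(n + 1) : ℤ) : ℂ) * (2 * Real.pi * Complex.I) := by
      have h3 : (k j : ℂ) ≠ 0 := by exact_mod_cast hk0.ne'
      simp only [τ]
      push_cast
      field_simp
      ring
    rw [h2, Complex.exp_add, Complex.exp_int_mul_two_pi_mul_I, Complex.exp_pi_mul_I]
    ring
  have hinj : Set.InjOn (fun n => z (τ n)) I := by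
    intro n hn n' hn' h
    have h1 := hph _ (hI n hn)
    have h2 : exactPhase (k j) (m j) (z (τ n)) = τ n' * Complex.I := by
      rw [show z (τ n) = z (τ n') from h]
      exact hph _ (hI n' hn')
    have h3 := mul_right_cancel₀ Complex.I_ne_zero (h1.symm.trans h2)
    exact hτinj (by exact_mod_cast h3)
  classical
  set Z := I.image fun n => z (τ n)
  have hZ : ∀ ζ ∈ Z, ∃ s ∈ Set.Icc a b, ζ = z s ∧ poincare (k j) (m j) ζ = 0 := by
    intro ζ hζ
    obtain ⟨n, hn, rfl⟩ := Finset.mem_image.mp hζ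
    exact ⟨τ n, hI n hn, rfl, hzero n hn⟩
  have hcard : (k j : ℝ) * (C - 2 * η) / 2 - 1 ≤ Z.card := by
    rw [Finset.card_image_of_injOn hinj, Int.card_Icc]
    have h1 := Int.ceil_lt_add_one ((k j * a / Real.pi - 1) / 2)
    have h2 := Int.lt_floor_add_one ((k j * b / Real.pi - 1) / 2)
    have h3 := Int.self_le_toNat (⌊(k j * b / Real.pi - 1) / 2⌋ + 1 - ⌈(k j * a / Real.pi - 1) / 2⌉)
    have h4 : ((⌊(k j * b / Real.pi - 1) / 2⌋ : ℝ) + 1 - ⌈(k j * a / Real.pi - 1) / 2⌉) ≤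
        ((⌊(k j * b / Real.pi - 1) / 2⌋ + 1 - ⌈(k j * a / Real.pi - 1) / 2⌉).toNat : ℝ) := by
      exact_mod_cast h3
    have h5 : (k j * b / Real.pi - 1) / 2 - (k j * a / Real.pi - 1) / 2 =
        (k j : ℝ) * (C - 2 * η) / 2 := by
      simp only [a, b]
      field_simp
      ring
    linarith
  have hrefl : Function.Injective fun ζ : ℂ => -starRingEnd ℂ ζ := fun ζ ζ' h =>
    (starRingEnd ℂ).injective (neg_injective h)
  have hdisj : Disjoint Z (Z.image fun ζ => -starRingEnd ℂ ζ) := by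
    rw [Finset.disjoint_left]
    intro ζ hζ hζ'
    obtain ⟨ζ', hζ'', rfl⟩ := Finset.mem_image.mp hζ'
    obtain ⟨s, hs, h1, -⟩ := hZ _ hζ
    obtain ⟨s', hs', h2, -⟩ := hZ _ hζ''
    have h3 := hre s hs
    have h4 := hre s' hs'
    rw [← h1, Complex.neg_re, Complex.conj_re] at h3
    rw [← h2] at h4
    linarith
  refine ⟨Z ∪ Z.image fun ζ => -starRingEnd ℂ ζ, fun ζ hζ => ?_, ?_⟩
  · rcases Finset.mem_union.mp hζ with h | h
    · obtain ⟨s, hs, rfl, h0⟩ := hZ ζ h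
      exact ⟨h0, mem_nearCurve_of_dist_le (hw s hs) (hd s hs) (hre s hs).ne'
        (by rw [abs_of_pos (hre s hs)]; exact hre' s hs) (him s hs) (hn s hs)⟩
    · obtain ⟨ζ', h', rfl⟩ := Finset.mem_image.mp h
      obtain ⟨s, hs, rfl, h0⟩ := hZ ζ' h'
      refine ⟨by rw [poincare_neg_conj _ _ (him s hs), h0, map_zero], ?_⟩
      refine mem_nearCurve_of_dist_le
        (neg_conj_mem_curve (hw s hs) (hwre s hs) (hwim s hs) (hwn s hs)) ?_ ?_ ?_ ?_ ?_
      · rw [dist_neg_neg, Complex.dist_conj_conj]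
        exact hd s hs
      · simpa using (hre s hs).ne'
      · rw [Complex.neg_re, Complex.conj_re, abs_neg, abs_of_pos (hre s hs)]
        exact hre' s hs
      · simpa using him s hs
      · rw [norm_neg, RCLike.norm_conj]
        exact hn s hs
  · rw [Finset.card_union_of_disjoint hdisj, Finset.card_image_of_injective _ hrefl]
    push_cast
    rw [div_le_iff₀ hε'] at hjk
    have h6 : η * k j ≤ ε' / 4 * k j := by gcongr
    nlinarith

/-! ### Comparison of the exhibited zeros with the valence inequality. -/

theorem mem_arc_of_norm_eq_one {z : ℂ} (hz : z ∈ fundDomain) (hn : ‖z‖ = 1) : z ∈ arc := by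
  rcases hz with ⟨-, h, -⟩ | ⟨-, -, h⟩
  · exact absurd hn h.ne'
  · have := Complex.norm_mul_exp_arg_mul_I z
    rw [hn] at this
    exact ⟨z.arg, h, by simpa using this.symm⟩

theorem mem_lineRho_iff {z : ℂ} : z ∈ lineRho ↔ z.re = 1 / 2 ∧ √3 / 2 ≤ z.im := by
  constructor
  · rintro ⟨t, ht, rfl⟩
    simpa using ht
  · rintro ⟨h1, h2⟩
    exact ⟨z.im, h2, by apply Complex.ext <;> simp [h1]⟩

theorem lineRho_subset_fundDomain : lineRho ⊆ fundDomain := by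
  intro z hz
  obtain ⟨h1, h2⟩ := mem_lineRho_iff.mp hz
  have h3 : (√3) ^ 2 = 3 := Real.sq_sqrt (by norm_num)
  have h4 : 0 < √3 := by positivity
  rw [mem_fundDomain_iff, h1]
  exact ⟨by linarith, by nlinarith, by norm_num, le_rfl, fun _ => by norm_num⟩

theorem I_mem_arc : Complex.I ∈ arc :=
  mem_arc_of_norm_eq_one (by rw [mem_fundDomain_iff]; norm_num) Complex.norm_I

theorem rho_mem_lineRho : rho ∈ lineRho := mem_lineRho_iff.mpr ⟨rfl, le_rfl⟩

theorem ellipticOrder_eq_one {z : ℂ} (h1 : z ≠ Complex.I) (h2 : z ≠ rho) : ellipticOrder z = 1 := by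
  rw [ellipticOrder, if_neg h1, if_neg h2]

theorem ellipticOrder_pos (z : ℂ) : 0 < ellipticOrder z := by
  unfold ellipticOrder
  split_ifs <;> norm_num

theorem ellipticOrder_le_three (z : ℂ) : ellipticOrder z ≤ 3 := by
  unfold ellipticOrder
  split_ifs <;> norm_num

theorem im_pos_of_mem_fundDomain {z : ℂ} (hz : z ∈ fundDomain) : 0 < z.im :=
  ((mem_fundDomain_iff z).mp hz).1

namespace IsCuspidal

variable {f : ℂ → ℂ} {l : ℕ}

/-- `analyticOrderNatAt` returns 0 at infinite order; one point where f does not vanish excludes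
this throughout the connected half plane. -/
theorem one_le_order (hf : IsCuspidal f l) {z₀ : ℂ} (hz₀ : 0 < z₀.im) (hne : f z₀ ≠ 0) {z : ℂ}
    (hz : 0 < z.im) (h : f z = 0) : 1 ≤ analyticOrderNatAt f z := by
  have hU : IsPreconnected {z : ℂ | 0 < z.im} := (convex_halfSpace_im_gt 0).isPreconnected
  have h1 : analyticOrderAt f z₀ ≠ ⊤ := by
    rw [(hf.analyticOnNhd z₀ hz₀).analyticOrderAt_eq_zero.mpr hne]
    exact ENat.zero_ne_top
  have h2 := hf.analyticOnNhd.analyticOrderAt_ne_top_of_isPreconnected hU hz₀ hz h1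
  rw [Nat.one_le_iff_ne_zero]
  intro h3
  have h4 : analyticOrderAt f z = 0 := by rw [← Nat.cast_analyticOrderNatAt h2, h3]; rfl
  exact (hf.analyticOnNhd z hz).analyticOrderAt_eq_zero.mp h4 h

/-- Each zero contributes at least 1/3 to the valence sum, whose bound is l/6, so l + 1 zeros are
too many. -/
theorem finite_zeros (hf : IsCuspidal f l) {z₀ : ℂ} (hz₀ : 0 < z₀.im) (hne : f z₀ ≠ 0) :
    {z ∈ fundDomain | f z = 0}.Finite := by
  by_contra hinf
  obtain ⟨S, hS, hcard⟩ := Set.Infinite.exists_subset_card_eq hinf (l + 1)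
  have h1 := hf.sum_order_le (S := S) fun z hz => (hS hz).1
  have h2 : ∑ z ∈ S, (1 / 3 : ℝ) ≤ ∑ z ∈ S, (analyticOrderNatAt f z / ellipticOrder z : ℝ) := by
    refine Finset.sum_le_sum fun z hz => ?_
    have h3 : (1 : ℝ) ≤ analyticOrderNatAt f z := by
      exact_mod_cast hf.one_le_order hz₀ hne (im_pos_of_mem_fundDomain (hS hz).1) (hS hz).2
    have h4 : (ellipticOrder z : ℝ) ≤ 3 := by exact_mod_cast ellipticOrder_le_three z
    have h5 : (0 : ℝ) < ellipticOrder z := by exact_mod_cast ellipticOrder_pos z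
    exact div_le_div₀ (by linarith) h3 h5 h4
  rw [Finset.sum_const, hcard, nsmul_eq_mul] at h2
  have h6 := h2.trans h1
  push_cast at h6
  have h7 : (0 : ℝ) ≤ l := by positivity
  linarith

open Classical in
theorem zeroCount_eq_sum (hfin : {z ∈ fundDomain | f z = 0}.Finite) {S : Set ℂ}
    (hS : S ⊆ fundDomain) :
    (zeroCount f S : ℝ) = ∑ z ∈ hfin.toFinset with z ∈ S, (analyticOrderNatAt f z : ℝ) := by
  rw [zeroCount, finsum_mem_eq_sum_of_inter_support_eq (t := {z ∈ hfin.toFinset | z ∈ S})]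
  · push_cast; rfl
  · ext z
    simp only [Set.mem_inter_iff, Function.mem_support, Finset.coe_filter, Set.Finite.mem_toFinset,
      Set.mem_ofPred_eq]
    constructor
    · rintro ⟨h1, h2⟩
      exact ⟨⟨⟨hS h1, apply_eq_zero_of_analyticOrderNatAt_ne_zero h2⟩, h1⟩, h2⟩
    · rintro ⟨⟨-, h1⟩, h2⟩
      exact ⟨h1, h2⟩

theorem card_le_zeroCount (hf : IsCuspidal f l) {z₀ : ℂ} (hz₀ : 0 < z₀.im) (hne : f z₀ ≠ 0)
    {S : Set ℂ} (hS : S ⊆ fundDomain) {Z : Finset ℂ} (hZ : ∀ z ∈ Z, z ∈ S ∧ f z = 0) :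
    (Z.card : ℝ) ≤ zeroCount f S := by
  classical
  rw [zeroCount_eq_sum (hf.finite_zeros hz₀ hne) hS, Finset.card_eq_sum_ones]
  push_cast
  refine le_trans (Finset.sum_le_sum (g := fun z => (analyticOrderNatAt f z : ℝ)) fun z hz => ?_)
    (Finset.sum_le_sum_of_subset_of_nonneg ?_ fun _ _ _ => by positivity)
  · exact_mod_cast hf.one_le_order hz₀ hne (im_pos_of_mem_fundDomain (hS (hZ z hz).1)) (hZ z hz).2
  · intro z hz
    simp only [Finset.mem_filter, Set.Finite.mem_toFinset, Set.mem_ofPred_eq]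
    exact ⟨⟨hS (hZ z hz).1, (hZ z hz).2⟩, (hZ z hz).1⟩

/-- If `Z` and `W` are sets of zeros other than `i` and `ρ`, with `W` inside `S` and `Z` outside,
then `S` has few zeros besides `W`. -/
theorem zeroCount_le (hf : IsCuspidal f l) {z₀ : ℂ} (hz₀ : 0 < z₀.im) (hne : f z₀ ≠ 0)
    {S : Set ℂ} (hS : S ⊆ fundDomain) {Z W : Finset ℂ}
    (hZ : ∀ z ∈ Z, z ∈ fundDomain ∧ z ≠ Complex.I ∧ z ≠ rho ∧ f z = 0) (hZS : ∀ z ∈ Z, z ∉ S)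
    (hW : ∀ z ∈ W, z ∈ S ∧ z ≠ Complex.I ∧ z ≠ rho ∧ f z = 0) :
    (zeroCount f S : ℝ) ≤ W.card + 3 * ((2 * l : ℕ) / 12 - Z.card - W.card) := by
  classical
  have hfin := hf.finite_zeros hz₀ hne
  set V : Finset ℂ := {z ∈ hfin.toFinset | z ∈ S}
  have hV : ∀ z ∈ V, z ∈ fundDomain ∧ z ∈ S ∧ f z = 0 := by
    intro z hz
    simp only [V, Finset.mem_filter, Set.Finite.mem_toFinset, Set.mem_ofPred_eq] at hz
    exact ⟨hz.1.1, hz.2, hz.1.2⟩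
  have hWV : W ⊆ V := by
    intro z hz
    simp only [V, Finset.mem_filter, Set.Finite.mem_toFinset, Set.mem_ofPred_eq]
    exact ⟨⟨hS (hW z hz).1, (hW z hz).2.2.2⟩, (hW z hz).1⟩
  have hdisj : Disjoint Z V := Finset.disjoint_left.mpr fun z hz hz' => hZS z hz (hV z hz').2.1
  have h1 := hf.sum_order_le (S := Z ∪ V) fun z hz =>
    (Finset.mem_union.mp hz).elim (fun h => (hZ z h).1) fun h => (hV z h).1
  rw [Finset.sum_union hdisj] at h1
  have h2 : (Z.card : ℝ) ≤ ∑ z ∈ Z, (analyticOrderNatAt f z / ellipticOrder z : ℝ) := by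
    rw [Finset.card_eq_sum_ones]
    push_cast
    refine Finset.sum_le_sum fun z hz => ?_
    obtain ⟨h3, h4, h5, h6⟩ := hZ z hz
    rw [ellipticOrder_eq_one h4 h5, Nat.cast_one, div_one]
    exact_mod_cast hf.one_le_order hz₀ hne (im_pos_of_mem_fundDomain h3) h6
  -- A zero in `S` has weight at least a third of its order. One in `W` has full weight, at least
  -- order/3 + 2/3. Solving the valence inequality for the total order gives the factor 3.
  have h7 : ∑ z ∈ V, ((analyticOrderNatAt f z : ℝ) / 3 + if z ∈ W then 2 / 3 else 0) ≤
      ∑ z ∈ V, (analyticOrderNatAt f z / ellipticOrder z : ℝ) := by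
    refine Finset.sum_le_sum fun z hz => ?_
    split_ifs with hzW
    · obtain ⟨h3, h4, h5, h6⟩ := hW z hzW
      rw [ellipticOrder_eq_one h4 h5, Nat.cast_one, div_one]
      have : (1 : ℝ) ≤ analyticOrderNatAt f z := by
        exact_mod_cast hf.one_le_order hz₀ hne (im_pos_of_mem_fundDomain (hS h3)) h6
      linarith
    · rw [add_zero]
      have h4 : (ellipticOrder z : ℝ) ≤ 3 := by exact_mod_cast ellipticOrder_le_three z
      have h5 : (0 : ℝ) < ellipticOrder z := by exact_mod_cast ellipticOrder_pos z
      gcongr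
  rw [Finset.sum_add_distrib, ← Finset.sum_div, ← zeroCount_eq_sum hfin hS, Finset.sum_ite_mem,
    Finset.inter_eq_right.mpr hWV, Finset.sum_const, nsmul_eq_mul] at h7
  linarith

end IsCuspidal

/-- The terms of the pairs `(0, 1)` and `(1, 0)` do not balance at a point slightly above `i`. -/
theorem exists_poincare_ne_zero {κ : ℝ} (hκ : 0 < κ) (hκ1 : κ ≤ 1) :
    ∃ K : ℕ, ∀ k m : ℕ, K ≤ k → Even k → 4 * Real.pi * m ≤ (1 - κ) * k →
      ∃ z : ℂ, 0 < z.im ∧ poincare k m z ≠ 0 := by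
  obtain ⟨K, hK⟩ := exists_approx_inner (1 + κ) hκ hκ1 (δ := 1 / 2) (by norm_num) (η := 1 / 2)
    (by norm_num)
  obtain ⟨K', hK'⟩ := exists_nat_ge (2 / κ ^ 2)
  refine ⟨max K K', fun k m hk hev hm => ?_⟩
  have hk1 : K ≤ k := (le_max_left _ _).trans hk
  have hkκ : 1 ≤ k * κ ^ 2 / 2 := by
    have h1 : (K' : ℝ) ≤ k := by exact_mod_cast (le_max_right _ _).trans hk
    rw [div_le_iff₀ (by positivity)] at hK'
    nlinarith [sq_nonneg κ]
  -- At height 1 the two terms have equal modulus. Raising it to 1 + κ separates their exponents by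
  -- at least kκ²/2.
  set y : ℝ := 1 + κ
  have hy : 0 < y := by positivity
  set z : ℂ := y * Complex.I
  have hzim : z.im = y := by simp [z]
  have hzre : z.re = 0 := by simp [z]
  have hz : 0 < z.im := by rw [hzim]; exact hy
  have hzn : ‖z‖ = y := by simp [z, abs_of_pos hy]
  refine ⟨z, hz, fun h0 => ?_⟩
  have h1 := hK k m hk1 hev hm z (by rw [hzre]; norm_num) (by rw [hzn]; simp only [y]; linarith) hz
    hzim.le
  rw [h0, zero_sub, norm_neg, hzim, hzn] at h1
  have h2 : ‖term k m 1 0 z‖ = termSize k m y y := by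
    have := norm_term_eq_termSize k m (c := 1) (d := 0) isCoprime_one_left z
    simpa [hzim, hzn] using this
  have h3 : ‖term k m 0 1 z‖ = Real.exp (-(2 * Real.pi * m * y)) := by
    have := norm_term_eq_termSize k m (c := 0) (d := 1) isCoprime_one_right z
    simpa [hzim, termSize] using this
  have h4 : ‖term k m 0 1 z‖ ≤ 3 / 2 * termSize k m y y := by
    have := norm_sub_le (term k m 0 1 z + term k m 1 0 z) (term k m 1 0 z)
    rw [add_sub_cancel_right, h2] at this
    linarith
  have h5 : Real.log y ≥ κ / y := by
    have := Real.one_sub_inv_le_log_of_pos hy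
    have h6 : 1 - y⁻¹ = κ / y := by
      rw [eq_div_iff hy.ne', sub_mul, inv_mul_cancel₀ hy.ne']
      simp only [y]
      ring
    linarith
  -- A gap of 1 in the exponents is a factor e ≥ 2, against the ratio 3/2 forced by a zero.
  have h7 : -(2 * Real.pi * m * (y / y ^ 2)) - k * Real.log y + 1 ≤ -(2 * Real.pi * m * y) := by
    have h8 : 2 * Real.pi * m * (y - y / y ^ 2) ≤ (1 - κ) * k / 2 * (y - y / y ^ 2) := by
      have h9 : 0 ≤ y - y / y ^ 2 := by
        rw [sub_nonneg, div_le_iff₀ (by positivity)]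
        have : 1 ≤ y ^ 2 := by simp only [y]; nlinarith
        nlinarith
      refine mul_le_mul_of_nonneg_right ?_ h9
      linarith
    have h10 : (1 - κ) * k / 2 * (y - y / y ^ 2) = k * (κ / y) - k * κ ^ 2 / 2 := by
      simp only [y] at hy ⊢
      field_simp
      ring
    have h11 : k * (κ / y) ≤ k * Real.log y := by gcongr
    nlinarith
  rw [h3, termSize_eq_exp _ _ _ hy] at h4
  have h12 := Real.exp_le_exp.mpr h7
  rw [Real.exp_add] at h12
  have h13 := Real.add_one_le_exp (1 : ℝ)
  have h14 := Real.exp_pos (-(2 * Real.pi * m * (y / y ^ 2)) - k * Real.log y)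
  nlinarith

/-- Divided by πk, the phase on the line tends to ψ(t) = arctan(2t)/π + α/(1/4 + t²). It grows by
1/2 - ψ(T) = P_ρ/12 from T to infinity. The term of (0,1) is dominated exactly where F(t) ≤ m/k,
which by monotonicity holds from slightly above T on. -/
theorem exists_zeros_lineRho {α κ ε T : ℝ} {k m : ℕ → ℕ}
    (hT : √3 / 2 < T) (hTα : heightFun T = α) (hκ : 0 < κ) (hκ1 : κ ≤ 1)
    (hev : ∀ j, Even (k j)) (hk : Tendsto k atTop atTop)
    (hm : Tendsto (fun j => (m j : ℝ) / k j) atTop (𝓝 α))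
    (hmk : ∀ᶠ j in atTop, 4 * Real.pi * m j ≤ (1 - κ) * k j) (hε : 0 < ε) :
    ∀ᶠ j in atTop, ∃ Z : Finset ℂ,
      (∀ z ∈ Z, poincare (k j) (m j) z = 0 ∧ z.re = 1 / 2 ∧ √3 / 2 < z.im) ∧
      (rhoProportion α T / 12 - ε) * k j ≤ (Z.card : ℝ) := by
  have hpi := Real.pi_pos
  have hv : ∀ t : ℝ, 0 < 1 / 4 + t ^ 2 := fun t => by positivity
  set ψ : ℝ → ℝ := fun t => Real.arctan (2 * t) / Real.pi + α / (1 / 4 + t ^ 2)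
  have hψc : Continuous ψ := by
    have h1 : Continuous fun t : ℝ => α / (1 / 4 + t ^ 2) :=
      continuous_const.div (by fun_prop) fun t => (hv t).ne'
    simp only [ψ]
    fun_prop
  have hψtop : Tendsto ψ atTop (𝓝 (1 / 2)) := by
    have h1 : Tendsto (fun t : ℝ => Real.arctan (2 * t)) atTop (𝓝 (Real.pi / 2)) :=
      (Real.tendsto_arctan_atTop.mono_right nhdsWithin_le_nhds).comp
        (tendsto_id.const_mul_atTop two_pos)
    have h2 : Tendsto (fun t : ℝ => α / (1 / 4 + t ^ 2)) atTop (𝓝 0) :=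
      tendsto_const_nhds.div_atTop
        (tendsto_atTop_add_const_left _ _ (tendsto_pow_atTop two_ne_zero))
    have h3 := (h1.div_const Real.pi).add h2
    have h4 : Real.pi / 2 / Real.pi + 0 = 1 / 2 := by field_simp; ring
    rwa [h4] at h3
  have hψT : rhoProportion α T / 12 = 1 / 2 - ψ T := by
    simp only [ψ, rhoProportion]
    ring
  -- Starting strictly above T gives F(a) < α, hence F(a) < m/k eventually, although m/k only tends
  -- to α.
  obtain ⟨a, haT, ha⟩ : ∃ a, T < a ∧ ψ a < ψ T + ε / 4 := by
    have h1 : ∀ᶠ t in 𝓝[>] T, ψ t < ψ T + ε / 4 :=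
      (hψc.continuousAt.eventually_lt_const (by linarith)).filter_mono nhdsWithin_le_nhds
    obtain ⟨a, h2, h3⟩ := (h1.and self_mem_nhdsWithin).exists
    exact ⟨a, h3, h2⟩
  obtain ⟨b, hab, hb⟩ : ∃ b, a ≤ b ∧ 1 / 2 - ε / 4 < ψ b := by
    obtain ⟨b, h1, h2⟩ := ((eventually_ge_atTop a).and
      (hψtop.eventually_const_lt (by linarith : 1 / 2 - ε / 4 < 1 / 2))).exists
    exact ⟨b, h1, h2⟩
  have ha3 : √3 / 2 < a := hT.trans haT
  have hFa : heightFun a < α := by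
    rw [← hTα]
    exact strictAntiOn_heightFun hT ha3 haT
  obtain ⟨K, hK⟩ := exists_zeros_line b hκ hκ1
  have hkR : Tendsto (fun j => (k j : ℝ)) atTop atTop := tendsto_natCast_atTop_atTop.comp hk
  have hL : Tendsto (fun j => (Real.arctan (2 * b) / Real.pi + (m j : ℝ) / k j / (1 / 4 + b ^ 2)) -
      (Real.arctan (2 * a) / Real.pi + (m j : ℝ) / k j / (1 / 4 + a ^ 2))) atTop
      (𝓝 (ψ b - ψ a)) :=
    (tendsto_const_nhds.add (hm.div_const _)).sub (tendsto_const_nhds.add (hm.div_const _))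
  filter_upwards [hmk, hk.eventually_ge_atTop K, hk.eventually_gt_atTop 0,
    hm.eventually_const_lt hFa, hkR.eventually_ge_atTop (8 / ε),
    hL.eventually_const_lt (by linarith : ψ b - ψ a - ε / 4 < ψ b - ψ a)]
    with j hj hjK hj0 hjF hjε hjL
  have hk0 : (0 : ℝ) < k j := by exact_mod_cast hj0
  obtain ⟨Z, hZ, hcard⟩ := hK (k j) (m j) hjK (hev j) hj a b ha3.le hab le_rfl (by
    intro t ht
    have ht3 : √3 / 2 < t := ha3.trans_le ht.1
    have ht0 : 0 < t := lt_trans (by positivity) ht3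
    have hF : heightFun t ≤ (m j : ℝ) / k j :=
      (strictAntiOn_heightFun.antitoneOn ha3 ht3 ht.1).trans hjF.le
    have hr := one_lt_sqrt_quarter_add ht3
    have hv1 : 0 < t ^ 2 - 3 / 4 := by
      rw [Real.lt_sqrt (by norm_num)] at hr
      linarith
    rw [heightFun, le_div_iff₀ hk0, one_div_mul_eq_div, div_div, div_mul_eq_mul_div,
      div_le_iff₀ (by positivity)] at hF
    have h1 : 2 * Real.pi * (m j : ℝ) * (t - t / (1 / 4 + t ^ 2)) =
        (m j * (t * (t ^ 2 - 3 / 4) * (4 * Real.pi))) / (2 * (1 / 4 + t ^ 2)) := by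
      have := hv t
      field_simp
      ring
    rw [h1, le_div_iff₀ (by positivity)]
    linarith)
  refine ⟨Z, fun z hz => ?_, ?_⟩
  · obtain ⟨h1, h2, h3, -⟩ := hZ z hz
    exact ⟨h1, h2, ha3.trans h3⟩
  · refine le_trans ?_ hcard
    have h1 : ((k j : ℝ) * Real.arctan (2 * b) + Real.pi * m j / (1 / 4 + b ^ 2) -
        (k j * Real.arctan (2 * a) + Real.pi * m j / (1 / 4 + a ^ 2))) / Real.pi =
        k j * ((Real.arctan (2 * b) / Real.pi + (m j : ℝ) / k j / (1 / 4 + b ^ 2)) -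
      (Real.arctan (2 * a) / Real.pi + (m j : ℝ) / k j / (1 / 4 + a ^ 2))) := by
      have h2 := (hv a).ne'
      have h3 := (hv b).ne'
      generalize 1 / 4 + a ^ 2 = u at *
      generalize 1 / 4 + b ^ 2 = v at *
      field_simp
    rw [h1, hψT]
    rw [div_le_iff₀ hε] at hjε
    nlinarith

/-- The proportions 1/12 - α, C and P_ρ/12 of the three disjoint families sum to 1/12, the valence
bound. The excess is thus o(k), which bounds from above both the zeros on the line and those
elsewhere. -/
theorem eventually_zeroCount_bounds {α κ ε ε' T : ℝ} {k m : ℕ → ℕ} (hα₀ : 0 < α)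
    (hα₁ : α < 1 / (4 * Real.pi)) (hT : √3 / 2 < T) (hTα : heightFun T = α)
    (hκ : 0 < κ) (hκ1 : κ ≤ 1) (hev : ∀ j, Even (k j)) (hk : Tendsto k atTop atTop)
    (hm : Tendsto (fun j => (m j : ℝ) / k j) atTop (𝓝 α))
    (hmk : ∀ᶠ j in atTop, 4 * Real.pi * m j ≤ (1 - κ) * k j) (hε : 0 < ε) (hε' : 0 < ε') :
    ∀ᶠ j in atTop, {z ∈ fundDomain | poincare (k j) (m j) z = 0}.Finite ∧
      (curveProportion α T - ε') * k j ≤ zeroCount (poincare (k j) (m j)) (nearCurve α ε) ∧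
      zeroCount (poincare (k j) (m j)) ((fundDomain \ (arc ∪ lineRho)) \ nearCurve α ε) ≤
        ε' * k j ∧
      |zeroCount (poincare (k j) (m j)) lineRho - rhoProportion α T * ((k j : ℝ) / 12)| ≤
        ε' * k j := by
  -- The families lose at most 4ηk together: 2ηk on the arc, where m ≤ (α + η) k is used, and ηk for
  -- each of the others. The factor 3 of `zeroCount_le` turns this into at most 12ηk.
  set η := ε' / 20
  have hη : 0 < η := by positivity
  obtain ⟨K, hK⟩ := exists_zeros_arc hκ hκ1 hη
  obtain ⟨K', hK'⟩ := exists_poincare_ne_zero hκ hκ1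
  filter_upwards [hmk, hk.eventually_ge_atTop (max (max K K') 6),
    exists_zeros_lineRho hT hTα hκ hκ1 hev hk hm hmk hη,
    exists_zeros_nearCurve hα₀ hα₁ hT hTα hκ hκ1 hev hk hm hmk hε hη,
    hm.eventually_const_lt hα₀, hm.eventually_lt_const (by linarith : α < α + η)]
    with j hj hjk ⟨ZL, hZL, hcardL⟩ ⟨ZN, hZN, hcardN⟩ hm0 hmη
  have hk6 : 6 ≤ k j := (le_max_right _ _).trans hjk
  have hk0 : (0 : ℝ) < k j := by exact_mod_cast (by omega : 0 < k j)
  -- For m = 0 the series is an Eisenstein series without the growth of a cusp form; α > 0 rules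
  -- this out for large indices.
  have hm1 : 1 ≤ m j := by
    rw [Nat.one_le_iff_ne_zero]
    intro h
    simp [h] at hm0
  obtain ⟨ZA, hZA, hcardA⟩ := hK (k j) (m j)
    (((le_max_left _ _).trans (le_max_left _ _)).trans hjk) (hev j) hj
  obtain ⟨z₀, hz₀, hne⟩ := hK' (k j) (m j)
    (((le_max_right _ _).trans (le_max_left _ _)).trans hjk) (hev j) hj
  rw [div_lt_iff₀ hk0] at hmη
  obtain ⟨l, hl⟩ : ∃ l, k j = 2 * l := ⟨_, (Nat.two_mul_div_two_of_even (hev j)).symm⟩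
  have hf : IsCuspidal (poincare (k j) (m j)) l := by
    rw [hl]
    exact isCuspidal_poincare (by omega) hm1
  set f := poincare (k j) (m j)
  have hA : ∀ z ∈ ZA, z ∈ fundDomain ∧ z ∈ arc ∧ z ∉ lineRho ∧ z ≠ Complex.I ∧ z ≠ rho ∧
      f z = 0 := by
    intro z hz
    obtain ⟨h0, him, hn, hre, hre'⟩ := hZA z hz
    have h1 : z ∈ fundDomain := by
      have := normSq_eq_re_im z
      rw [hn] at this
      rw [mem_fundDomain_iff]
      exact ⟨him, by linarith, by linarith, hre'.le, fun _ => hre.le⟩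
    have h2 : z ∉ lineRho := fun h => hre'.ne (mem_lineRho_iff.mp h).1
    exact ⟨h1, mem_arc_of_norm_eq_one h1 hn, h2, fun h => by simp [h] at hre,
      fun h => h2 (h ▸ rho_mem_lineRho), h0⟩
  have hL : ∀ z ∈ ZL, z ∈ lineRho ∧ z ≠ Complex.I ∧ z ≠ rho ∧ f z = 0 := by
    intro z hz
    obtain ⟨h0, hre, him⟩ := hZL z hz
    exact ⟨mem_lineRho_iff.mpr ⟨hre, him.le⟩, fun h => by norm_num [h] at hre,
      fun h => him.ne (by rw [h]; rfl), h0⟩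
  have hN : ∀ z ∈ ZN, z ∈ nearCurve α ε ∧ z ∈ fundDomain ∧ z ∉ arc ∧ z ∉ lineRho ∧
      z ≠ Complex.I ∧ z ≠ rho ∧ f z = 0 := by
    intro z hz
    obtain ⟨h0, h1⟩ := hZN z hz
    have h2 : z ∉ arc := fun h => h1.1.2 (Or.inl (Or.inl h))
    have h3 : z ∉ lineRho := fun h => h1.1.2 (Or.inl (Or.inr h))
    exact ⟨h1, h1.1.1, h2, h3, fun h => h2 (h ▸ I_mem_arc), fun h => h3 (h ▸ rho_mem_lineRho), h0⟩
  classical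
  have hAN : Disjoint ZA ZN :=
    Finset.disjoint_left.mpr fun z hz hz' => (hN z hz').2.2.1 (hA z hz).2.1
  have hANL : Disjoint (ZA ∪ ZN) ZL := by
    rw [Finset.disjoint_union_left]
    exact ⟨Finset.disjoint_left.mpr fun z hz hz' => (hA z hz).2.2.1 (hL z hz').1,
      Finset.disjoint_left.mpr fun z hz hz' => (hN z hz).2.2.2.1 (hL z hz').1⟩
  have hsum : curveProportion α T + rhoProportion α T / 12 = α := by
    rw [curveProportion, rhoProportion]
    ring
  have hkl : ((2 * l : ℕ) : ℝ) = k j := by rw [← hl]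
  have hlineRho := hf.zeroCount_le hz₀ hne lineRho_subset_fundDomain (Z := ZA ∪ ZN) (W := ZL)
    (fun z hz => (Finset.mem_union.mp hz).elim
      (fun h => ⟨(hA z h).1, (hA z h).2.2.2⟩) (fun h => ⟨(hN z h).2.1, (hN z h).2.2.2.2⟩))
    (fun z hz => (Finset.mem_union.mp hz).elim
      (fun h => (hA z h).2.2.1) (fun h => (hN z h).2.2.2.1)) hL
  have hrest := hf.zeroCount_le hz₀ hne (S := (fundDomain \ (arc ∪ lineRho)) \ nearCurve α ε)
    (fun z hz => hz.1.1) (Z := (ZA ∪ ZN) ∪ ZL) (W := ∅)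
    (fun z hz => by
      rcases Finset.mem_union.mp hz with h | h
      · exact (Finset.mem_union.mp h).elim
          (fun h => ⟨(hA z h).1, (hA z h).2.2.2⟩) (fun h => ⟨(hN z h).2.1, (hN z h).2.2.2.2⟩)
      · exact ⟨lineRho_subset_fundDomain (hL z h).1, (hL z h).2⟩)
    (fun z hz hzS => by
      rcases Finset.mem_union.mp hz with h | h
      · exact (Finset.mem_union.mp h).elim
          (fun h => hzS.1.2 (Or.inl (hA z h).2.1)) (fun h => hzS.2 (hN z h).1)
      · exact hzS.1.2 (Or.inr (hL z h).1))
    (by simp)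
  have hlow := hf.card_le_zeroCount hz₀ hne lineRho_subset_fundDomain (Z := ZL)
    fun z hz => ⟨(hL z hz).1, (hL z hz).2.2.2⟩
  have hnear := hf.card_le_zeroCount hz₀ hne (S := nearCurve α ε) (fun z hz => hz.1.1) (Z := ZN)
    fun z hz => ⟨(hN z hz).1, (hN z hz).2.2.2.2.2.2⟩
  rw [Finset.card_union_of_disjoint hAN, hkl] at hlineRho
  rw [Finset.card_union_of_disjoint hANL, Finset.card_union_of_disjoint hAN, hkl] at hrest
  push_cast [Finset.card_empty] at hlineRho hrest
  have hC : curveProportion α T * k j + rhoProportion α T / 12 * k j = α * k j := by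
    rw [← add_mul, hsum]
  have hηk : ε' * k j = 20 * (η * k j) := by simp only [η]; ring
  have hηk0 : 0 < η * k j := by positivity
  refine ⟨hf.finite_zeros hz₀ hne, by linarith, by linarith, ?_⟩
  rw [abs_le]
  constructor <;> linarith

end PoincareZeros

theorem theorem3 (α : ℝ) (hα₀ : 0 < α) (hα₁ : α < 1 / (4 * Real.pi)) :
    ∃ C T : ℝ, 0 < C ∧
      -- `T` is the unique solution `F⁻¹(α)` of `F(t) = α` in `t > √3/2`
      (√3 / 2 < T ∧ PoincareZeros.heightFun T = α ∧
        ∀ t : ℝ, √3 / 2 < t → PoincareZeros.heightFun t = α → t = T) ∧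
      ∀ k m : ℕ → ℕ, (∀ j, Even (k j)) → Tendsto k atTop atTop →
        (fun j => (m j : ℝ) - α * k j) =o[atTop] (fun j => (k j : ℝ)) →
        -- eventually there are only finitely many zeros, so that all the counts are genuine
        (∀ᶠ j in atTop,
          {z ∈ PoincareZeros.fundDomain | PoincareZeros.poincare (k j) (m j) z = 0}.Finite) ∧
        (∀ ε : ℝ, 0 < ε →
          (∃ e : ℕ → ℝ, e =o[atTop] (fun j => (k j : ℝ)) ∧
            ∀ j, C * k j + e j <
              (PoincareZeros.zeroCount (PoincareZeros.poincare (k j) (m j))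
                (PoincareZeros.nearCurve α ε) : ℝ)) ∧
          (fun j => (PoincareZeros.zeroCount (PoincareZeros.poincare (k j) (m j))
              ((PoincareZeros.fundDomain \ (PoincareZeros.arc ∪ PoincareZeros.lineRho)) \
                PoincareZeros.nearCurve α ε) : ℝ)) =o[atTop] (fun j => (k j : ℝ))) ∧
        (fun j => (PoincareZeros.zeroCount (PoincareZeros.poincare (k j) (m j))
            PoincareZeros.lineRho : ℝ) -
              PoincareZeros.rhoProportion α T * ((k j : ℝ) / 12)) =o[atTop]
          (fun j => (k j : ℝ)) := by
  have hpi := Real.pi_pos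
  obtain ⟨T, hT, hTα⟩ := PoincareZeros.exists_heightFun_eq hα₀ hα₁
  refine ⟨PoincareZeros.curveProportion α T, T, PoincareZeros.curveProportion_pos hT hTα,
    ⟨hT, hTα, fun t ht h =>
      PoincareZeros.strictAntiOn_heightFun.injOn ht hT (h.trans hTα.symm)⟩, ?_⟩
  intro k m hev hk hmo
  have hkR : Tendsto (fun j => (k j : ℝ)) atTop atTop := tendsto_natCast_atTop_atTop.comp hk
  have hm : Tendsto (fun j => (m j : ℝ) / k j) atTop (nhds α) := by
    have h1 := hmo.tendsto_div_nhds_zero.add_const α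
    rw [zero_add] at h1
    refine h1.congr' ?_
    filter_upwards [hkR.eventually_gt_atTop 0] with j hj
    field_simp
    ring
  rw [lt_div_iff₀ (by positivity)] at hα₁
  have hα₂ : α < 1 / (4 * Real.pi) := by rwa [lt_div_iff₀ (by positivity)]
  -- Half of the gap in 4πα < 1 is kept as a margin, the other half absorbs the deviation of m/k
  -- from α.
  set κ := (1 - α * (4 * Real.pi)) / 2
  have hκ : 0 < κ := by simp only [κ]; linarith
  have hκ1 : κ ≤ 1 := by
    have : 0 < α * (4 * Real.pi) := by positivity
    simp only [κ]
    linarith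
  have hmk : ∀ᶠ j in atTop, 4 * Real.pi * m j ≤ (1 - κ) * k j := by
    have h1 : α < (1 - κ) / (4 * Real.pi) := by
      rw [lt_div_iff₀ (by positivity)]
      simp only [κ]
      linarith
    filter_upwards [hm.eventually_lt_const h1, hkR.eventually_gt_atTop 0] with j hj hj0
    rw [div_lt_div_iff₀ hj0 (by positivity)] at hj
    linarith
  have key := fun {ε ε' : ℝ} (hε : 0 < ε) (hε' : 0 < ε') =>
    PoincareZeros.eventually_zeroCount_bounds hα₀ hα₂ hT hTα hκ hκ1 hev hk hm hmk hε hε'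
  refine ⟨(key one_pos one_pos).mono fun j hj => hj.1, fun ε hε => ⟨?_, ?_⟩, ?_⟩
  · set N : ℕ → ℝ := fun j => PoincareZeros.zeroCount (PoincareZeros.poincare (k j) (m j))
      (PoincareZeros.nearCurve α ε)
    -- The minimum makes the inequality valid for every index, also where the count may not be
    -- meaningful, and -1 makes it strict.
    refine ⟨fun j => min 0 (N j - PoincareZeros.curveProportion α T * k j) - 1, ?_, fun j => ?_⟩
    · refine IsLittleO.of_bound fun c hc => ?_
      filter_upwards [key hε (half_pos hc), hkR.eventually_ge_atTop (2 / c)] with j hj hjc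
      rw [div_le_iff₀ hc] at hjc
      have h1 : -(c / 2 * k j) ≤ N j - PoincareZeros.curveProportion α T * k j := by
        have := hj.2.1
        simp only [N]
        linarith
      have h2 : -(c / 2 * k j) ≤ min 0 (N j - PoincareZeros.curveProportion α T * k j) :=
        le_min (by linarith) h1
      have h3 := min_le_left 0 (N j - PoincareZeros.curveProportion α T * k j)
      rw [Real.norm_eq_abs, Real.norm_natCast, abs_of_nonpos (by linarith)]
      linarith
    · have := min_le_right 0 (N j - PoincareZeros.curveProportion α T * k j)
      change _ < N j
      linarith
  · refine IsLittleO.of_bound fun c hc => ?_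
    filter_upwards [key hε hc] with j hj
    rw [Real.norm_natCast, Real.norm_natCast]
    exact hj.2.2.1
  · refine IsLittleO.of_bound fun c hc => ?_
    filter_upwards [key one_pos hc] with j hj
    rw [Real.norm_eq_abs, Real.norm_natCast]
    exact hj.2.2.2
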